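/- Let $(\mathcal S,\mathcal A,\gamma,P,R)$ be a discounted Markov decision process with finite non-empty $\mathcal S,\mathcal A$, $D=|\mathcal S||\mathcal A|\ge 2$, $\gamma\in(0,1)$ and random rewards $R(s,a)\in[0,1]$ with means $r(s,a)$; no condition on optimal policies is imposed. Let $\lambda>0$ and, for $Q\in\mathbb R^D$, $(\mathcal L_\lambda Q)(s)=\max_\pi \mathbb E_{a\sim\pi(\cdot|s)}[Q(s,a)-\lambda\log\pi(a|s)]$. Let $Q^*_\lambda$ be the unique solution of $Q=r+\gamma P\mathcal L_\lambda Q$, and $\pi^*_\lambda$ the unique policy that attains the maximum in $(\mathcal L_\lambda Q^*_\lambda)(s)$ for every $s$. At each iteration $t\ge1$ one observes independent $r_t(s,a)\sim R(s,a)$ and $s_t(s,a)\sim P(\cdot|s,a)$ for all $(s,a)$, independently over $t$; the matrix $P_t$ has as $(s,a)$-th row the indicator vector of $s_t(s,a)$. From an arbitrary deterministic $\widetilde Q_0$ let $$\widetilde Q_t=(1-\eta_t)\widetilde Q_{t-1}+\eta_t\,(r_t+\gamma P_t\mathcal L_\lambda\widetilde Q_{t-1}),\qquad t\ge1 .$$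 Put $\widetilde Z=(r_t-r)+\gamma(P_t-P)\mathcal L_\lambda Q^*_\lambda$, let $P^{\pi^*_\lambda}$ be the state-action transition matrix of $\pi^*_\lambda$, and put $\widetilde{\mathrm{Var}}_Q=(I-\gamma P^{\pi^*_\lambda})^{-1}\mathrm{Var}(\widetilde Z)(I-\gamma P^{\pi^*_\lambda})^{-\top}$. Write $$H_T=(1+\lambda)\big[(1+(1-\gamma)\|\widetilde Q_0-Q^*_\lambda\|_\infty)(1+\ln D)(1+\ln T)\big]^k .$$ There are a universal constant $c>0$ and a universal exponent $k\in\mathbb N$ and, for every $\alpha\in(1/2,1)$, a constant $C_\alpha>0$ depending only on $\alpha$, such that for all such processes, all $\lambda$, $\widetilde Q_0$ and $T\ge1$: * if $\eta_0=1$ and $\eta_t=t^{-\alpha}$ for $t\ge1$, then $$\mathbb E\Big\|\frac1T\sum_{t=1}^T\widetilde Q_t-Q^*_\lambda\Big\|_\infty\le c\sqrt{\|\mathrm{diag}(\widetilde{\mathrm{Var}}_Q)\|_\infty}\sqrt{\frac{\ln D}{T}}+C_\alpha\frac{\sqrt{\ln D}}{(1-\gamma)^3}\frac1{T^{1-\alpha/2}}+C_\alpha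 H_T\left(\frac{1/\lambda}{(1-\gamma)^{3+\frac{2}{1-\alpha}}}\frac1T+\frac{\gamma/\lambda}{(1-\gamma)^{4+\frac1{1-\alpha}}}\frac1{T^\alpha}\right);$$ * if $\eta_t=\frac1{1+(1-\gamma)t}$, then $$\mathbb E\Big\|\frac1T\sum_{t=1}^T\widetilde Q_t-Q^*_\lambda\Big\|_\infty\le c\sqrt{\frac{\|\mathrm{Var}(\widetilde Z)\|_\infty}{(1-\gamma)^2}}\sqrt{\frac{\ln D}{T}}+c\,H_T\,\frac{1/\lambda}{(1-\gamma)^6}\frac1T .$$ -/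

import Mathlib

open MeasureTheory ProbabilityTheory

universe u v w

/-- A stationary randomized policy: `π.1 s a` is the probability `π(a | s)`. -/
abbrev Policy (S : Type*) (A : Type*) [Fintype A] :=
  {π : S → A → ℝ // ∀ s, π s ∈ stdSimplex ℝ A}

/-- A discounted infinite-horizon Markov decision process with random rewards:
discount factor `γ`, transition kernel `P` and reward laws `R`. -/
structure DiscountedMDP (S : Type*) (A : Type*) where
  γ : ℝ
  γ_pos : 0 < γ
  γ_lt_one : γ < 1
  P : S × A → PMF S
  R : S × A → Measure ℝ
  isProb : ∀ x, IsProbabilityMeasure (R x)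

/-- The norm `‖B‖_∞ = max_i ∑_j |B i j|` of a real matrix (the outer norm is the sup norm of
the vector of absolute row sums). -/
noncomputable def matInfNorm {ι : Type*} [Fintype ι] (B : Matrix ι ι ℝ) : ℝ :=
  ‖fun i => ∑ j, |B i j|‖

/-- The polynomial step size: `η_0 = 1` and `η_t = t ^ (-α)` for `t ≥ 1`. -/
noncomputable def polyStep (α : ℝ) (t : ℕ) : ℝ := if t = 0 then 1 else (t : ℝ) ^ (-α)

/-- The linearly rescaled step size `η_t = 1 / (1 + (1 - γ) t)`. -/
noncomputable def linStep (γ : ℝ) (t : ℕ) : ℝ := 1 / (1 + (1 - γ) * t)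

/-- The entropy-regularized value of `Q` under `π` at `s`:
`E_{a ∼ π(·|s)} [Q(s,a) - lam * log π(a|s)]`. -/
noncomputable def regValue {S A : Type*} [Fintype A] (lam : ℝ) (Q : S × A → ℝ)
    (π : Policy S A) (s : S) : ℝ :=
  ∑ a, π.1 s a * (Q (s, a) - lam * Real.log (π.1 s a))

/-- The soft maximum `(L_lam Q)(s) = max_π E_{a ∼ π(·|s)} [Q(s,a) - lam * log π(a|s)]`. -/
noncomputable def softMax {S A : Type*} [Fintype A] (lam : ℝ) (Q : S × A → ℝ) (s : S) : ℝ :=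
  ⨆ π : Policy S A, regValue lam Q π s

/-- Gibbs' inequality, termwise. -/
theorem gibbs_term {lam q Z p : ℝ} (hlam : 0 < lam) (hZ : 0 < Z) (hp : 0 ≤ p) :
    p * (q - lam * Real.log p) ≤ p * (lam * Real.log Z) + lam * (Real.exp (q / lam) / Z - p) ∧
    (p * (q - lam * Real.log p) = p * (lam * Real.log Z) + lam * (Real.exp (q / lam) / Z - p) →
      p = Real.exp (q / lam) / Z) := by
  have hz : 0 < Real.exp (q / lam) / Z := div_pos (Real.exp_pos _) hZ
  rcases hp.eq_or_lt with rfl | hp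
  · refine ⟨by simp; positivity, fun h => ?_⟩
    have : lam * (Real.exp (q / lam) / Z) = 0 := by simpa using h.symm
    exact absurd this (mul_pos hlam hz).ne'
  · have hq : q = lam * (Real.log (Real.exp (q / lam) / Z) + Real.log Z) := by
      rw [Real.log_div (Real.exp_pos _).ne' hZ.ne', Real.log_exp]
      field_simp
      ring
    set z := Real.exp (q / lam) / Z with hzdef
    have hlog : Real.log (z / p) = Real.log z - Real.log p := Real.log_div hz.ne' hp.ne'
    have e1 : p * (q - lam * Real.log p) = p * (lam * Real.log Z) + lam * (p * Real.log (z / p)) := by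
      rw [hlog]
      linear_combination p * hq
    have e2 : lam * (z - p) = lam * (p * (z / p - 1)) := by
      field_simp
    have hle : p * Real.log (z / p) ≤ p * (z / p - 1) :=
      mul_le_mul_of_nonneg_left (Real.log_le_sub_one_of_pos (div_pos hz hp)) hp.le
    refine ⟨by rw [e1, e2]; gcongr, fun h => ?_⟩
    by_contra hne
    have h1 : z / p ≠ 1 := fun h' => hne ((div_eq_one_iff_eq hp.ne').1 h').symm
    have := mul_lt_mul_of_pos_left
      (mul_lt_mul_of_pos_left (Real.log_lt_sub_one_of_pos (div_pos hz hp) h1) hp) hlam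
    rw [e1, e2] at h
    linarith

theorem regValue_le {S A : Type*} [Fintype A] [Nonempty A] {lam : ℝ} (hlam : 0 < lam)
    (Q : S × A → ℝ) (π : Policy S A) (s : S) :
    regValue lam Q π s ≤ lam * Real.log (∑ a, Real.exp (Q (s, a) / lam)) ∧
    (regValue lam Q π s = lam * Real.log (∑ a, Real.exp (Q (s, a) / lam)) →
      ∀ a, π.1 s a = Real.exp (Q (s, a) / lam) / ∑ b, Real.exp (Q (s, b) / lam)) := by
  set Z := ∑ a, Real.exp (Q (s, a) / lam) with hZdef
  have hZ : 0 < Z := Finset.sum_pos (fun a _ => Real.exp_pos _) Finset.univ_nonempty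
  have hg := fun a => gibbs_term (q := Q (s, a)) hlam hZ ((π.2 s).1 a)
  have hs : ∑ a, (π.1 s a * (lam * Real.log Z)
      + lam * (Real.exp (Q (s, a) / lam) / Z - π.1 s a)) = lam * Real.log Z := by
    rw [Finset.sum_add_distrib, ← Finset.sum_mul, ← Finset.mul_sum, Finset.sum_sub_distrib,
      ← Finset.sum_div, (π.2 s).2, ← hZdef, div_self hZ.ne']
    ring
  have hle := Finset.sum_le_sum fun a (_ : a ∈ Finset.univ) => (hg a).1
  refine ⟨hs ▸ hle, fun h a => (hg a).2 ?_⟩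
  exact (Finset.sum_eq_sum_iff_of_le fun a _ => (hg a).1).1 (h.trans hs.symm) a (Finset.mem_univ a)

theorem exists_regValue_eq {S A : Type*} [Fintype A] [Nonempty A] {lam : ℝ} (hlam : 0 < lam)
    (Q : S × A → ℝ) : ∃ π : Policy S A, ∀ s,
      regValue lam Q π s = lam * Real.log (∑ a, Real.exp (Q (s, a) / lam)) := by
  have hZ : ∀ s, 0 < ∑ a, Real.exp (Q (s, a) / lam) := fun s =>
    Finset.sum_pos (fun a _ => Real.exp_pos _) Finset.univ_nonempty
  refine ⟨⟨fun s a => Real.exp (Q (s, a) / lam) / ∑ b, Real.exp (Q (s, b) / lam),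
    fun s => ⟨fun a => div_nonneg (Real.exp_pos _).le (hZ s).le, ?_⟩⟩, fun s => ?_⟩
  · rw [← Finset.sum_div, div_self (hZ s).ne']
  · have : ∀ a, Q (s, a) - lam * Real.log (Real.exp (Q (s, a) / lam)
        / ∑ b, Real.exp (Q (s, b) / lam)) = lam * Real.log (∑ a, Real.exp (Q (s, a) / lam)) := by
      intro a
      rw [Real.log_div (Real.exp_pos _).ne' (hZ s).ne', Real.log_exp]
      field_simp
      ring
    simp only [regValue, this]
    rw [← Finset.sum_mul, ← Finset.sum_div, div_self (hZ s).ne', one_mul]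

theorem bddAbove_regValue {S A : Type*} [Fintype A] [Nonempty A] {lam : ℝ} (hlam : 0 < lam)
    (Q : S × A → ℝ) (s : S) : BddAbove (Set.range fun π : Policy S A => regValue lam Q π s) :=
  ⟨_, by rintro _ ⟨π, rfl⟩; exact (regValue_le hlam Q π s).1⟩

theorem softMax_eq {S A : Type*} [Fintype A] [Nonempty A] {lam : ℝ} (hlam : 0 < lam)
    (Q : S × A → ℝ) (s : S) :
    softMax lam Q s = lam * Real.log (∑ a, Real.exp (Q (s, a) / lam)) := by
  obtain ⟨π, hπ⟩ := exists_regValue_eq hlam Q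
  have : Nonempty (Policy S A) := ⟨π⟩
  exact le_antisymm (ciSup_le fun π' => (regValue_le hlam Q π' s).1)
    ((hπ s).symm.le.trans (le_ciSup (bddAbove_regValue hlam Q s) π))

/-- The policy that attains the maximum in `softMax lam Q` at every state
(it exists and is unique for `0 < lam`, see `softGreedy_spec`). -/
noncomputable def softGreedy {S A : Type*} [Fintype A] [Nonempty A] (lam : ℝ)
    (Q : S × A → ℝ) : Policy S A :=
  haveI : Nonempty (Policy S A) := by
    classical exact ⟨⟨fun _ => Pi.single (Classical.arbitrary A) 1, fun _ => single_mem_stdSimplex ℝ _⟩⟩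
  Classical.epsilon fun π : Policy S A => ∀ s, regValue lam Q π s = softMax lam Q s

theorem softGreedy_spec {S A : Type*} [Fintype A] [Nonempty A] {lam : ℝ} (hlam : 0 < lam)
    (Q : S × A → ℝ) :
    (∀ s, regValue lam Q (softGreedy lam Q) s = softMax lam Q s) ∧
    ∀ π : Policy S A, (∀ s, regValue lam Q π s = softMax lam Q s) → π = softGreedy lam Q := by
  obtain ⟨π₀, hπ₀⟩ := exists_regValue_eq hlam Q
  have h0 : ∃ π : Policy S A, ∀ s, regValue lam Q π s = softMax lam Q s :=
    ⟨π₀, fun s => (hπ₀ s).trans (softMax_eq hlam Q s).symm⟩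
  have hG : ∀ s, regValue lam Q (softGreedy lam Q) s = softMax lam Q s :=
    Classical.epsilon_spec_aux _ _ h0
  refine ⟨hG, fun π hπ => ?_⟩
  apply Subtype.ext
  funext s a
  rw [(regValue_le hlam Q π s).2 ((hπ s).trans (softMax_eq hlam Q s)) a,
    (regValue_le hlam Q _ s).2 ((hG s).trans (softMax_eq hlam Q s)) a]

theorem softMax_le_add {S A : Type*} [Fintype S] [Fintype A] [Nonempty A] {lam : ℝ}
    (hlam : 0 < lam) (Q Q' : S × A → ℝ) (s : S) :
    softMax lam Q s ≤ softMax lam Q' s + ‖Q - Q'‖ := by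
  rw [← (softGreedy_spec hlam Q).1 s]
  refine le_trans ?_ (add_le_add_left (le_ciSup (bddAbove_regValue hlam Q' s) (softGreedy lam Q)) _)
  set p := softGreedy lam Q
  have h1 : ∑ a, p.1 s a * ‖Q - Q'‖ = ‖Q - Q'‖ := by
    rw [← Finset.sum_mul, (p.2 s).2, one_mul]
  simp only [regValue]
  rw [← h1, ← Finset.sum_add_distrib]
  refine Finset.sum_le_sum fun a _ => ?_
  rw [← mul_add]
  refine mul_le_mul_of_nonneg_left ?_ ((p.2 s).1 a)
  have := (le_abs_self _).trans (norm_le_pi_norm (Q - Q') (s, a))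
  simp only [Pi.sub_apply] at this
  linarith

namespace DiscountedMDP

variable {S : Type u} {A : Type v} [Fintype S] [Fintype A]

instance (M : DiscountedMDP S A) (x : S × A) : IsProbabilityMeasure (M.R x) := M.isProb x

/-- The expected reward `r(s,a)`. -/
noncomputable def meanReward (M : DiscountedMDP S A) (x : S × A) : ℝ := ∫ y, y ∂(M.R x)

/-- The transition matrix `P`, with rows indexed by state-action pairs. -/
noncomputable def transMat (M : DiscountedMDP S A) : Matrix (S × A) S ℝ :=
  Matrix.of fun x s => (M.P x s).toReal

/-- The regularized Bellman operator `Q ↦ r + γ P (L_lam Q)`. -/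
noncomputable def softBellman (M : DiscountedMDP S A) (lam : ℝ) (Q : S × A → ℝ) : S × A → ℝ :=
  M.meanReward + M.γ • M.transMat.mulVec (softMax lam Q)

theorem sum_transMat (M : DiscountedMDP S A) (x : S × A) : ∑ s, M.transMat x s = 1 := by
  have h := (M.P x).tsum_coe
  rw [tsum_fintype] at h
  simp only [transMat, Matrix.of_apply]
  rw [← ENNReal.toReal_sum fun s _ => (M.P x).apply_ne_top s, h, ENNReal.toReal_one]

theorem softBellman_contracting [Nonempty A] (M : DiscountedMDP S A) {lam : ℝ} (hlam : 0 < lam) :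
    ContractingWith ⟨M.γ, M.γ_pos.le⟩ (M.softBellman lam) := by
  refine ⟨M.γ_lt_one, LipschitzWith.of_dist_le_mul fun Q Q' => ?_⟩
  rw [dist_eq_norm, dist_eq_norm]
  change _ ≤ M.γ * ‖Q - Q'‖
  refine (pi_norm_le_iff_of_nonneg (mul_nonneg M.γ_pos.le (norm_nonneg _))).2 fun x => ?_
  have hV : ∀ s, |softMax lam Q s - softMax lam Q' s| ≤ ‖Q - Q'‖ := fun s => by
    have h1 := softMax_le_add hlam Q Q' s
    have h2 := softMax_le_add hlam Q' Q s
    rw [norm_sub_rev] at h2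
    exact abs_le.2 ⟨by linarith, by linarith⟩
  have he : (M.softBellman lam Q - M.softBellman lam Q') x
      = M.γ * ∑ s, M.transMat x s * (softMax lam Q s - softMax lam Q' s) := by
    simp only [softBellman, Pi.sub_apply, Pi.add_apply, Pi.smul_apply, smul_eq_mul,
      Matrix.mulVec, dotProduct, mul_sub, Finset.sum_sub_distrib]
    ring
  rw [he, norm_mul, Real.norm_of_nonneg M.γ_pos.le]
  refine mul_le_mul_of_nonneg_left ?_ M.γ_pos.le
  calc ‖∑ s, M.transMat x s * (softMax lam Q s - softMax lam Q' s)‖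
      ≤ ∑ s, M.transMat x s * ‖Q - Q'‖ := by
        refine (norm_sum_le _ _).trans (Finset.sum_le_sum fun s _ => ?_)
        have h0 : 0 ≤ M.transMat x s := ENNReal.toReal_nonneg
        rw [norm_mul, Real.norm_of_nonneg h0]
        exact mul_le_mul_of_nonneg_left (hV s) h0
    _ = ‖Q - Q'‖ := by rw [← Finset.sum_mul, M.sum_transMat, one_mul]

/-- The fixed point `Q*_lam` of the regularized Bellman operator
(it exists and is unique for `0 < lam`, see `softQStar_spec`). -/
noncomputable def softQStar (M : DiscountedMDP S A) (lam : ℝ) : S × A → ℝ :=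
  Classical.epsilon fun Q => Q = M.softBellman lam Q

theorem softQStar_spec [Nonempty A] (M : DiscountedMDP S A) {lam : ℝ} (hlam : 0 < lam) :
    M.softQStar lam = M.softBellman lam (M.softQStar lam) ∧
    ∀ Q, Q = M.softBellman lam Q → Q = M.softQStar lam := by
  have hc := M.softBellman_contracting hlam
  have h : M.softQStar lam = M.softBellman lam (M.softQStar lam) :=
    Classical.epsilon_spec (p := fun Q => Q = M.softBellman lam Q)
      ⟨hc.fixedPoint, hc.fixedPoint_isFixedPt.symm⟩
  exact ⟨h, fun Q hQ => hc.fixedPoint_unique' hQ.symm h.symm⟩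

/-- The optimal policy `π*_lam` of the entropy-regularized problem. -/
noncomputable def softOptPolicy [Nonempty A] (M : DiscountedMDP S A) (lam : ℝ) : Policy S A :=
  softGreedy lam (M.softQStar lam)

/-- The law of one batch of observations `(r_t(s,a), s_t(s,a))_{(s,a)}` of the generative model:
all rewards `r_t(s,a) ∼ R(s,a)` and next states `s_t(s,a) ∼ P(·|s,a)` are independent. -/
noncomputable def obsLaw [MeasurableSpace S] (M : DiscountedMDP S A) :
    Measure (S × A → ℝ × S) :=
  Measure.pi fun x => (M.R x).prod (M.P x).toMeasure

/-- The sequence `o` of batches on the probability space `(Ω, μ)` is i.i.d. with law `obsLaw`. -/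
structure IsSample [MeasurableSpace S] (M : DiscountedMDP S A) {Ω : Type w} [MeasurableSpace Ω]
    (μ : Measure Ω) (o : ℕ → Ω → S × A → ℝ × S) : Prop where
  measurable : ∀ t, Measurable (o t)
  law : ∀ t, μ.map (o t) = M.obsLaw
  indep : iIndepFun o μ

/-- The iterates of synchronous entropy-regularized Q-learning,
`Q_t = (1 - η_t) Q_{t-1} + η_t (r_t + γ P_t (L_lam Q_{t-1}))`, along the observations `o`;
the entry `(s,a)` of `P_t V` is `V (s_t(s,a))`. -/
noncomputable def softIter (M : DiscountedMDP S A) (lam : ℝ) (η : ℕ → ℝ) (Q₀ : S × A → ℝ)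
    (o : ℕ → S × A → ℝ × S) : ℕ → S × A → ℝ
  | 0 => Q₀
  | t + 1 => fun x =>
      (1 - η (t + 1)) * softIter M lam η Q₀ o t x
        + η (t + 1) * ((o (t + 1) x).1
            + M.γ * softMax lam (softIter M lam η Q₀ o t) (o (t + 1) x).2)

/-- The averaged iterate `(1 / T) ∑_{t=1}^T Q_t`. -/
noncomputable def softAvg (M : DiscountedMDP S A) (lam : ℝ) (η : ℕ → ℝ) (Q₀ : S × A → ℝ)
    (o : ℕ → S × A → ℝ × S) (T : ℕ) : S × A → ℝ :=
  (T : ℝ)⁻¹ • ∑ t ∈ Finset.Icc 1 T, M.softIter lam η Q₀ o t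

/-- The regularized Bellman noise `Z = (r_t - r) + γ (P_t - P) (L_lam Q*_lam)` as a function of
one batch of observations. -/
noncomputable def softNoise (M : DiscountedMDP S A) (lam : ℝ) (ob : S × A → ℝ × S) (x : S × A) :
    ℝ :=
  ((ob x).1 - M.meanReward x)
    + M.γ * (softMax lam (M.softQStar lam) (ob x).2
        - M.transMat.mulVec (softMax lam (M.softQStar lam)) x)

/-- The covariance matrix `Var(Z) = E[Z Zᵀ]` of the regularized Bellman noise. -/
noncomputable def softNoiseVar [MeasurableSpace S] (M : DiscountedMDP S A) (lam : ℝ) :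
    Matrix (S × A) (S × A) ℝ :=
  Matrix.of fun x y => ∫ ob, M.softNoise lam ob x * M.softNoise lam ob y ∂M.obsLaw

/-- The matrix `Π^π`, with rows indexed by states. -/
def projMat [DecidableEq S] (π : Policy S A) : Matrix S (S × A) ℝ :=
  Matrix.of fun s x => if x.1 = s then π.1 s x.2 else 0

/-- The state-action transition matrix `P^π = P Π^π`. -/
noncomputable def policyMat [DecidableEq S] (M : DiscountedMDP S A) (π : Policy S A) :
    Matrix (S × A) (S × A) ℝ :=
  M.transMat * projMat π

/-- The asymptotic variance
`(I - γ P^{π*_lam})⁻¹ Var(Z) (I - γ P^{π*_lam})⁻ᵀ`. -/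
noncomputable def softAsymVar [DecidableEq S] [DecidableEq A] [Nonempty A] [MeasurableSpace S]
    (M : DiscountedMDP S A) (lam : ℝ) : Matrix (S × A) (S × A) ℝ :=
  (1 - M.γ • M.policyMat (M.softOptPolicy lam))⁻¹ * M.softNoiseVar lam
    * ((1 - M.γ • M.policyMat (M.softOptPolicy lam))⁻¹).transpose

end DiscountedMDP

/-! ### Sup-norm inequalities for bounded vector martingales. -/

section Martingale

variable {ι : Type*} [Fintype ι] {Ω : Type*} {mΩ : MeasurableSpace Ω}

/-! Write κ = 1 - γ, let Δ_t be the error of the iterate, δ = Δ_0, and K the state-action transition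
matrix of the soft optimal policy. The soft maximum is convex, its gradient at Q* is that policy,
and it exceeds its linearization by at most 2‖Δ‖²/λ (`softMax_sub_sub_le`). This smoothness replaces
any condition on optimal policies: the error obeys Δ_{t+1} = (1-η)Δ_t + η(γ(KΔ_t + ζ_t) + Z_t +
D_t), where Z is the i.i.d. noise at Q*, ζ is quadratic in Δ, and D is a martingale difference of
norm at most 2γ‖Δ‖. `IsPerturbedIter` records exactly this, and `IsSample.isPerturbedIter` shows
that Q-learning is an instance.

Polynomial steps. Solving the recursion for (I-γK)Δ_t, summing over t and inverting I-γK gives the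
sum of (I-γK)⁻¹Z_t, whose covariance is the asymptotic variance, plus remainders (`norm_sum_le`).
The telescoping remainder is Abel-summed and needs E‖Δ_t‖; the sums of D and ζ need the sum of
E‖Δ_t‖². The second moment is found first: subtracting the exponentially smoothed noise leaves a
residual that contracts pathwise at rate κη, so E‖Δ_t‖² is of order η_t after a burn-in τ =
(4/κ)^{1/(1-α)}. Then E‖Δ_t‖ is estimated again with Z and D filtered separately. The part of order
√η_t comes from Z alone and is free of the initial error and of λ; everything else is of order η_t.

Linearly rescaled steps. Here (1-κη_{t+1})η_t = η_{t+1}, so recursions with contraction 1-κη are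
solved exactly by dividing by η_t. The matrix γK is kept inside the filter, the residual is then
driven by ζ only, and the triangle inequality over time already yields √T/κ, without inverting I-γK.

Martingale tool. The sup norm is bounded through the logarithm of a symmetric exponential potential.
Its second-order increment is a variance weighted by a predictable probability vector, so a bound on
the mean of that weighted variance (`WeightedVarLe`) suffices. This matters for D, whose useful size
bound holds only on average.

Dependence on λ. The maximal entropy bonus shifts Q* and all iterates by the same constant
(`entropyValue`). After that shift the ranges, hence the noise bounds, do not involve λ log|A|; λ
enters the estimates only through ζ. -/

/-- A vector-valued bounded martingale difference sequence. The increment `X t` is revealed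
at time `t + 1` and is centered given the information `ℱ t`. -/
structure IsBoundedMDS (μ : Measure Ω) (ℱ : Filtration ℕ mΩ) (X : ℕ → Ω → ι → ℝ) (B : ℝ) :
    Prop where
  adapted : ∀ t i, Measurable[ℱ (t + 1)] fun ω => X t ω i
  bound : ∀ t ω, ‖X t ω‖ ≤ B
  centered : ∀ t i (g : Ω → ℝ), Measurable[ℱ t] g → (∃ C, ∀ ω, |g ω| ≤ C) →
    ∫ ω, g ω * X t ω i ∂μ = 0

/-- The coordinates of `X t`, mixed with weights known at time `t`, have second moment
at most `v`. -/
def WeightedVarLe (μ : Measure Ω) (ℱ : Filtration ℕ mΩ) (X : ℕ → Ω → ι → ℝ) (t : ℕ) (v : ℝ) :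
    Prop :=
  ∀ (q : ι → Ω → ℝ) (C : ℝ), (∀ i, Measurable[ℱ t] (q i)) → (∀ i ω, 0 ≤ q i ω) →
    (∀ ω, ∑ i, q i ω ≤ C) → ∫ ω, ∑ i, q i ω * X t ω i ^ 2 ∂μ ≤ C * v

/-- The logarithm of twice the number of coordinates. -/
noncomputable def logCard (ι : Type*) [Fintype ι] : ℝ := Real.log (2 * Fintype.card ι)

/-- The symmetric exponential potential. -/
noncomputable def coshSum (β : ℝ) (x : ι → ℝ) : ℝ :=
  ∑ i, (Real.exp (β * x i) + Real.exp (-(β * x i)))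

theorem coshSum_pos [Nonempty ι] (β : ℝ) (x : ι → ℝ) : 0 < coshSum β x :=
  Finset.sum_pos (fun _ _ => by positivity) Finset.univ_nonempty

theorem coshSum_zero (β : ℝ) : coshSum β (0 : ι → ℝ) = 2 * Fintype.card ι := by
  simp [coshSum]; ring

theorem exp_norm_le_coshSum [Nonempty ι] {β : ℝ} (hβ : 0 ≤ β) (x : ι → ℝ) :
    Real.exp (β * ‖x‖) ≤ coshSum β x := by
  obtain ⟨i, -, hi⟩ := Finset.exists_mem_eq_sup' Finset.univ_nonempty (fun i => ‖x i‖)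
  have hx : ‖x‖ = |x i| := by
    refine le_antisymm ((pi_norm_le_iff_of_nonneg (abs_nonneg _)).2 fun j => ?_)
      (norm_le_pi_norm x i)
    have := Finset.le_sup' (fun i => ‖x i‖) (Finset.mem_univ j)
    rw [hi] at this
    exact this
  have h1 : Real.exp (β * ‖x‖) ≤ Real.exp (β * x i) + Real.exp (-(β * x i)) := by
    rw [hx]
    rcases abs_cases (x i) with ⟨h, -⟩ | ⟨h, -⟩ <;> rw [h]
    · linarith [Real.exp_pos (-(β * x i))]
    · rw [mul_neg]; linarith [Real.exp_pos (β * x i)]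
  exact h1.trans (Finset.single_le_sum
    (f := fun i => Real.exp (β * x i) + Real.exp (-(β * x i)))
    (fun _ _ => by positivity) (Finset.mem_univ i))

/-- Coordinatewise Taylor expansion: |e^u - 1 - u| ≤ u² holds for |u| ≤ 1, which is why β b ≤ 1 is
needed throughout. -/
theorem coshSum_add_le {β b : ℝ} (hβ : 0 ≤ β) (hb : β * b ≤ 1) (x d : ι → ℝ) (hd : ‖d‖ ≤ b) :
    coshSum β (x + d) ≤ coshSum β x
      + β * ∑ i, (Real.exp (β * x i) - Real.exp (-(β * x i))) * d i
      + β ^ 2 * ∑ i, (Real.exp (β * x i) + Real.exp (-(β * x i))) * d i ^ 2 := by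
  simp only [coshSum]
  rw [Finset.mul_sum, Finset.mul_sum, ← Finset.sum_add_distrib, ← Finset.sum_add_distrib]
  refine Finset.sum_le_sum fun i _ => ?_
  have hdi : |β * d i| ≤ 1 := by
    rw [abs_mul, abs_of_nonneg hβ]
    exact (mul_le_mul_of_nonneg_left ((norm_le_pi_norm d i).trans hd) hβ).trans hb
  have h1 := (abs_le.1 (Real.abs_exp_sub_one_sub_id_le hdi)).2
  have h2 := (abs_le.1 (Real.abs_exp_sub_one_sub_id_le (x := -(β * d i)) (by rwa [abs_neg]))).2
  have e1 : Real.exp (β * (x + d) i) = Real.exp (β * x i) * Real.exp (β * d i) := by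
    rw [← Real.exp_add]; congr 1; simp; ring
  have e2 : Real.exp (-(β * (x + d) i)) = Real.exp (-(β * x i)) * Real.exp (-(β * d i)) := by
    rw [← Real.exp_add]; congr 1; simp; ring
  rw [e1, e2]
  have h1' := mul_le_mul_of_nonneg_left h1 (Real.exp_pos (β * x i)).le
  have h2' := mul_le_mul_of_nonneg_left h2 (Real.exp_pos (-(β * x i))).le
  nlinarith

theorem coshSum_le {β b : ℝ} (hβ : 0 ≤ β) {x : ι → ℝ} (hx : ‖x‖ ≤ b) :
    coshSum β x ≤ Fintype.card ι * (2 * Real.exp (β * b)) := by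
  have : ∀ i ∈ Finset.univ, Real.exp (β * x i) + Real.exp (-(β * x i)) ≤ 2 * Real.exp (β * b) := by
    intro i _
    have h := abs_le.1 ((norm_le_pi_norm x i).trans hx)
    have h1 : Real.exp (β * x i) ≤ Real.exp (β * b) :=
      Real.exp_le_exp.2 (mul_le_mul_of_nonneg_left h.2 hβ)
    have h2 : Real.exp (-(β * x i)) ≤ Real.exp (β * b) :=
      Real.exp_le_exp.2 (by rw [← mul_neg]; exact mul_le_mul_of_nonneg_left (by linarith) hβ)
    linarith
  refine (Finset.sum_le_card_nsmul _ _ _ this).trans ?_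
  simp

theorem integrable_of_abs_le {μ : Measure Ω} [IsFiniteMeasure μ] {f : Ω → ℝ} (hf : Measurable f)
    {C : ℝ} (hC : ∀ ω, |f ω| ≤ C) : Integrable f μ :=
  Integrable.of_bound hf.aestronglyMeasurable C (Filter.Eventually.of_forall hC)

theorem integral_le_add {μ : Measure Ω} {f f₁ f₂ : Ω → ℝ} (hf : Integrable f μ)
    (h₁ : Integrable f₁ μ) (h₂ : Integrable f₂ μ) (h : ∀ ω, f ω ≤ f₁ ω + f₂ ω) :
    ∫ ω, f ω ∂μ ≤ ∫ ω, f₁ ω ∂μ + ∫ ω, f₂ ω ∂μ := by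
  rw [← integral_add h₁ h₂]
  exact integral_mono hf (h₁.add h₂) h

theorem integral_le_add_add {μ : Measure Ω} {f f₁ f₂ f₃ : Ω → ℝ} (hf : Integrable f μ)
    (h₁ : Integrable f₁ μ) (h₂ : Integrable f₂ μ) (h₃ : Integrable f₃ μ)
    (h : ∀ ω, f ω ≤ f₁ ω + f₂ ω + f₃ ω) :
    ∫ ω, f ω ∂μ ≤ ∫ ω, f₁ ω ∂μ + ∫ ω, f₂ ω ∂μ + ∫ ω, f₃ ω ∂μ := by
  have := integral_le_add hf (h₁.add h₂) h₃ h
  rwa [integral_add' h₁ h₂] at this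

namespace IsBoundedMDS

variable {μ : Measure Ω} [IsProbabilityMeasure μ] {ℱ : Filtration ℕ mΩ}
  {Y : ℕ → Ω → ι → ℝ} {b : ℝ}

theorem measurable_coord (hY : IsBoundedMDS μ ℱ Y b) (t : ℕ) (i : ι) :
    Measurable fun ω => Y t ω i :=
  (hY.adapted t i).mono (ℱ.le _) le_rfl

theorem measurable (hY : IsBoundedMDS μ ℱ Y b) (t : ℕ) : Measurable (Y t) :=
  measurable_pi_lambda _ fun i => hY.measurable_coord t i

theorem abs_le (hY : IsBoundedMDS μ ℱ Y b) (t : ℕ) (ω : Ω) (i : ι) : |Y t ω i| ≤ b :=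
  (norm_le_pi_norm (Y t ω) i).trans (hY.bound t ω)

theorem measurable_sum (hY : IsBoundedMDS μ ℱ Y b) (n : ℕ) (i : ι) :
    Measurable[ℱ n] fun ω => (∑ j ∈ Finset.range n, Y j ω) i := by
  simp only [Finset.sum_apply]
  refine Finset.measurable_sum _ fun j hj => ?_
  exact (hY.adapted j i).mono (ℱ.mono (Finset.mem_range.1 hj)) le_rfl

theorem norm_sum_le (hY : IsBoundedMDS μ ℱ Y b) (n : ℕ) (ω : Ω) :
    ‖∑ j ∈ Finset.range n, Y j ω‖ ≤ n * b := by
  refine (norm_sum_le_of_le _ fun j _ => hY.bound j ω).trans ?_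
  simp

theorem measurable_coshSum (hY : IsBoundedMDS μ ℱ Y b) (β : ℝ) (n : ℕ) :
    Measurable[ℱ n] fun ω => coshSum β (∑ j ∈ Finset.range n, Y j ω) := by
  unfold coshSum
  refine Finset.measurable_sum _ fun i _ => ?_
  have := (hY.measurable_sum n i).const_mul β
  exact (Real.measurable_exp.comp this).add (Real.measurable_exp.comp this.neg)

theorem integral_centered (hY : IsBoundedMDS μ ℱ Y b) (t : ℕ) (g : ι → Ω → ℝ)
    (hg : ∀ i, Measurable[ℱ t] (g i)) {C : ℝ} (hC : ∀ i ω, |g i ω| ≤ C) :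
    Integrable (fun ω => ∑ i, g i ω * Y t ω i) μ ∧ ∫ ω, ∑ i, g i ω * Y t ω i ∂μ = 0 := by
  have hint : ∀ i, Integrable (fun ω => g i ω * Y t ω i) μ := fun i =>
    integrable_of_abs_le (C := C * b) (((hg i).mono (ℱ.le _) le_rfl).mul (hY.measurable_coord t i))
      fun ω => by
        rw [abs_mul]
        exact mul_le_mul (hC i ω) (hY.abs_le t ω i) (abs_nonneg _) ((abs_nonneg _).trans (hC i ω))
  refine ⟨integrable_finsetSum _ fun i _ => hint i, ?_⟩
  rw [integral_finsetSum _ fun i _ => hint i]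
  exact Finset.sum_eq_zero fun i _ => hY.centered t i (g i) (hg i) ⟨C, hC i⟩

theorem integrable_weighted_sq (hY : IsBoundedMDS μ ℱ Y b) (t : ℕ) (g : ι → Ω → ℝ)
    (hg : ∀ i, Measurable[ℱ t] (g i)) {C : ℝ} (hC : ∀ i ω, |g i ω| ≤ C) :
    Integrable (fun ω => ∑ i, g i ω * Y t ω i ^ 2) μ :=
  integrable_finsetSum _ fun i _ => integrable_of_abs_le (C := C * b ^ 2)
    (((hg i).mono (ℱ.le _) le_rfl).mul ((hY.measurable_coord t i).pow_const 2)) fun ω => by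
      rw [abs_mul, abs_pow]
      exact mul_le_mul (hC i ω) (pow_le_pow_left₀ (abs_nonneg _) (hY.abs_le t ω i) 2)
        (by positivity) ((abs_nonneg _).trans (hC i ω))

/-- Maximal inequality of Bernstein type for the expected sup norm of a martingale. -/
theorem integral_norm_sum_le [Nonempty ι] (hY : IsBoundedMDS μ ℱ Y b) {v : ℕ → ℝ} {n : ℕ}
    (hv : ∀ t < n, WeightedVarLe μ ℱ Y t (v t)) {β : ℝ} (hβ : 0 < β) (hβb : β * b ≤ 1) :
    ∫ ω, ‖∑ j ∈ Finset.range n, Y j ω‖ ∂μ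
      ≤ logCard ι / β + β * ∑ j ∈ Finset.range n, v j := by
  have hlogint : ∀ m, Integrable
      (fun ω => Real.log (coshSum β (∑ j ∈ Finset.range m, Y j ω))) μ := fun m => by
    refine integrable_of_abs_le (C := |Real.log (Fintype.card ι * (2 * Real.exp (β * (m * b))))|)
      (Real.measurable_log.comp ((hY.measurable_coshSum β m).mono (ℱ.le _) le_rfl)) fun ω => ?_
    have h1 : (1 : ℝ) ≤ coshSum β (∑ j ∈ Finset.range m, Y j ω) :=
      (Real.one_le_exp (by positivity)).trans (exp_norm_le_coshSum hβ.le _)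
    have h2 := coshSum_le hβ.le (hY.norm_sum_le m ω)
    rw [abs_of_nonneg (Real.log_nonneg h1)]
    exact (Real.log_le_log (by linarith) h2).trans (le_abs_self _)
  -- The logarithm is taken before the expectation. The potential then divides out of the increment,
  -- which leaves a centered term and a variance averaged over coordinates.
  have key : ∀ m ≤ n, ∫ ω, Real.log (coshSum β (∑ j ∈ Finset.range m, Y j ω)) ∂μ
      ≤ logCard ι + β ^ 2 * ∑ j ∈ Finset.range m, v j := by
    intro m
    induction m with
    | zero => intro _; simp [coshSum_zero, logCard]
    | succ m ih =>
      intro hm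
      have ih' := ih (by omega)
      set S : Ω → ι → ℝ := fun ω => ∑ j ∈ Finset.range m, Y j ω with hS
      have hpos : ∀ ω, 0 < coshSum β (S ω) := fun ω => coshSum_pos _ _
      set g : ι → Ω → ℝ := fun i ω =>
        (Real.exp (β * S ω i) - Real.exp (-(β * S ω i))) / coshSum β (S ω) with hg
      -- The normalized potential: a probability vector known at time m, and a coordinatewise bound
      -- for |g|.
      set p : ι → Ω → ℝ := fun i ω =>
        (Real.exp (β * S ω i) + Real.exp (-(β * S ω i))) / coshSum β (S ω) with hp
      have hme : ∀ i, Measurable[ℱ m] fun ω => β * S ω i := fun i =>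
        (hY.measurable_sum m i).const_mul β
      have hgm : ∀ i, Measurable[ℱ m] (g i) := fun i =>
        ((Real.measurable_exp.comp (hme i)).sub (Real.measurable_exp.comp (hme i).neg)).div
          (hY.measurable_coshSum β m)
      have hpm : ∀ i, Measurable[ℱ m] (p i) := fun i =>
        ((Real.measurable_exp.comp (hme i)).add (Real.measurable_exp.comp (hme i).neg)).div
          (hY.measurable_coshSum β m)
      have hp0 : ∀ i ω, 0 ≤ p i ω := fun i ω => div_nonneg (by positivity) (hpos ω).le
      have hpsum : ∀ ω, ∑ i, p i ω ≤ 1 := fun ω => by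
        simp only [hp]
        rw [← Finset.sum_div]
        exact (div_self (hpos ω).ne').le
      have hp1 : ∀ i ω, |p i ω| ≤ 1 := fun i ω => by
        rw [abs_of_nonneg (hp0 i ω)]
        exact (Finset.single_le_sum (f := fun i => p i ω) (fun i _ => hp0 i ω)
          (Finset.mem_univ i)).trans (hpsum ω)
      have hg1 : ∀ i ω, |g i ω| ≤ 1 := fun i ω => by
        refine le_trans ?_ (hp1 i ω)
        simp only [hg, hp, abs_div]
        refine div_le_div_of_nonneg_right ?_ (abs_nonneg _)
        rw [abs_of_pos (by positivity : 0 < Real.exp (β * S ω i) + Real.exp (-(β * S ω i))),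
          _root_.abs_le]
        constructor <;> linarith [Real.exp_pos (β * S ω i), Real.exp_pos (-(β * S ω i))]
      have hpt : ∀ ω, Real.log (coshSum β (∑ j ∈ Finset.range (m + 1), Y j ω))
          ≤ Real.log (coshSum β (S ω)) + β * ∑ i, g i ω * Y m ω i
            + β ^ 2 * ∑ i, p i ω * Y m ω i ^ 2 := fun ω => by
        rw [Finset.sum_range_succ]
        have h1 := coshSum_add_le hβ.le hβb (S ω) (Y m ω) (hY.bound m ω)
        have h2 : Real.log (coshSum β (S ω + Y m ω) / coshSum β (S ω))
            ≤ coshSum β (S ω + Y m ω) / coshSum β (S ω) - 1 :=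
          Real.log_le_sub_one_of_pos (div_pos (coshSum_pos _ _) (hpos ω))
        rw [Real.log_div (coshSum_pos _ _).ne' (hpos ω).ne'] at h2
        have h3 : coshSum β (S ω + Y m ω) / coshSum β (S ω) ≤ 1 + β * ∑ i, g i ω * Y m ω i
            + β ^ 2 * ∑ i, p i ω * Y m ω i ^ 2 := by
          rw [div_le_iff₀ (hpos ω)]
          refine h1.trans (le_of_eq ?_)
          have e1 : (∑ i, g i ω * Y m ω i) * coshSum β (S ω)
              = ∑ i, (Real.exp (β * S ω i) - Real.exp (-(β * S ω i))) * Y m ω i := by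
            rw [Finset.sum_mul]
            refine Finset.sum_congr rfl fun i _ => ?_
            simp only [hg]
            have := (hpos ω).ne'
            field_simp
          have e2 : (∑ i, p i ω * Y m ω i ^ 2) * coshSum β (S ω)
              = ∑ i, (Real.exp (β * S ω i) + Real.exp (-(β * S ω i))) * Y m ω i ^ 2 := by
            rw [Finset.sum_mul]
            refine Finset.sum_congr rfl fun i _ => ?_
            simp only [hp]
            have := (hpos ω).ne'
            field_simp
          rw [← e1, ← e2]
          ring
        linarith
      have hc := hY.integral_centered m g hgm hg1
      have hq := hY.integrable_weighted_sq m p hpm hp1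
      have hvm := hv m (by omega) p 1 hpm hp0 hpsum
      refine (integral_le_add_add (hlogint (m + 1)) (hlogint m) (hc.1.const_mul β)
        (hq.const_mul (β ^ 2)) hpt).trans ?_
      rw [integral_const_mul, integral_const_mul, hc.2, Finset.sum_range_succ]
      nlinarith [sq_nonneg β]
  have hnint : Integrable (fun ω => ‖∑ j ∈ Finset.range n, Y j ω‖) μ :=
    integrable_of_abs_le (C := n * b)
      ((Finset.measurable_sum _ fun j _ => hY.measurable j).norm) fun ω => by
        rw [abs_norm]; exact hY.norm_sum_le n ω
  have h1 : β * ∫ ω, ‖∑ j ∈ Finset.range n, Y j ω‖ ∂μ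
      ≤ ∫ ω, Real.log (coshSum β (∑ j ∈ Finset.range n, Y j ω)) ∂μ := by
    rw [← integral_const_mul]
    refine integral_mono (hnint.const_mul β) (hlogint n) fun ω => ?_
    have := Real.log_le_log (Real.exp_pos _)
      (exp_norm_le_coshSum hβ.le (∑ j ∈ Finset.range n, Y j ω))
    rwa [Real.log_exp] at this
  have h2 := h1.trans (key n le_rfl)
  rw [← mul_le_mul_iff_right₀ hβ]
  refine h2.trans (le_of_eq ?_)
  field_simp

/-- `integral_norm_sum_le` with the optimal value of the free parameter. -/
theorem integral_norm_sum_le_sqrt [Nonempty ι] (hY : IsBoundedMDS μ ℱ Y b) (hb : 0 < b)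
    {v : ℕ → ℝ} {n : ℕ} (hv : ∀ t < n, WeightedVarLe μ ℱ Y t (v t)) {V : ℝ} (hV0 : 0 ≤ V)
    (hV : ∑ j ∈ Finset.range n, v j ≤ V) :
    ∫ ω, ‖∑ j ∈ Finset.range n, Y j ω‖ ∂μ
      ≤ 2 * Real.sqrt (logCard ι * V) + logCard ι * b := by
  set l := logCard ι with hl
  have hcard : (1 : ℝ) ≤ Fintype.card ι := by exact_mod_cast Fintype.card_pos
  have hl0 : 0 < l := Real.log_pos (by linarith)
  -- The unconstrained optimum β = √(l/V) is admissible only if it is at most 1/b. In the other case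
  -- β = 1/b is used, and V/b ≤ √(lV).
  by_cases hcase : V * b⁻¹ ^ 2 ≤ l
  · have h := hY.integral_norm_sum_le hv (inv_pos.2 hb) (inv_mul_cancel₀ hb.ne').le
    have h2 : b⁻¹ * V ≤ Real.sqrt (l * V) := by
      apply Real.le_sqrt_of_sq_le
      calc (b⁻¹ * V) ^ 2 = (V * b⁻¹ ^ 2) * V := by ring
        _ ≤ l * V := by gcongr
    have h3 : b⁻¹ * ∑ j ∈ Finset.range n, v j ≤ b⁻¹ * V := by gcongr
    rw [div_inv_eq_mul] at h
    linarith [Real.sqrt_nonneg (l * V)]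
  · push Not at hcase
    have hVpos : 0 < V := by
      by_contra hcon
      have : V = 0 := le_antisymm (not_lt.1 hcon) hV0
      simp [this] at hcase
      linarith
    set β := Real.sqrt (l / V) with hβ
    have hβpos : 0 < β := Real.sqrt_pos.2 (div_pos hl0 hVpos)
    have hβb : β * b ≤ 1 := by
      have : β ≤ b⁻¹ := by
        rw [hβ]
        apply Real.sqrt_le_iff.2 ⟨by positivity, ?_⟩
        rw [div_le_iff₀ hVpos]
        linarith
      calc β * b ≤ b⁻¹ * b := by gcongr
        _ = 1 := inv_mul_cancel₀ hb.ne'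
    have h := hY.integral_norm_sum_le hv hβpos hβb
    have hsq : β ^ 2 = l / V := Real.sq_sqrt (div_pos hl0 hVpos).le
    have e1 : β * V = Real.sqrt (l * V) := by
      symm
      rw [Real.sqrt_eq_iff_mul_self_eq (by positivity) (by positivity)]
      have : β * V * (β * V) = β ^ 2 * V * V := by ring
      rw [this, hsq]; field_simp
    have e2 : l / β = β * V := by
      rw [div_eq_iff hβpos.ne']
      have : β * V * β = β ^ 2 * V := by ring
      rw [this, hsq]; field_simp
    have h3 : β * ∑ j ∈ Finset.range n, v j ≤ β * V := by gcongr
    rw [← hl, e2] at h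
    have : 0 ≤ l * b := by positivity
    linarith

/-- Second moment of the sup norm of a martingale with bounded increments. -/
theorem integral_norm_sum_sq_le [Nonempty ι] (hcard : 2 ≤ Fintype.card ι)
    (hY : IsBoundedMDS μ ℱ Y b) {c : ℕ → ℝ}
    (hc : ∀ t ω, ‖Y t ω‖ ≤ c t) {n : ℕ} {V : ℝ} (hV : 0 < V) (hbV : b ^ 2 ≤ V)
    (hcV : ∑ j ∈ Finset.range n, c j ^ 2 ≤ V) :
    ∫ ω, ‖∑ j ∈ Finset.range n, Y j ω‖ ^ 2 ∂μ ≤ 10 * logCard ι ^ 2 * V := by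
  set l := logCard ι with hl
  have hcard' : (2 : ℝ) ≤ Fintype.card ι := by exact_mod_cast hcard
  have hl1 : 1 ≤ l := by
    rw [hl, logCard, Real.le_log_iff_exp_le (by positivity)]
    linarith [Real.exp_one_lt_d9]
  have hexpl : Real.exp l = 2 * Fintype.card ι := Real.exp_log (by positivity)
  -- With β²V = 1 the potential grows by a factor of at most e ≤ e^l, so its mean stays below
  -- e^{2l}. This explains the truncation level 2l below.
  set β := (Real.sqrt V)⁻¹ with hβ
  have hβpos : 0 < β := inv_pos.2 (Real.sqrt_pos.2 hV)
  have hβsq : β ^ 2 * V = 1 := by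
    rw [hβ, inv_pow, Real.sq_sqrt hV.le, inv_mul_cancel₀ hV.ne']
  have hβb : β * b ≤ 1 := by
    rw [hβ, inv_mul_le_iff₀ (Real.sqrt_pos.2 hV), mul_one]
    exact Real.le_sqrt_of_sq_le hbV
  have hint : ∀ m, Integrable (fun ω => coshSum β (∑ j ∈ Finset.range m, Y j ω)) μ := fun m =>
    integrable_of_abs_le (C := Fintype.card ι * (2 * Real.exp (β * (m * b))))
      ((hY.measurable_coshSum β m).mono (ℱ.le _) le_rfl) fun ω => by
        rw [abs_of_pos (coshSum_pos _ _)]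
        exact coshSum_le hβpos.le (hY.norm_sum_le m ω)
  have key : ∀ m, ∫ ω, coshSum β (∑ j ∈ Finset.range m, Y j ω) ∂μ
      ≤ Real.exp l * Real.exp (β ^ 2 * ∑ j ∈ Finset.range m, c j ^ 2) := by
    intro m
    induction m with
    | zero => simp [coshSum_zero, hexpl]
    | succ m ih =>
      set S : Ω → ι → ℝ := fun ω => ∑ j ∈ Finset.range m, Y j ω with hS
      set g : ι → Ω → ℝ := fun i ω => Real.exp (β * S ω i) - Real.exp (-(β * S ω i)) with hg
      have hme : ∀ i, Measurable[ℱ m] fun ω => β * S ω i := fun i =>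
        (hY.measurable_sum m i).const_mul β
      have hgm : ∀ i, Measurable[ℱ m] (g i) := fun i =>
        (Real.measurable_exp.comp (hme i)).sub (Real.measurable_exp.comp (hme i).neg)
      have hg1 : ∀ i ω, |g i ω| ≤ Fintype.card ι * (2 * Real.exp (β * (m * b))) := fun i ω => by
        refine le_trans ?_ (coshSum_le hβpos.le (hY.norm_sum_le m ω))
        refine le_trans ?_ (Finset.single_le_sum
          (f := fun i => Real.exp (β * S ω i) + Real.exp (-(β * S ω i)))
          (fun _ _ => by positivity) (Finset.mem_univ i))
        rw [_root_.abs_le]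
        simp only [hg]
        constructor <;> linarith [Real.exp_pos (β * S ω i), Real.exp_pos (-(β * S ω i))]
      have hpt : ∀ ω, coshSum β (∑ j ∈ Finset.range (m + 1), Y j ω)
          ≤ (1 + β ^ 2 * c m ^ 2) * coshSum β (S ω) + β * ∑ i, g i ω * Y m ω i := fun ω => by
        rw [Finset.sum_range_succ]
        have h1 := coshSum_add_le hβpos.le hβb (S ω) (Y m ω) (hY.bound m ω)
        have h2 : ∑ i, (Real.exp (β * S ω i) + Real.exp (-(β * S ω i))) * Y m ω i ^ 2
            ≤ coshSum β (S ω) * c m ^ 2 := by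
          rw [coshSum, Finset.sum_mul]
          refine Finset.sum_le_sum fun i _ => mul_le_mul_of_nonneg_left ?_ (by positivity)
          exact sq_le_sq' (_root_.abs_le.1 ((norm_le_pi_norm (Y m ω) i).trans (hc m ω))).1
            (_root_.abs_le.1 ((norm_le_pi_norm (Y m ω) i).trans (hc m ω))).2
        have h3 := mul_le_mul_of_nonneg_left h2 (sq_nonneg β)
        linarith
      have hcen := hY.integral_centered m g hgm hg1
      have := integral_mono (hint (m + 1))
        (((hint m).const_mul (1 + β ^ 2 * c m ^ 2)).add (hcen.1.const_mul β)) hpt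
      refine this.trans ?_
      simp only [Pi.add_apply]
      rw [integral_add ((hint m).const_mul _) (hcen.1.const_mul β), integral_const_mul,
        integral_const_mul, hcen.2, mul_zero, add_zero, Finset.sum_range_succ, mul_add,
        Real.exp_add]
      have h4 : 1 + β ^ 2 * c m ^ 2 ≤ Real.exp (β ^ 2 * c m ^ 2) := by
        linarith [Real.add_one_le_exp (β ^ 2 * c m ^ 2)]
      calc _ ≤ (1 + β ^ 2 * c m ^ 2)
            * (Real.exp l * Real.exp (β ^ 2 * ∑ j ∈ Finset.range m, c j ^ 2)) := by gcongr
        _ ≤ Real.exp (β ^ 2 * c m ^ 2)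
            * (Real.exp l * Real.exp (β ^ 2 * ∑ j ∈ Finset.range m, c j ^ 2)) := by gcongr
        _ = _ := by ring
  have hkey : ∫ ω, coshSum β (∑ j ∈ Finset.range n, Y j ω) ∂μ ≤ Real.exp (2 * l) := by
    refine (key n).trans ?_
    rw [← Real.exp_add]
    apply Real.exp_le_exp.2
    have : β ^ 2 * ∑ j ∈ Finset.range n, c j ^ 2 ≤ β ^ 2 * V := by gcongr
    linarith
  -- Above the level m the square is dominated by the second-order expansion of e^{y-m}; the factor
  -- e^{-m} later cancels the mean of the potential.
  have hsq : ∀ y m : ℝ, 0 ≤ y → 0 ≤ m → y ^ 2 ≤ m ^ 2 + 2 * (m + 1) * (Real.exp (-m) * Real.exp y) := by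
    intro y m hy hm
    rw [← Real.exp_add]
    rcases le_total y m with h | h
    · have : 0 ≤ 2 * (m + 1) * Real.exp (-m + y) := by positivity
      nlinarith
    · have h1 : 1 + (y - m) + (y - m) ^ 2 / 2 ≤ Real.exp (-m + y) := by
        have := Real.quadratic_le_exp_of_nonneg (sub_nonneg.2 h)
        rwa [show -m + y = y - m by ring]
      nlinarith [mul_nonneg hm (sq_nonneg (y - m))]
  have hnint : Integrable (fun ω => ‖∑ j ∈ Finset.range n, Y j ω‖ ^ 2) μ :=
    integrable_of_abs_le (C := (n * b) ^ 2)
      ((Finset.measurable_sum _ fun j _ => hY.measurable j).norm.pow_const 2) fun ω => by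
        rw [abs_pow, abs_norm]
        exact pow_le_pow_left₀ (norm_nonneg _) (hY.norm_sum_le n ω) 2
  have h1 : β ^ 2 * ∫ ω, ‖∑ j ∈ Finset.range n, Y j ω‖ ^ 2 ∂μ
      ≤ (2 * l) ^ 2 + 2 * (2 * l + 1) := by
    have hpt : ∀ ω, β ^ 2 * ‖∑ j ∈ Finset.range n, Y j ω‖ ^ 2 ≤ (2 * l) ^ 2
        + 2 * (2 * l + 1) * (Real.exp (-(2 * l)) * coshSum β (∑ j ∈ Finset.range n, Y j ω)) := by
      intro ω
      rw [← mul_pow]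
      refine (hsq _ (2 * l) (by positivity) (by positivity)).trans ?_
      gcongr
      exact exp_norm_le_coshSum hβpos.le _
    have := integral_mono (hnint.const_mul (β ^ 2))
      ((integrable_const ((2 * l) ^ 2)).add (((hint n).const_mul _).const_mul _)) hpt
    rw [integral_const_mul] at this
    refine this.trans ?_
    simp only [Pi.add_apply]
    rw [integral_add (integrable_const _) (((hint n).const_mul _).const_mul _), integral_const_mul,
      integral_const_mul, integral_const]
    have h2 : Real.exp (-(2 * l)) * ∫ ω, coshSum β (∑ j ∈ Finset.range n, Y j ω) ∂μ ≤ 1 := by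
      calc _ ≤ Real.exp (-(2 * l)) * Real.exp (2 * l) := by gcongr
        _ = 1 := by rw [← Real.exp_add]; simp
    have h3 : 2 * (2 * l + 1) * (Real.exp (-(2 * l))
        * ∫ ω, coshSum β (∑ j ∈ Finset.range n, Y j ω) ∂μ) ≤ 2 * (2 * l + 1) * 1 := by gcongr
    simpa using h3
  have h2 : ∫ ω, ‖∑ j ∈ Finset.range n, Y j ω‖ ^ 2 ∂μ
      = V * (β ^ 2 * ∫ ω, ‖∑ j ∈ Finset.range n, Y j ω‖ ^ 2 ∂μ) := by
    rw [← mul_assoc, mul_comm V, hβsq, one_mul]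
  rw [h2]
  calc _ ≤ V * ((2 * l) ^ 2 + 2 * (2 * l + 1)) := by gcongr
    _ ≤ V * (10 * l ^ 2) := by gcongr; nlinarith
    _ = _ := by ring

end IsBoundedMDS

end Martingale

/-! ### Linear recursions with matrix coefficients and their weights. -/

section Filter

variable {ι : Type*} [Fintype ι]

theorem norm_mulVec_le {M : Matrix ι ι ℝ} {c : ℝ} (hM : ∀ i k, 0 ≤ M i k)
    (hc : ∀ i, ∑ k, M i k ≤ c) (hc0 : 0 ≤ c) (x : ι → ℝ) : ‖M.mulVec x‖ ≤ c * ‖x‖ := by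
  refine (pi_norm_le_iff_of_nonneg (by positivity)).2 fun i => ?_
  calc ‖∑ k, M i k * x k‖ ≤ ∑ k, M i k * ‖x‖ := by
        refine norm_sum_le_of_le _ fun k _ => ?_
        rw [norm_mul, Real.norm_of_nonneg (hM i k)]
        exact mul_le_mul_of_nonneg_left (norm_le_pi_norm x k) (hM i k)
    _ = (∑ k, M i k) * ‖x‖ := by rw [Finset.sum_mul]
    _ ≤ c * ‖x‖ := by gcongr; exact hc i

/-- Cauchy–Schwarz with the row of M as a measure. -/
theorem sq_mulVec_le {M : Matrix ι ι ℝ} {c : ℝ} (hM : ∀ i k, 0 ≤ M i k)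
    (hc : ∀ i, ∑ k, M i k ≤ c) (x : ι → ℝ) (i : ι) :
    M.mulVec x i ^ 2 ≤ c * ∑ k, M i k * x k ^ 2 := by
  have h := Finset.sum_sq_le_sum_mul_sum_of_sq_le_mul Finset.univ
    (r := fun k => M i k * x k) (f := fun k => M i k) (g := fun k => M i k * x k ^ 2)
    (fun k _ => hM i k) (fun k _ => mul_nonneg (hM i k) (sq_nonneg _)) (fun k _ => le_of_eq (by ring))
  refine h.trans (mul_le_mul_of_nonneg_right (hc i) ?_)
  exact Finset.sum_nonneg fun k _ => mul_nonneg (hM i k) (sq_nonneg _)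

/-- The output of the linear recursion `N (t+1) = A t N t + η (t+1) X t` started at `0`. -/
noncomputable def linFilter (A : ℕ → Matrix ι ι ℝ) (η : ℕ → ℝ) (X : ℕ → ι → ℝ) : ℕ → ι → ℝ
  | 0 => 0
  | t + 1 => (A t).mulVec (linFilter A η X t) + η (t + 1) • X t

open Classical in
/-- The weight of the input `X j` in `linFilter A η X t`. -/
noncomputable def filterKernel (A : ℕ → Matrix ι ι ℝ) (η : ℕ → ℝ) (j : ℕ) : ℕ → Matrix ι ι ℝ
  | 0 => 0
  | t + 1 => if j = t then η (t + 1) • 1 else A t * filterKernel A η j t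

/-- The scalar version of `filterKernel`. -/
noncomputable def filterWeight (a : ℕ → ℝ) (η : ℕ → ℝ) (j : ℕ) : ℕ → ℝ
  | 0 => 0
  | t + 1 => if j = t then η (t + 1) else a t * filterWeight a η j t

variable {A : ℕ → Matrix ι ι ℝ} {a η : ℕ → ℝ}

/-- At a fixed time t the output is a sum over j with deterministic matrix coefficients, so
martingale inputs give a martingale sum in j. -/
theorem linFilter_eq_sum (X : ℕ → ι → ℝ) (t : ℕ) :
    linFilter A η X t = ∑ j ∈ Finset.range t, (filterKernel A η j t).mulVec (X j) := by
  classical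
  induction t with
  | zero => simp [linFilter]
  | succ t ih =>
    rw [Finset.sum_range_succ, linFilter, ih, Matrix.mulVec_sum]
    congr 1
    · refine Finset.sum_congr rfl fun j hj => ?_
      rw [filterKernel, if_neg (Finset.mem_range.1 hj).ne, Matrix.mulVec_mulVec]
    · rw [filterKernel, if_pos rfl, Matrix.smul_mulVec, Matrix.one_mulVec]

theorem linFilter_add (X Y : ℕ → ι → ℝ) (t : ℕ) :
    linFilter A η (fun j => X j + Y j) t = linFilter A η X t + linFilter A η Y t := by
  simp only [linFilter_eq_sum, Matrix.mulVec_add, Finset.sum_add_distrib]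

theorem filterKernel_nonneg (hA : ∀ t i k, 0 ≤ A t i k) (hη : ∀ t, 0 ≤ η t) (j t : ℕ) (i k : ι) :
    0 ≤ filterKernel A η j t i k := by
  classical
  induction t generalizing i k with
  | zero => exact le_rfl
  | succ t ih =>
    rw [filterKernel]
    split_ifs
    · rw [Matrix.smul_apply, Matrix.one_apply]
      split_ifs <;> simp [hη]
    · rw [Matrix.mul_apply]
      exact Finset.sum_nonneg fun l _ => mul_nonneg (hA _ _ _) (ih _ _)

theorem sum_filterKernel (hA : ∀ t i, ∑ k, A t i k = a t) (j t : ℕ) (i : ι) :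
    ∑ k, filterKernel A η j t i k = filterWeight a η j t := by
  classical
  induction t generalizing i with
  | zero => simp [filterKernel, filterWeight]
  | succ t ih =>
    rw [filterKernel, filterWeight]
    split_ifs
    · simp [Matrix.one_apply]
    · simp only [Matrix.mul_apply]
      rw [Finset.sum_comm]
      simp only [← Finset.mul_sum, ih]
      rw [← Finset.sum_mul, hA]

theorem filterWeight_nonneg (ha : ∀ t, 0 ≤ a t) (hη : ∀ t, 0 ≤ η t) (j t : ℕ) :
    0 ≤ filterWeight a η j t := by
  induction t with
  | zero => exact le_rfl
  | succ t ih =>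
    rw [filterWeight]
    split_ifs
    · exact hη _
    · exact mul_nonneg (ha _) ih

/-- A new input enters with weight η, and older weights are multiplied by a; the hypothesis on a and
η says that this never lifts them above the current step size. -/
theorem filterWeight_le (ha : ∀ t, 0 ≤ a t) (hη : ∀ t, 0 ≤ η t)
    (haη : ∀ t, 1 ≤ t → a t * η t ≤ η (t + 1)) (j t : ℕ) : filterWeight a η j t ≤ η t := by
  induction t with
  | zero => exact hη 0
  | succ t ih =>
    rw [filterWeight]
    split_ifs
    · exact le_rfl
    · rcases Nat.eq_zero_or_pos t with rfl | ht
      · simp [filterWeight, hη]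
      · exact (mul_le_mul_of_nonneg_left ih (ha t)).trans (haη t ht)

theorem sum_filterWeight_succ (x : ℕ → ℝ) (t : ℕ) :
    ∑ j ∈ Finset.range (t + 1), filterWeight a η j (t + 1) * x j
      = a t * ∑ j ∈ Finset.range t, filterWeight a η j t * x j + η (t + 1) * x t := by
  rw [Finset.sum_range_succ, Finset.mul_sum]
  congr 1
  · refine Finset.sum_congr rfl fun j hj => ?_
    rw [filterWeight, if_neg (Finset.mem_range.1 hj).ne, mul_assoc]
  · rw [filterWeight, if_pos rfl]

/-- Each step takes a convex combination of the past and the new input; the deficit from one is the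
weight of the initial value. -/
theorem sum_filterWeight_le_one (hη : ∀ t, η (t + 1) ≤ 1) (t : ℕ) :
    ∑ j ∈ Finset.range t, filterWeight (fun t => 1 - η (t + 1)) η j t ≤ 1 := by
  induction t with
  | zero => simp
  | succ t ih =>
    have h := sum_filterWeight_succ (a := fun t => 1 - η (t + 1)) (η := η) (fun _ => 1) t
    simp only [mul_one] at h
    rw [h]
    nlinarith [hη t]

end Filter

/-! ### Filters driven by martingale differences. -/

section FilterMDS

variable {ι : Type*} [Fintype ι] {Ω : Type*} {mΩ : MeasurableSpace Ω} {μ : Measure Ω}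
  [IsProbabilityMeasure μ] {ℱ : Filtration ℕ mΩ} {X : ℕ → Ω → ι → ℝ} {B : ℝ}

theorem IsBoundedMDS.mulVec (hX : IsBoundedMDS μ ℱ X B) (M : ℕ → Matrix ι ι ℝ) {b : ℝ}
    (hb : ∀ t ω, ‖(M t).mulVec (X t ω)‖ ≤ b) :
    IsBoundedMDS μ ℱ (fun t ω => (M t).mulVec (X t ω)) b where
  adapted t i := Finset.measurable_sum _ fun k _ => (hX.adapted t k).const_mul (M t i k)
  bound := hb
  centered t i g hg := by
    rintro ⟨C, hC⟩
    have h := (hX.integral_centered t (fun k ω => M t i k * g ω) (fun k => hg.const_mul _)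
      (C := (∑ k, |M t i k|) * C) fun k ω => by
        rw [abs_mul]
        exact mul_le_mul (Finset.single_le_sum (f := fun k => |M t i k|)
          (fun _ _ => abs_nonneg _) (Finset.mem_univ k)) (hC ω) (abs_nonneg _)
          (Finset.sum_nonneg fun _ _ => abs_nonneg _)).2
    rw [← h]
    refine integral_congr_ae (Filter.Eventually.of_forall fun ω => ?_)
    simp only [Matrix.mulVec, dotProduct, Finset.mul_sum]
    exact Finset.sum_congr rfl fun k _ => by ring

theorem IsBoundedMDS.integrable_norm_sq (hX : IsBoundedMDS μ ℱ X B) (t : ℕ) :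
    Integrable (fun ω => ‖X t ω‖ ^ 2) μ :=
  integrable_of_abs_le (C := B ^ 2) ((hX.measurable t).norm.pow_const 2) fun ω => by
    rw [abs_pow, abs_norm]; exact pow_le_pow_left₀ (norm_nonneg _) (hX.bound t ω) 2

theorem abs_weight_le {q : ι → Ω → ℝ} {C : ℝ} (h0 : ∀ i ω, 0 ≤ q i ω)
    (hC : ∀ ω, ∑ i, q i ω ≤ C) (i : ι) (ω : Ω) : |q i ω| ≤ C := by
  rw [abs_of_nonneg (h0 i ω)]
  exact (Finset.single_le_sum (f := fun i => q i ω) (fun i _ => h0 i ω)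
    (Finset.mem_univ i)).trans (hC ω)

/-- Bounding every coordinate by the sup norm removes the weights, so only the unconditional mean of
‖X t‖² is involved. -/
theorem IsBoundedMDS.weightedVarLe (hX : IsBoundedMDS μ ℱ X B) {t : ℕ} {v : ℝ}
    (hv : ∫ ω, ‖X t ω‖ ^ 2 ∂μ ≤ v) : WeightedVarLe μ ℱ X t v := by
  intro q C hq h0 hC
  have hCnn : 0 ≤ C := by
    obtain ⟨ω⟩ := nonempty_of_isProbabilityMeasure μ
    exact (Finset.sum_nonneg fun i _ => h0 i ω).trans (hC ω)
  calc ∫ ω, ∑ i, q i ω * X t ω i ^ 2 ∂μ ≤ ∫ ω, C * ‖X t ω‖ ^ 2 ∂μ := by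
        refine integral_mono (hX.integrable_weighted_sq t q hq (abs_weight_le h0 hC))
          ((hX.integrable_norm_sq t).const_mul C) fun ω => ?_
        calc ∑ i, q i ω * X t ω i ^ 2 ≤ ∑ i, q i ω * ‖X t ω‖ ^ 2 := by
              refine Finset.sum_le_sum fun i _ => mul_le_mul_of_nonneg_left ?_ (h0 i ω)
              rw [← sq_abs (X t ω i)]
              exact pow_le_pow_left₀ (abs_nonneg _) (norm_le_pi_norm (X t ω) i) 2
          _ = (∑ i, q i ω) * ‖X t ω‖ ^ 2 := by rw [Finset.sum_mul]
          _ ≤ C * ‖X t ω‖ ^ 2 := by gcongr; exact hC ω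
    _ = C * ∫ ω, ‖X t ω‖ ^ 2 ∂μ := integral_const_mul _ _
    _ ≤ C * v := by gcongr

/-- By Cauchy–Schwarz the matrix can be moved from X onto the weights: c qᵀM is again nonnegative
and known at time t, with total mass at most c²C. -/
theorem WeightedVarLe.mulVec (hX : IsBoundedMDS μ ℱ X B) {t : ℕ} {v : ℝ}
    (hv : WeightedVarLe μ ℱ X t v) {M : ℕ → Matrix ι ι ℝ} {c : ℝ} (hM : ∀ i k, 0 ≤ M t i k)
    (hc : ∀ i, ∑ k, M t i k ≤ c) (hc0 : 0 ≤ c) :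
    WeightedVarLe μ ℱ (fun t ω => (M t).mulVec (X t ω)) t (c ^ 2 * v) := by
  intro q C hq h0 hC
  have hqm : ∀ k, Measurable[ℱ t] fun ω => ∑ i, c * q i ω * M t i k := fun k =>
    Finset.measurable_sum _ fun i _ => ((hq i).const_mul c).mul_const _
  have hq0 : ∀ k ω, 0 ≤ ∑ i, c * q i ω * M t i k := fun k ω =>
    Finset.sum_nonneg fun i _ => mul_nonneg (mul_nonneg hc0 (h0 i ω)) (hM i k)
  have hqC : ∀ ω, ∑ k, ∑ i, c * q i ω * M t i k ≤ c ^ 2 * C := fun ω => by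
    rw [Finset.sum_comm]
    simp only [← Finset.mul_sum]
    calc ∑ i, c * q i ω * ∑ k, M t i k ≤ ∑ i, c * q i ω * c :=
          Finset.sum_le_sum fun i _ => mul_le_mul_of_nonneg_left (hc i) (mul_nonneg hc0 (h0 i ω))
      _ = c ^ 2 * ∑ i, q i ω := by
          rw [Finset.mul_sum]; exact Finset.sum_congr rfl fun i _ => by ring
      _ ≤ c ^ 2 * C := by gcongr; exact hC ω
  have hb : ∀ ω, ‖(M t).mulVec (X t ω)‖ ≤ c * B := fun ω =>
    (norm_mulVec_le hM hc hc0 _).trans (mul_le_mul_of_nonneg_left (hX.bound t ω) hc0)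
  have hint : Integrable (fun ω => ∑ i, q i ω * (M t).mulVec (X t ω) i ^ 2) μ := by
    refine integrable_finsetSum _ fun i _ => integrable_of_abs_le (C := C * (c * B) ^ 2) ?_ ?_
    · exact ((hq i).mono (ℱ.le _) le_rfl).mul (Measurable.pow_const (Finset.measurable_sum _
        fun k _ => (hX.measurable_coord t k).const_mul (M t i k)) 2)
    · intro ω
      rw [abs_mul, abs_pow]
      exact mul_le_mul (abs_weight_le h0 hC i ω) (pow_le_pow_left₀ (abs_nonneg _)
        ((norm_le_pi_norm ((M t).mulVec (X t ω)) i).trans (hb ω)) 2) (by positivity)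
        ((abs_nonneg _).trans (abs_weight_le h0 hC i ω))
  have h := hv _ _ hqm hq0 hqC
  refine (integral_mono hint (hX.integrable_weighted_sq t _ hqm (abs_weight_le hq0 hqC))
    fun ω => ?_).trans (h.trans (le_of_eq (by ring)))
  simp only [Finset.sum_mul]
  rw [Finset.sum_comm]
  refine Finset.sum_le_sum fun i _ => ?_
  calc q i ω * (M t).mulVec (X t ω) i ^ 2 ≤ q i ω * (c * ∑ k, M t i k * X t ω k ^ 2) :=
        mul_le_mul_of_nonneg_left (sq_mulVec_le hM hc _ i) (h0 i ω)
    _ = _ := by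
        rw [Finset.mul_sum, Finset.mul_sum]
        exact Finset.sum_congr rfl fun k _ => by ring

variable {A : ℕ → Matrix ι ι ℝ} {a η : ℕ → ℝ}

/-- Row-(sub)stochastic transition matrices and step sizes whose filter weights at time `t`
never exceed `η t`. -/
structure IsStepFilter (A : ℕ → Matrix ι ι ℝ) (a η : ℕ → ℝ) : Prop where
  mat_nonneg : ∀ t i k, 0 ≤ A t i k
  mat_sum : ∀ t i, ∑ k, A t i k = a t
  fac_nonneg : ∀ t, 0 ≤ a t
  step_pos : ∀ t, 0 < η t
  step_le : ∀ t, η t ≤ 1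
  fac_mul_le : ∀ t, 1 ≤ t → a t * η t ≤ η (t + 1)

namespace IsStepFilter

variable (hF : IsStepFilter A a η)
include hF

theorem weight_nonneg (j t : ℕ) : 0 ≤ filterWeight a η j t :=
  filterWeight_nonneg hF.fac_nonneg (fun t => (hF.step_pos t).le) j t

theorem weight_le (j t : ℕ) : filterWeight a η j t ≤ η t :=
  filterWeight_le hF.fac_nonneg (fun t => (hF.step_pos t).le) hF.fac_mul_le j t

theorem kernel_nonneg (j t : ℕ) (i k : ι) : 0 ≤ filterKernel A η j t i k :=
  filterKernel_nonneg hF.mat_nonneg (fun t => (hF.step_pos t).le) j t i k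

theorem sum_kernel_le (j t : ℕ) (i : ι) :
    ∑ k, filterKernel A η j t i k ≤ filterWeight a η j t :=
  (sum_filterKernel hF.mat_sum j t i).le

theorem norm_kernel_le (hX : IsBoundedMDS μ ℱ X B) (t j : ℕ) (ω : Ω) :
    ‖(filterKernel A η j t).mulVec (X j ω)‖ ≤ filterWeight a η j t * B :=
  (norm_mulVec_le (hF.kernel_nonneg j t) (hF.sum_kernel_le j t) (hF.weight_nonneg j t) _).trans
    (mul_le_mul_of_nonneg_left (hX.bound j ω) (hF.weight_nonneg j t))

theorem isBoundedMDS (hX : IsBoundedMDS μ ℱ X B) (hB : 0 ≤ B) (t : ℕ) :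
    IsBoundedMDS μ ℱ (fun j ω => (filterKernel A η j t).mulVec (X j ω)) (η t * B) :=
  hX.mulVec (fun j => filterKernel A η j t) fun j ω =>
    (hF.norm_kernel_le hX t j ω).trans (mul_le_mul_of_nonneg_right (hF.weight_le j t) hB)

theorem integral_norm_le [Nonempty ι] (hX : IsBoundedMDS μ ℱ X B) (hB : 0 < B) {x : ℕ → ℝ}
    {t : ℕ} (hx : ∀ j < t, WeightedVarLe μ ℱ X j (x j)) {V : ℝ} (hV0 : 0 ≤ V)
    (hV : ∑ j ∈ Finset.range t, filterWeight a η j t ^ 2 * x j ≤ V) :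
    ∫ ω, ‖linFilter A η (fun j => X j ω) t‖ ∂μ
      ≤ 2 * Real.sqrt (logCard ι * V)
        + logCard ι * (η t * B) := by
  simp only [linFilter_eq_sum]
  refine (hF.isBoundedMDS hX hB.le t).integral_norm_sum_le_sqrt (mul_pos (hF.step_pos t) hB)
    (v := fun j => filterWeight a η j t ^ 2 * x j) (fun j hj => ?_) hV0 hV
  exact WeightedVarLe.mulVec hX (hx j hj) (M := fun j => filterKernel A η j t)
    (hF.kernel_nonneg j t) (hF.sum_kernel_le j t) (hF.weight_nonneg j t)

/-- Every weight is at most η t and the weights sum to at most one, so their squares sum to at most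
η t. -/
theorem integral_norm_sq_le [Nonempty ι] (hcard : 2 ≤ Fintype.card ι)
    (hX : IsBoundedMDS μ ℱ X B) (hB : 0 < B) (t : ℕ)
    (hsum : ∑ j ∈ Finset.range t, filterWeight a η j t ≤ 1) :
    ∫ ω, ‖linFilter A η (fun j => X j ω) t‖ ^ 2 ∂μ
      ≤ 10 * logCard ι ^ 2 * (η t * B ^ 2) := by
  simp only [linFilter_eq_sum]
  refine (hF.isBoundedMDS hX hB.le t).integral_norm_sum_sq_le hcard
    (c := fun j => filterWeight a η j t * B) (fun j ω => hF.norm_kernel_le hX t j ω)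
    (mul_pos (hF.step_pos t) (by positivity)) ?_ ?_
  · have := hF.step_le t
    have := hF.step_pos t
    rw [mul_pow]
    gcongr
    nlinarith
  · calc ∑ j ∈ Finset.range t, (filterWeight a η j t * B) ^ 2
        ≤ ∑ j ∈ Finset.range t, filterWeight a η j t * (η t * B ^ 2) := by
          refine Finset.sum_le_sum fun j _ => ?_
          have h1 := hF.weight_le j t
          have h2 := hF.weight_nonneg j t
          calc (filterWeight a η j t * B) ^ 2
              = filterWeight a η j t * (filterWeight a η j t * B ^ 2) := by ring
            _ ≤ _ := by gcongr
      _ = (∑ j ∈ Finset.range t, filterWeight a η j t) * (η t * B ^ 2) := by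
          rw [Finset.sum_mul]
      _ ≤ 1 * (η t * B ^ 2) := by
          have := (hF.step_pos t).le
          gcongr
      _ = _ := one_mul _

theorem norm_le (hX : IsBoundedMDS μ ℱ X B) (hB : 0 ≤ B) (t : ℕ) (ω : Ω) :
    ‖linFilter A η (fun j => X j ω) t‖ ≤ t * (η t * B) := by
  rw [linFilter_eq_sum]
  exact (hF.isBoundedMDS hX hB t).norm_sum_le t ω

theorem measurable (hX : IsBoundedMDS μ ℱ X B) (hB : 0 ≤ B) (t : ℕ) :
    Measurable fun ω => linFilter A η (fun j => X j ω) t := by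
  simp only [linFilter_eq_sum]
  exact Finset.measurable_sum _ fun j _ => (hF.isBoundedMDS hX hB t).measurable j

theorem integrable_norm (hX : IsBoundedMDS μ ℱ X B) (hB : 0 ≤ B) (t : ℕ) :
    Integrable (fun ω => ‖linFilter A η (fun j => X j ω) t‖) μ :=
  integrable_of_abs_le (hF.measurable hX hB t).norm fun ω => by
    rw [abs_norm]; exact hF.norm_le hX hB t ω

theorem integrable_norm_sq (hX : IsBoundedMDS μ ℱ X B) (hB : 0 ≤ B) (t : ℕ) :
    Integrable (fun ω => ‖linFilter A η (fun j => X j ω) t‖ ^ 2) μ :=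
  integrable_of_abs_le (C := (t * (η t * B)) ^ 2) ((hF.measurable hX hB t).norm.pow_const 2)
    fun ω => by
      rw [abs_pow, abs_norm]; exact pow_le_pow_left₀ (norm_nonneg _) (hF.norm_le hX hB t ω) 2

end IsStepFilter

end FilterMDS

/-! ### The abstract error recursion and its comparison with smoothed noise. -/

section PerturbedIteration

variable {ι : Type*} [Fintype ι] {Ω : Type*} {mΩ : MeasurableSpace Ω} {μ : Measure Ω}
  {ℱ : Filtration ℕ mΩ}

theorem one_le_logCard (h : 2 ≤ Fintype.card ι) : 1 ≤ logCard ι := by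
  have hcard' : (2 : ℝ) ≤ Fintype.card ι := by exact_mod_cast h
  rw [logCard, Real.le_log_iff_exp_le (by positivity)]
  linarith [Real.exp_one_lt_d9]

theorem IsBoundedMDS.add [IsProbabilityMeasure μ] {X Y : ℕ → Ω → ι → ℝ} {b c : ℝ}
    (hX : IsBoundedMDS μ ℱ X b) (hY : IsBoundedMDS μ ℱ Y c) :
    IsBoundedMDS μ ℱ (fun t ω => X t ω + Y t ω) (b + c) where
  adapted t i := (hX.adapted t i).add (hY.adapted t i)
  bound t ω := (norm_add_le _ _).trans (add_le_add (hX.bound t ω) (hY.bound t ω))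
  centered t i g hg hb := by
    obtain ⟨C, hC⟩ := hb
    have hgm : Measurable g := hg.mono (ℱ.le _) le_rfl
    have h1 : Integrable (fun ω => g ω * X t ω i) μ :=
      integrable_of_abs_le (C := C * b) (hgm.mul (hX.measurable_coord t i)) fun ω => by
        rw [abs_mul]
        exact mul_le_mul (hC ω) (hX.abs_le t ω i) (abs_nonneg _) ((abs_nonneg _).trans (hC ω))
    have h2 : Integrable (fun ω => g ω * Y t ω i) μ :=
      integrable_of_abs_le (C := C * c) (hgm.mul (hY.measurable_coord t i)) fun ω => by
        rw [abs_mul]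
        exact mul_le_mul (hC ω) (hY.abs_le t ω i) (abs_nonneg _) ((abs_nonneg _).trans (hC ω))
    simp only [Pi.add_apply, mul_add]
    rw [integral_add h1 h2, hX.centered t i g hg ⟨C, hC⟩, hY.centered t i g hg ⟨C, hC⟩, add_zero]

theorem IsBoundedMDS.mono {X : ℕ → Ω → ι → ℝ} {b c : ℝ} (hX : IsBoundedMDS μ ℱ X b)
    (h : b ≤ c) : IsBoundedMDS μ ℱ X c :=
  ⟨hX.adapted, fun t ω => (hX.bound t ω).trans h, hX.centered⟩

/-- Step sizes in `(0, 1]` whose inverses grow by at most one per step. -/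
structure IsStepSeq (η : ℕ → ℝ) : Prop where
  pos : ∀ t, 0 < η t
  le_one : ∀ t, η t ≤ 1
  mul_le : ∀ t, 1 ≤ t → (1 - η (t + 1)) * η t ≤ η (t + 1)

open Classical in
/-- The transition matrices of exponential smoothing with step sizes `η`. -/
noncomputable def smoothMat (ι : Type*) (η : ℕ → ℝ) (t : ℕ) : Matrix ι ι ℝ :=
  (1 - η (t + 1)) • 1

theorem smoothMat_mulVec (η : ℕ → ℝ) (t : ℕ) (x : ι → ℝ) :
    (smoothMat ι η t).mulVec x = (1 - η (t + 1)) • x := by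
  classical
  rw [smoothMat, Matrix.smul_mulVec]
  congr 1
  convert Matrix.one_mulVec x

theorem IsStepSeq.isStepFilter {η : ℕ → ℝ} (h : IsStepSeq η) :
    IsStepFilter (smoothMat ι η) (fun t => 1 - η (t + 1)) η where
  mat_nonneg t i k := by
    classical
    rw [smoothMat, Matrix.smul_apply, Matrix.one_apply]
    have := h.le_one (t + 1)
    split_ifs <;> simp [this]
  mat_sum t i := by
    classical
    simp [smoothMat, Matrix.one_apply]
  fac_nonneg t := sub_nonneg.2 (h.le_one _)
  step_pos := h.pos
  step_le := h.le_one
  fac_mul_le := h.mul_le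

/-- The error process `Δ` of a stochastic approximation scheme whose mean map is a
`(1 - κ)`-contraction with a quadratic linearization error `ζ` and whose noise splits into the
noise `Z` at the fixed point and a part `D` that is controlled by the error. -/
structure IsPerturbedIter (μ : Measure Ω) (ℱ : Filtration ℕ mΩ) (κ h lam : ℝ)
    (K : Matrix ι ι ℝ) (η : ℕ → ℝ) (δ : ι → ℝ) (Δ ζ Z D : ℕ → Ω → ι → ℝ) : Prop where
  rate_pos : 0 < κ
  rate_lt_one : κ < 1
  lam_pos : 0 < lam
  scale_eq : h = 1 + κ * ‖δ‖
  mat_nonneg : ∀ i k, 0 ≤ K i k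
  mat_sum : ∀ i, ∑ k, K i k = 1
  init : ∀ ω, Δ 0 ω = δ
  step : ∀ t ω, Δ (t + 1) ω = (1 - η (t + 1)) • Δ t ω
    + η (t + 1) • ((1 - κ) • (K.mulVec (Δ t ω) + ζ t ω) + (Z t ω + D t ω))
  contr : ∀ t ω, ‖K.mulVec (Δ t ω) + ζ t ω‖ ≤ ‖Δ t ω‖
  quad : ∀ t ω, ‖ζ t ω‖ ≤ 2 * ‖Δ t ω‖ ^ 2 / lam
  measurable : ∀ t, Measurable (Δ t)
  bound : ∀ t ω, ‖Δ t ω‖ ≤ h / κ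
  mdsZ : IsBoundedMDS μ ℱ Z (1 / κ)
  mdsD : IsBoundedMDS μ ℱ D (2 * h / κ)
  norm_le : ∀ t ω, ‖D t ω‖ ≤ 2 * (1 - κ) * ‖Δ t ω‖

namespace IsPerturbedIter

variable [IsProbabilityMeasure μ] {κ h lam : ℝ} {K : Matrix ι ι ℝ} {η : ℕ → ℝ} {δ : ι → ℝ}
  {Δ ζ Z D : ℕ → Ω → ι → ℝ}

theorem one_le_scale (hP : IsPerturbedIter μ ℱ κ h lam K η δ Δ ζ Z D) : 1 ≤ h := by
  rw [hP.scale_eq]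
  have := mul_nonneg hP.rate_pos.le (norm_nonneg δ)
  linarith

theorem norm_init_le (hP : IsPerturbedIter μ ℱ κ h lam K η δ Δ ζ Z D) : ‖δ‖ ≤ h / κ := by
  rw [le_div_iff₀ hP.rate_pos, hP.scale_eq]
  linarith

theorem integrable_norm (hP : IsPerturbedIter μ ℱ κ h lam K η δ Δ ζ Z D) (t : ℕ) :
    Integrable (fun ω => ‖Δ t ω‖) μ :=
  integrable_of_abs_le (hP.measurable t).norm fun ω => by rw [abs_norm]; exact hP.bound t ω

theorem integrable_norm_sq (hP : IsPerturbedIter μ ℱ κ h lam K η δ Δ ζ Z D) (t : ℕ) :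
    Integrable (fun ω => ‖Δ t ω‖ ^ 2) μ :=
  integrable_of_abs_le (C := (h / κ) ^ 2) ((hP.measurable t).norm.pow_const 2) fun ω => by
    rw [abs_pow, abs_norm]; exact pow_le_pow_left₀ (norm_nonneg _) (hP.bound t ω) 2

theorem mdsNoise (hP : IsPerturbedIter μ ℱ κ h lam K η δ Δ ζ Z D) :
    IsBoundedMDS μ ℱ (fun t ω => Z t ω + D t ω) (3 * h / κ) := by
  refine (hP.mdsZ.add hP.mdsD).mono ?_
  rw [← add_div]
  have := hP.rate_pos
  have := hP.one_le_scale
  gcongr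
  linarith

theorem scale_div_pos (hP : IsPerturbedIter μ ℱ κ h lam K η δ Δ ζ Z D) : 0 < h / κ :=
  div_pos (zero_lt_one.trans_le hP.one_le_scale) hP.rate_pos

/-- The smoothed noise. -/
noncomputable def noise (η : ℕ → ℝ) (Z D : ℕ → Ω → ι → ℝ) (t : ℕ) (ω : Ω) : ι → ℝ :=
  linFilter (smoothMat ι η) η (fun j => Z j ω + D j ω) t

theorem measurable_noise (hP : IsPerturbedIter μ ℱ κ h lam K η δ Δ ζ Z D) (hη : IsStepSeq η)
    (t : ℕ) : Measurable (noise η Z D t) :=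
  hη.isStepFilter.measurable hP.mdsNoise
    (by have := hP.scale_div_pos; rw [mul_div_assoc]; positivity) t

theorem integrable_noise (hP : IsPerturbedIter μ ℱ κ h lam K η δ Δ ζ Z D) (hη : IsStepSeq η)
    (t : ℕ) : Integrable (fun ω => ‖noise η Z D t ω‖) μ :=
  hη.isStepFilter.integrable_norm hP.mdsNoise
    (by have := hP.scale_div_pos; rw [mul_div_assoc]; positivity) t

theorem integrable_noise_sq (hP : IsPerturbedIter μ ℱ κ h lam K η δ Δ ζ Z D) (hη : IsStepSeq η)
    (t : ℕ) : Integrable (fun ω => ‖noise η Z D t ω‖ ^ 2) μ :=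
  hη.isStepFilter.integrable_norm_sq hP.mdsNoise
    (by have := hP.scale_div_pos; rw [mul_div_assoc]; positivity) t

/-- The constant is 10 · 3², where 3h/κ bounds Z + D. -/
theorem integral_noise_sq_le [Nonempty ι] (hP : IsPerturbedIter μ ℱ κ h lam K η δ Δ ζ Z D)
    (hη : IsStepSeq η) (hcard : 2 ≤ Fintype.card ι) (t : ℕ) :
    ∫ ω, ‖noise η Z D t ω‖ ^ 2 ∂μ ≤ 90 * (logCard ι * (h / κ)) ^ 2 * η t := by
  have h3 : 0 < 3 * h / κ := by have := hP.scale_div_pos; rw [mul_div_assoc]; positivity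
  refine (hη.isStepFilter.integral_norm_sq_le hcard hP.mdsNoise h3 t
    (sum_filterWeight_le_one (fun t => hη.le_one _) t)).trans (le_of_eq ?_)
  ring

theorem integrable_resid (hP : IsPerturbedIter μ ℱ κ h lam K η δ Δ ζ Z D) (hη : IsStepSeq η)
    (t : ℕ) : Integrable (fun ω => ‖Δ t ω - noise η Z D t ω‖) μ := by
  refine ((hP.integrable_norm t).add (hP.integrable_noise hη t)).mono'
    ((hP.measurable t).sub (hP.measurable_noise hη t)).norm.aestronglyMeasurable
    (Filter.Eventually.of_forall fun ω => ?_)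
  rw [norm_norm]
  exact norm_sub_le _ _

theorem integrable_resid_sq (hP : IsPerturbedIter μ ℱ κ h lam K η δ Δ ζ Z D) (hη : IsStepSeq η)
    (t : ℕ) : Integrable (fun ω => ‖Δ t ω - noise η Z D t ω‖ ^ 2) μ := by
  refine (((hP.integrable_norm_sq t).const_mul 2).add
    ((hP.integrable_noise_sq hη t).const_mul 2)).mono'
    (((hP.measurable t).sub (hP.measurable_noise hη t)).norm.pow_const 2).aestronglyMeasurable
    (Filter.Eventually.of_forall fun ω => ?_)
  rw [Real.norm_of_nonneg (by positivity)]
  have := norm_sub_le (Δ t ω) (noise η Z D t ω)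
  simp only [Pi.add_apply]
  nlinarith [sq_nonneg (‖Δ t ω‖ - ‖noise η Z D t ω‖), norm_nonneg (Δ t ω - noise η Z D t ω)]

/-- The error and the smoothed noise receive the same innovation, which cancels in the difference.
What remains is deterministic given the past: a smoothing step plus γ times a map of norm at most
‖Δ‖ ≤ ‖Δ - N‖ + ‖N‖, with N the smoothed noise. -/
theorem norm_resid_succ_le (hP : IsPerturbedIter μ ℱ κ h lam K η δ Δ ζ Z D) (hη : IsStepSeq η)
    (t : ℕ) (ω : Ω) :
    ‖Δ (t + 1) ω - noise η Z D (t + 1) ω‖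
      ≤ (1 - κ * η (t + 1)) * ‖Δ t ω - noise η Z D t ω‖
        + κ * η (t + 1) * (‖noise η Z D t ω‖ / κ) := by
  have hκ := hP.rate_pos
  have e : Δ (t + 1) ω - noise η Z D (t + 1) ω = (1 - η (t + 1)) • (Δ t ω - noise η Z D t ω)
      + (η (t + 1) * (1 - κ)) • (K.mulVec (Δ t ω) + ζ t ω) := by
    rw [hP.step, noise, linFilter, smoothMat_mulVec, ← noise]
    module
  rw [e]
  have h0 := hη.pos (t + 1)
  have h1 := hη.le_one (t + 1)
  have hκ1 := hP.rate_lt_one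
  have h2 := hP.contr t ω
  have h3 : ‖Δ t ω‖ ≤ ‖Δ t ω - noise η Z D t ω‖ + ‖noise η Z D t ω‖ := by
    have := norm_add_le (Δ t ω - noise η Z D t ω) (noise η Z D t ω)
    rwa [sub_add_cancel] at this
  refine (norm_add_le _ _).trans ?_
  rw [norm_smul, norm_smul, Real.norm_of_nonneg (sub_nonneg.2 h1),
    Real.norm_of_nonneg (mul_nonneg h0.le (sub_nonneg.2 hκ1.le))]
  have h4 : η (t + 1) * (1 - κ) * ‖K.mulVec (Δ t ω) + ζ t ω‖
      ≤ η (t + 1) * (1 - κ) * (‖Δ t ω - noise η Z D t ω‖ + ‖noise η Z D t ω‖) :=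
    mul_le_mul_of_nonneg_left (h2.trans h3) (mul_nonneg h0.le (sub_nonneg.2 hκ1.le))
  have h5 : κ * η (t + 1) * (‖noise η Z D t ω‖ / κ) = η (t + 1) * ‖noise η Z D t ω‖ := by
    field_simp
  rw [h5]
  have h6 : 0 ≤ κ * (η (t + 1) * ‖noise η Z D t ω‖) := by positivity
  linarith

theorem integral_resid_succ_le (hP : IsPerturbedIter μ ℱ κ h lam K η δ Δ ζ Z D)
    (hη : IsStepSeq η) (t : ℕ) :
    ∫ ω, ‖Δ (t + 1) ω - noise η Z D (t + 1) ω‖ ∂μ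
      ≤ (1 - κ * η (t + 1)) * ∫ ω, ‖Δ t ω - noise η Z D t ω‖ ∂μ
        + κ * η (t + 1) * ((∫ ω, ‖noise η Z D t ω‖ ∂μ) / κ) := by
  rw [← integral_div, ← integral_const_mul, ← integral_const_mul]
  exact integral_le_add (hP.integrable_resid hη _) ((hP.integrable_resid hη _).const_mul _)
    (((hP.integrable_noise hη t).div_const κ).const_mul _) (hP.norm_resid_succ_le hη t)

/-- Since κη ≤ 1, the pathwise bound is a convex combination, and the square is convex. -/
theorem integral_resid_sq_succ_le (hP : IsPerturbedIter μ ℱ κ h lam K η δ Δ ζ Z D)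
    (hη : IsStepSeq η) (t : ℕ) :
    ∫ ω, ‖Δ (t + 1) ω - noise η Z D (t + 1) ω‖ ^ 2 ∂μ
      ≤ (1 - κ * η (t + 1)) * ∫ ω, ‖Δ t ω - noise η Z D t ω‖ ^ 2 ∂μ
        + κ * η (t + 1) * ((∫ ω, ‖noise η Z D t ω‖ ^ 2 ∂μ) / κ ^ 2) := by
  rw [← integral_div, ← integral_const_mul, ← integral_const_mul]
  refine integral_le_add (hP.integrable_resid_sq hη _) ((hP.integrable_resid_sq hη _).const_mul _)
    (((hP.integrable_noise_sq hη t).div_const _).const_mul _) fun ω => ?_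
  have h1 := hP.norm_resid_succ_le hη t ω
  rw [← div_pow]
  set x := ‖Δ t ω - noise η Z D t ω‖
  set y := ‖noise η Z D t ω‖ / κ
  have h0 := hη.pos (t + 1)
  have h2 : 0 ≤ κ * η (t + 1) := mul_nonneg hP.rate_pos.le h0.le
  have h3 : κ * η (t + 1) ≤ 1 := mul_le_one₀ hP.rate_lt_one.le h0.le (hη.le_one _)
  calc ‖Δ (t + 1) ω - noise η Z D (t + 1) ω‖ ^ 2
      ≤ ((1 - κ * η (t + 1)) * x + κ * η (t + 1) * y) ^ 2 := by gcongr
    _ ≤ (1 - κ * η (t + 1)) * x ^ 2 + κ * η (t + 1) * y ^ 2 := by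
      nlinarith [mul_nonneg (mul_nonneg h2 (sub_nonneg.2 h3)) (sq_nonneg (x - y))]

theorem resid_zero (hP : IsPerturbedIter μ ℱ κ h lam K η δ Δ ζ Z D) (ω : Ω) :
    Δ 0 ω - noise η Z D 0 ω = δ := by
  rw [hP.init, noise, linFilter, sub_zero]

theorem integral_norm_sq_le_resid (hP : IsPerturbedIter μ ℱ κ h lam K η δ Δ ζ Z D)
    (hη : IsStepSeq η) (t : ℕ) :
    ∫ ω, ‖Δ t ω‖ ^ 2 ∂μ ≤ 2 * ∫ ω, ‖Δ t ω - noise η Z D t ω‖ ^ 2 ∂μ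
      + 2 * ∫ ω, ‖noise η Z D t ω‖ ^ 2 ∂μ := by
  rw [← integral_const_mul, ← integral_const_mul]
  refine integral_le_add (hP.integrable_norm_sq t) ((hP.integrable_resid_sq hη t).const_mul 2)
    ((hP.integrable_noise_sq hη t).const_mul 2) fun ω => ?_
  have := norm_add_le (Δ t ω - noise η Z D t ω) (noise η Z D t ω)
  rw [sub_add_cancel] at this
  nlinarith [sq_nonneg (‖Δ t ω - noise η Z D t ω‖ - ‖noise η Z D t ω‖), norm_nonneg (Δ t ω)]

theorem integral_norm_le_resid (hP : IsPerturbedIter μ ℱ κ h lam K η δ Δ ζ Z D)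
    (hη : IsStepSeq η) (t : ℕ) :
    ∫ ω, ‖Δ t ω‖ ∂μ ≤ ∫ ω, ‖Δ t ω - noise η Z D t ω‖ ∂μ + ∫ ω, ‖noise η Z D t ω‖ ∂μ := by
  refine integral_le_add (hP.integrable_norm t) (hP.integrable_resid hη t)
    (hP.integrable_noise hη t) fun ω => ?_
  have := norm_add_le (Δ t ω - noise η Z D t ω) (noise η Z D t ω)
  rwa [sub_add_cancel] at this

theorem integral_normD_sq_le (hP : IsPerturbedIter μ ℱ κ h lam K η δ Δ ζ Z D) (t : ℕ) :
    ∫ ω, ‖D t ω‖ ^ 2 ∂μ ≤ 4 * (1 - κ) ^ 2 * ∫ ω, ‖Δ t ω‖ ^ 2 ∂μ := by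
  rw [← integral_const_mul]
  refine integral_mono (hP.mdsD.integrable_norm_sq t) ((hP.integrable_norm_sq t).const_mul _)
    fun ω => ?_
  calc ‖D t ω‖ ^ 2 ≤ (2 * (1 - κ) * ‖Δ t ω‖) ^ 2 := by gcongr; exact hP.norm_le t ω
    _ = _ := by ring

/-- The factor γ² is discarded here; the averaged bound for polynomial steps keeps it by using
`integral_normD_sq_le` directly. -/
theorem weightedVarLe_D (hP : IsPerturbedIter μ ℱ κ h lam K η δ Δ ζ Z D) (t : ℕ) :
    WeightedVarLe μ ℱ D t (4 * ∫ ω, ‖Δ t ω‖ ^ 2 ∂μ) := by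
  refine hP.mdsD.weightedVarLe ((hP.integral_normD_sq_le t).trans ?_)
  have h0 : 0 ≤ ∫ ω, ‖Δ t ω‖ ^ 2 ∂μ := integral_nonneg fun ω => by positivity
  have := hP.rate_pos
  have := hP.rate_lt_one
  gcongr
  nlinarith

end IsPerturbedIter

end PerturbedIteration

/-! ### Scalar recursions, the burn-in weight and power sums. -/

section ScalarEstimates

/-- A summable weight that is at least one up to time `τ`. -/
noncomputable def earlyWeight (τ : ℝ) (t : ℕ) : ℝ := 4 * τ ^ 2 / (t + τ) ^ 2

theorem earlyWeight_nonneg (τ : ℝ) (t : ℕ) : 0 ≤ earlyWeight τ t := by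
  unfold earlyWeight; positivity

theorem earlyWeight_le {τ : ℝ} (hτ : 0 < τ) (t : ℕ) : earlyWeight τ t ≤ 4 := by
  unfold earlyWeight
  rw [div_le_iff₀ (by positivity)]
  have : (0 : ℝ) ≤ t := Nat.cast_nonneg t
  nlinarith [mul_nonneg this hτ.le]

theorem one_le_earlyWeight {τ : ℝ} (hτ : 0 < τ) {t : ℕ} (ht : (t : ℝ) ≤ τ) :
    1 ≤ earlyWeight τ t := by
  unfold earlyWeight
  have : (0 : ℝ) ≤ t := Nat.cast_nonneg t
  rw [le_div_iff₀ (by positivity)]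
  nlinarith

/-- The weight decays like t⁻², so a relative loss of 3/(t+1) per step is more than it suffers. It
thus decays more slowly than a contraction of rate 4/t. -/
theorem mul_earlyWeight_le {τ : ℝ} (hτ : 0 < τ) (t : ℕ) :
    (1 - 3 / ((t : ℝ) + 1)) * earlyWeight τ t ≤ earlyWeight τ (t + 1) := by
  unfold earlyWeight
  have ht : (0 : ℝ) ≤ t := Nat.cast_nonneg t
  push_cast
  rw [mul_div_assoc', div_le_div_iff₀ (by positivity) (by positivity)]
  have key : (1 - 3 / ((t : ℝ) + 1)) * (t + 1 + τ) ^ 2 ≤ (t + τ) ^ 2 := by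
    have h1 : (t : ℝ) + 1 + τ ≤ 1 / (t + 1) * (t + 1 + τ) ^ 2 := by
      rw [one_div, inv_mul_eq_div, le_div_iff₀ (by positivity)]
      nlinarith
    have h2 : (1 - 3 / ((t : ℝ) + 1)) * (t + 1 + τ) ^ 2
        = (t + 1 + τ) ^ 2 - 3 * (1 / (t + 1) * (t + 1 + τ) ^ 2) := by ring
    rw [h2]
    nlinarith
  have h4 : (0 : ℝ) ≤ 4 * τ ^ 2 := by positivity
  nlinarith [mul_le_mul_of_nonneg_left key h4]

/-- Comparison with the telescoping sum of 1/(t+τ) - 1/(t+1+τ). The burn-in therefore costs a total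
of order τ, without a logarithm. -/
theorem sum_earlyWeight_le {τ : ℝ} (hτ : 0 < τ) (T : ℕ) :
    ∑ t ∈ Finset.range T, earlyWeight τ (t + 1) ≤ 4 * τ := by
  have h : ∑ t ∈ Finset.range T, earlyWeight τ (t + 1) ≤ 4 * τ - 4 * τ ^ 2 / (T + τ) := by
    induction T with
    | zero => simp; field_simp; simp
    | succ T ih =>
      rw [Finset.sum_range_succ]
      have hT : (0 : ℝ) ≤ T := Nat.cast_nonneg T
      have : earlyWeight τ (T + 1) ≤ 4 * τ ^ 2 / (T + τ) - 4 * τ ^ 2 / ((T + 1 : ℕ) + τ) := by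
        unfold earlyWeight
        push_cast
        rw [div_sub_div _ _ (by positivity) (by positivity),
          div_le_div_iff₀ (by positivity) (by positivity)]
        have h4 : (0 : ℝ) ≤ 4 * τ ^ 2 * (T + 1 + τ) := by positivity
        nlinarith
      linarith
  have hT : (0 : ℝ) ≤ T := Nat.cast_nonneg T
  have : 0 ≤ 4 * τ ^ 2 / (T + τ) := by positivity
  linarith

theorem rpow_mul_earlyWeight_le {τ α : ℝ} (hτ : 1 ≤ τ) (hα0 : 0 ≤ α) (hα : α ≤ 1) (t : ℕ) :
    (t : ℝ) ^ α * earlyWeight τ t ≤ 4 * τ := by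
  have ht : (0 : ℝ) ≤ t := Nat.cast_nonneg t
  have h1 : (t : ℝ) ^ α ≤ t + τ :=
    calc (t : ℝ) ^ α ≤ (t + τ) ^ α := by gcongr; linarith
      _ ≤ (t + τ) ^ (1 : ℝ) := Real.rpow_le_rpow_of_exponent_le (by linarith) hα
      _ = t + τ := Real.rpow_one _
  unfold earlyWeight
  rw [mul_div_assoc', div_le_iff₀ (by positivity)]
  calc (t : ℝ) ^ α * (4 * τ ^ 2) ≤ (t + τ) * (4 * τ ^ 2) := by gcongr
    _ ≤ 4 * τ * (t + τ) ^ 2 := by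
      have h4 : (0 : ℝ) ≤ 4 * τ * (t + τ) := by positivity
      nlinarith

/-- Solution of a contracting recursion with a slowly decaying input. -/
theorem contracting_recursion_le {τ M : ℝ} {y g ρ p : ℕ → ℝ} (hτ : 0 < τ) (hM : 0 ≤ M)
    (hρ0 : ∀ t, 0 ≤ ρ t) (hρ1 : ∀ t, ρ t ≤ 1)
    (hρ : ∀ t : ℕ, τ ≤ t → 4 / (t : ℝ) ≤ ρ t) (hp0 : ∀ t, 1 ≤ t → 0 ≤ p t)
    (hp1 : ∀ t, 1 ≤ t → p (t + 1) ≤ p t)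
    (hp : ∀ t : ℕ, 1 ≤ t → (1 - 1 / ((t : ℝ) + 1)) * p t ≤ p (t + 1))
    (hg : ∀ t, 1 ≤ t → g t ≤ p t + M * earlyWeight τ t) (hy1 : y 1 ≤ p 1)
    (hy : ∀ t, 1 ≤ t → y (t + 1) ≤ (1 - ρ (t + 1)) * y t + ρ (t + 1) * g t) (t : ℕ) (ht : 1 ≤ t) :
    y t ≤ 2 * p t + (p 1 + 4 * M) * earlyWeight τ t := by
  have hpt : ∀ t, 1 ≤ t → p t ≤ p 1 := fun t ht => by
    induction t, ht using Nat.le_induction with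
    | base => exact le_rfl
    | succ t ht ih => exact (hp1 t ht).trans ih
  have hgt : ∀ t, 1 ≤ t → g t ≤ p 1 + 4 * M := fun t ht => by
    have h1 := hg t ht
    have h2 := mul_le_mul_of_nonneg_left (earlyWeight_le hτ t) hM
    linarith [hpt t ht]
  have hcrude : ∀ t, 1 ≤ t → y t ≤ p 1 + 4 * M := fun t ht => by
    induction t, ht using Nat.le_induction with
    | base => linarith
    | succ t ht ih =>
      have h1 := mul_le_mul_of_nonneg_left ih (sub_nonneg.2 (hρ1 (t + 1)))
      have h2 := mul_le_mul_of_nonneg_left (hgt t ht) (hρ0 (t + 1))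
      linarith [hy t ht]
  have hc0 : 0 ≤ p 1 + 4 * M := by have := hp0 1 le_rfl; positivity
  induction t, ht using Nat.le_induction with
  | base =>
    have h1 := hp0 1 le_rfl
    have h2 := mul_nonneg hc0 (earlyWeight_nonneg τ 1)
    linarith
  | succ t ht ih =>
    -- Up to τ the weight is at least one and the crude uniform bound suffices; the contraction is
    -- used only afterwards.
    rcases le_total ((t + 1 : ℕ) : ℝ) τ with h | h
    · have h1 := one_le_earlyWeight hτ h
      have h2 := mul_le_mul_of_nonneg_left h1 hc0
      linarith [hcrude (t + 1) (by omega), hp0 (t + 1) (by omega)]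
    · have hr := hρ (t + 1) h
      push_cast at hr
      have hr1 := hρ1 (t + 1)
      set r := ρ (t + 1)
      set n : ℝ := (t : ℝ) + 1 with hn
      have hn0 : 0 < n := by positivity
      have e0 := earlyWeight_nonneg τ t
      -- For r ≥ 4/n the recursion has slack: half of r absorbs the decay of p (rate 1/n) and three
      -- quarters of r absorb the decay of the weight (rate 3/n). The remaining quarter pays for the
      -- input, as M is at most a quarter of p 1 + 4M.
      have h1 : (1 - r / 2) * p t ≤ p (t + 1) := by
        refine le_trans (mul_le_mul_of_nonneg_right ?_ (hp0 t ht)) (hp t ht)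
        have : 1 / n ≤ 2 / n := by gcongr; norm_num
        have : 4 / n = 2 * (2 / n) := by ring
        linarith
      have h2 : (1 - 3 / 4 * r) * earlyWeight τ t ≤ earlyWeight τ (t + 1) := by
        refine le_trans (mul_le_mul_of_nonneg_right ?_ e0) (mul_earlyWeight_le hτ t)
        have : 4 / n = 4 * (1 / n) := by ring
        have : 3 / n = 3 * (1 / n) := by ring
        linarith
      have h3 := mul_le_mul_of_nonneg_left ih (sub_nonneg.2 hr1)
      have h4 := mul_le_mul_of_nonneg_left (hg t ht) (hρ0 (t + 1))
      have h5 := mul_le_mul_of_nonneg_left h2 hc0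
      have h6 : 0 ≤ p 1 * (r * earlyWeight τ t) :=
        mul_nonneg (hp0 1 le_rfl) (mul_nonneg (hρ0 (t + 1)) e0)
      have h7 := hy t ht
      nlinarith

theorem one_sub_mul_rpow_neg_le {θ : ℝ} (h1 : θ ≤ 1) {t : ℕ} (ht : 1 ≤ t) :
    (1 - 1 / ((t : ℝ) + 1)) * (t : ℝ) ^ (-θ) ≤ ((t : ℝ) + 1) ^ (-θ) := by
  have ht0 : (0 : ℝ) < t := by exact_mod_cast ht
  have e1 : (1 - 1 / ((t : ℝ) + 1)) = t * ((t : ℝ) + 1)⁻¹ := by field_simp; ring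
  have e2 : (t : ℝ) * (t : ℝ) ^ (-θ) = (t : ℝ) ^ (1 - θ) := by
    rw [mul_comm, ← Real.rpow_add_one ht0.ne']
    congr 1; ring
  have e3 : ((t : ℝ) + 1) ^ (-θ) = ((t : ℝ) + 1)⁻¹ * ((t : ℝ) + 1) ^ (1 - θ) := by
    rw [← Real.rpow_neg_one, ← Real.rpow_add (by positivity)]
    congr 1; ring
  rw [e1, e3, mul_right_comm, e2, mul_comm]
  gcongr
  linarith

/-- Bernoulli's inequality (1 - 1/(T+1))^θ ≤ 1 - θ/(T+1) plays the role of the integral comparison.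
-/
theorem sum_rpow_le {θ : ℝ} (h0 : 0 < θ) (h1 : θ ≤ 1) (T : ℕ) :
    ∑ t ∈ Finset.range T, ((t : ℝ) + 1) ^ (θ - 1) ≤ (T : ℝ) ^ θ / θ := by
  induction T with
  | zero => simp [Real.zero_rpow h0.ne']
  | succ T ih =>
    rw [Finset.sum_range_succ]
    have hT : (0 : ℝ) ≤ T := Nat.cast_nonneg T
    have hT1 : (0 : ℝ) < (T : ℝ) + 1 := by positivity
    have hb : (1 + -(1 / ((T : ℝ) + 1))) ^ θ ≤ 1 + θ * -(1 / ((T : ℝ) + 1)) :=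
      rpow_one_add_le_one_add_mul_self (by
        rw [neg_le_neg_iff, div_le_one hT1]; linarith) h0.le h1
    have e1 : (T : ℝ) ^ θ = ((T : ℝ) + 1) ^ θ * (1 + -(1 / ((T : ℝ) + 1))) ^ θ := by
      rw [← Real.mul_rpow hT1.le]
      · congr 1; field_simp; ring
      · have : 1 / ((T : ℝ) + 1) ≤ 1 := by rw [div_le_one hT1]; linarith
        linarith
    have e2 : ((T : ℝ) + 1) ^ (θ - 1) = ((T : ℝ) + 1) ^ θ * (1 / ((T : ℝ) + 1)) := by
      rw [Real.rpow_sub_one hT1.ne']; ring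
    have h2 := mul_le_mul_of_nonneg_left hb (Real.rpow_nonneg hT1.le θ)
    rw [le_div_iff₀ h0] at ih ⊢
    push_cast
    rw [add_mul, e2]
    rw [e1] at ih
    linarith

theorem sum_inv_le (T : ℕ) : ∑ t ∈ Finset.range T, 1 / ((t : ℝ) + 1) ≤ 1 + Real.log T := by
  have h := harmonic_le_one_add_log T
  rw [harmonic] at h
  push_cast at h
  simpa [one_div] using h

theorem sum_inv_sqrt_le (T : ℕ) :
    ∑ t ∈ Finset.range T, 1 / Real.sqrt ((t : ℝ) + 1) ≤ 2 * Real.sqrt T := by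
  induction T with
  | zero => simp
  | succ T ih =>
    rw [Finset.sum_range_succ]
    have hT : (0 : ℝ) ≤ T := Nat.cast_nonneg T
    push_cast
    have hs := Real.sqrt_pos.2 (by positivity : (0 : ℝ) < (T : ℝ) + 1)
    have h1 := Real.sq_sqrt hT
    have h2 := Real.sq_sqrt (by positivity : (0 : ℝ) ≤ (T : ℝ) + 1)
    have h3 : 1 / Real.sqrt ((T : ℝ) + 1) ≤ 2 * Real.sqrt ((T : ℝ) + 1) - 2 * Real.sqrt T := by
      rw [div_le_iff₀ hs]
      nlinarith [sq_nonneg (Real.sqrt ((T : ℝ) + 1) - Real.sqrt T)]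
    linarith

theorem polyStep_succ (α : ℝ) (t : ℕ) : polyStep α (t + 1) = ((t : ℝ) + 1) ^ (-α) := by
  simp [polyStep]

theorem polyStep_of_pos (α : ℝ) {t : ℕ} (ht : 1 ≤ t) : polyStep α t = (t : ℝ) ^ (-α) := by
  rw [polyStep, if_neg (by omega)]

theorem inv_polyStep (α : ℝ) {t : ℕ} (ht : 1 ≤ t) : (polyStep α t)⁻¹ = (t : ℝ) ^ α := by
  rw [polyStep_of_pos α ht, Real.rpow_neg (Nat.cast_nonneg t), inv_inv]

theorem rpow_succ_sub_le {α : ℝ} (h0 : 0 ≤ α) (h1 : α ≤ 1) {t : ℕ} (ht : 1 ≤ t) :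
    ((t : ℝ) + 1) ^ α - (t : ℝ) ^ α ≤ (t : ℝ) ^ (α - 1) := by
  have ht0 : (0 : ℝ) < t := by exact_mod_cast ht
  have hb : (1 + 1 / (t : ℝ)) ^ α ≤ 1 + α * (1 / (t : ℝ)) :=
    rpow_one_add_le_one_add_mul_self (by
      have : 0 ≤ 1 / (t : ℝ) := by positivity
      linarith) h0 h1
  have e1 : ((t : ℝ) + 1) ^ α = (t : ℝ) ^ α * (1 + 1 / (t : ℝ)) ^ α := by
    rw [← Real.mul_rpow ht0.le (by positivity)]
    congr 1; field_simp
  have e2 : (t : ℝ) ^ (α - 1) = (t : ℝ) ^ α * (1 / (t : ℝ)) := by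
    rw [Real.rpow_sub_one ht0.ne']; ring
  have hp : 0 ≤ (t : ℝ) ^ α * (1 / (t : ℝ)) := by positivity
  have h2 := mul_le_mul_of_nonneg_left hb (Real.rpow_nonneg ht0.le α)
  rw [e1, e2]
  nlinarith

theorem rpow_succ_le {α : ℝ} (h0 : 0 ≤ α) (h1 : α ≤ 1) {t : ℕ} (ht : 1 ≤ t) :
    ((t : ℝ) + 1) ^ α ≤ (t : ℝ) ^ α + 1 := by
  have h := rpow_succ_sub_le h0 h1 ht
  have : (t : ℝ) ^ (α - 1) ≤ 1 :=
    Real.rpow_le_one_of_one_le_of_nonpos (by exact_mod_cast ht) (by linarith)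
  linarith

theorem isStepSeq_polyStep {α : ℝ} (h0 : 0 ≤ α) (h1 : α ≤ 1) : IsStepSeq (polyStep α) where
  pos t := by
    unfold polyStep
    split_ifs with h
    · exact one_pos
    · have : (0 : ℝ) < t := by exact_mod_cast Nat.pos_of_ne_zero h
      positivity
  le_one t := by
    unfold polyStep
    split_ifs with h
    · exact le_rfl
    · exact Real.rpow_le_one_of_one_le_of_nonpos
        (by exact_mod_cast Nat.pos_of_ne_zero h) (by linarith)
  mul_le t ht := by
    have ht0 : (0 : ℝ) < t := by exact_mod_cast ht
    rw [polyStep_succ, polyStep_of_pos α ht, Real.rpow_neg ht0.le, Real.rpow_neg (by positivity)]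
    have h := rpow_succ_le h0 h1 ht
    have hx : 0 < (t : ℝ) ^ α := by positivity
    have hy : 0 < ((t : ℝ) + 1) ^ α := by positivity
    rw [← div_eq_mul_inv, div_le_iff₀ hx, sub_le_iff_le_add]
    have : 1 = (((t : ℝ) + 1) ^ α)⁻¹ * ((t : ℝ) + 1) ^ α := (inv_mul_cancel₀ hy.ne').symm
    calc (1 : ℝ) = (((t : ℝ) + 1) ^ α)⁻¹ * ((t : ℝ) + 1) ^ α := this
      _ ≤ (((t : ℝ) + 1) ^ α)⁻¹ * ((t : ℝ) ^ α + 1) := by gcongr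
      _ = _ := by ring

/-- This is the choice of the burn-in time: κ t^{-α} ≥ 4/t means t^{1-α} ≥ 4/κ. -/
theorem four_div_le_polyStep {κ α : ℝ} (hκ : 0 < κ) (hα : α < 1) {t : ℕ}
    (ht : (4 / κ) ^ (1 / (1 - α)) ≤ t) : 4 / (t : ℝ) ≤ κ * polyStep α t := by
  have h4 : 0 < 4 / κ := by positivity
  have ht0 : (0 : ℝ) < t := lt_of_lt_of_le (Real.rpow_pos_of_pos h4 _) ht
  have h1 : 0 < 1 - α := by linarith
  have h2 : 4 / κ ≤ (t : ℝ) ^ (1 - α) := by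
    have := Real.rpow_le_rpow (Real.rpow_nonneg h4.le _) ht h1.le
    rwa [← Real.rpow_mul h4.le, one_div_mul_cancel h1.ne', Real.rpow_one] at this
  rw [polyStep_of_pos α (by exact_mod_cast ht0), div_le_iff₀ ht0]
  rw [div_le_iff₀ hκ] at h2
  have : (t : ℝ) ^ (1 - α) = (t : ℝ) ^ (-α) * t := by
    rw [← Real.rpow_add_one ht0.ne']; congr 1; ring
  rw [this] at h2
  linarith

end ScalarEstimates

/-! ### Moments of the error for polynomial step sizes. -/

section PolynomialSteps

theorem polyStep_nonneg (α : ℝ) (t : ℕ) : 0 ≤ polyStep α t := by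
  unfold polyStep; split_ifs <;> positivity

theorem polyStep_one (α : ℝ) : polyStep α 1 = 1 := by simp [polyStep]

theorem polyStep_succ_le {α : ℝ} (h0 : 0 ≤ α) {t : ℕ} (ht : 1 ≤ t) :
    polyStep α (t + 1) ≤ polyStep α t := by
  have : (0 : ℝ) < t := by exact_mod_cast ht
  rw [polyStep_succ, polyStep_of_pos α ht]
  exact Real.rpow_le_rpow_of_nonpos this (by linarith) (by linarith)

theorem mul_polyStep_le {α : ℝ} (h1 : α ≤ 1) {t : ℕ} (ht : 1 ≤ t) :
    (1 - 1 / ((t : ℝ) + 1)) * polyStep α t ≤ polyStep α (t + 1) := by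
  rw [polyStep_succ, polyStep_of_pos α ht]
  exact one_sub_mul_rpow_neg_le h1 ht

theorem sqrt_polyStep (α : ℝ) (t : ℕ) : Real.sqrt (polyStep α t) = polyStep (α / 2) t := by
  unfold polyStep
  split_ifs
  · exact Real.sqrt_one
  · rw [Real.sqrt_eq_rpow, ← Real.rpow_mul (Nat.cast_nonneg t)]
    congr 1; ring

theorem one_le_four_div_rpow {κ α : ℝ} (hκ : 0 < κ) (hκ1 : κ < 1) (hα : α < 1) :
    1 ≤ (4 / κ) ^ (1 / (1 - α)) := by
  apply Real.one_le_rpow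
  · rw [le_div_iff₀ hκ]; linarith
  · have : 0 < 1 - α := by linarith
    positivity

namespace IsPerturbedIter

variable {ι : Type*} [Fintype ι] [Nonempty ι] {Ω : Type*} {mΩ : MeasurableSpace Ω}
  {μ : Measure Ω} {ℱ : Filtration ℕ mΩ} [IsProbabilityMeasure μ] {κ h lam α : ℝ}
  {K : Matrix ι ι ℝ} {δ : ι → ℝ} {Δ ζ Z D : ℕ → Ω → ι → ℝ}

/-- The smoothed noise has second moment of order η_t, and the residual recursion, solved by
`contracting_recursion_le`, inherits this order at the price of 1/κ² and the burn-in weight. -/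
theorem poly_integral_norm_sq_le
    (hP : IsPerturbedIter μ ℱ κ h lam K (polyStep α) δ Δ ζ Z D)
    (hcard : 2 ≤ Fintype.card ι) (h0 : 0 ≤ α) (h1 : α < 1) {t : ℕ} (ht : 1 ≤ t) :
    ∫ ω, ‖Δ t ω‖ ^ 2 ∂μ ≤ 540 * (logCard ι * h / κ ^ 2) ^ 2
      * (polyStep α t + earlyWeight ((4 / κ) ^ (1 / (1 - α))) t) := by
  have hη : IsStepSeq (polyStep α) := isStepSeq_polyStep h0 h1.le
  have hκ := hP.rate_pos
  have hκ1 := hP.rate_lt_one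
  have hL := one_le_logCard hcard
  have hh := hP.one_le_scale
  have hτ := zero_lt_one.trans_le (one_le_four_div_rpow hκ hκ1 h1)
  set τ := (4 / κ) ^ (1 / (1 - α)) with hτdef
  set L := logCard ι with hLdef
  set E := 90 * (L * h / κ ^ 2) ^ 2 with hE
  have hE0 : 0 ≤ E := by positivity
  have hN : ∀ t, (∫ ω, ‖noise (polyStep α) Z D t ω‖ ^ 2 ∂μ) / κ ^ 2 ≤ E * polyStep α t := fun t => by
    rw [div_le_iff₀ (by positivity)]
    refine (hP.integral_noise_sq_le hη hcard t).trans (le_of_eq ?_)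
    rw [hE, ← hLdef]
    field_simp
  have hδE : ‖δ‖ ^ 2 ≤ E := by
    have h2 : ‖δ‖ ≤ L * h / κ ^ 2 := by
      refine hP.norm_init_le.trans ?_
      rw [div_le_div_iff₀ hκ (by positivity)]
      have : h * κ ≤ h * L := by gcongr; linarith
      nlinarith
    calc ‖δ‖ ^ 2 ≤ (L * h / κ ^ 2) ^ 2 := by gcongr
      _ ≤ E := by rw [hE]; nlinarith [sq_nonneg (L * h / κ ^ 2)]
  have hy1 : ∫ ω, ‖Δ 1 ω - noise (polyStep α) Z D 1 ω‖ ^ 2 ∂μ ≤ E * polyStep α 1 := by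
    have h2 := hP.integral_resid_sq_succ_le hη 0
    simp only [hP.resid_zero, integral_const, probReal_univ, one_smul, zero_add] at h2
    have h3 := hN 0
    rw [polyStep_one] at h2 ⊢
    have h4 : polyStep α 0 = 1 := by simp [polyStep]
    rw [h4] at h3
    refine h2.trans ?_
    have := mul_le_mul_of_nonneg_left h3 hκ.le
    have := mul_le_mul_of_nonneg_left hδE (sub_nonneg.2 hκ1.le)
    linarith
  have hrec := contracting_recursion_le (τ := τ) (M := 0)
    (y := fun t => ∫ ω, ‖Δ t ω - noise (polyStep α) Z D t ω‖ ^ 2 ∂μ)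
    (g := fun t => (∫ ω, ‖noise (polyStep α) Z D t ω‖ ^ 2 ∂μ) / κ ^ 2)
    (ρ := fun t => κ * polyStep α t) (p := fun t => E * polyStep α t) hτ le_rfl
    (fun t => mul_nonneg hκ.le (polyStep_nonneg α t))
    (fun t => mul_le_one₀ hκ1.le (polyStep_nonneg α t) (hη.le_one t))
    (fun t ht => four_div_le_polyStep hκ h1 ht)
    (fun t _ => mul_nonneg hE0 (polyStep_nonneg α t))
    (fun t ht => mul_le_mul_of_nonneg_left (polyStep_succ_le h0 ht) hE0)
    (fun t ht => by
      have := mul_le_mul_of_nonneg_left (mul_polyStep_le h1.le ht) hE0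
      linarith)
    (fun t _ => by simpa using hN t) hy1 (fun t _ => hP.integral_resid_sq_succ_le hη t) t ht
  have h5 := hP.integral_norm_sq_le_resid hη t
  have h6 := hN t
  rw [div_le_iff₀ (by positivity)] at h6
  have hp0 := polyStep_nonneg α t
  have he0 := earlyWeight_nonneg τ t
  have hκ2 : κ ^ 2 ≤ 1 := by nlinarith
  have h7 : E * polyStep α t * κ ^ 2 ≤ E * polyStep α t * 1 := by gcongr
  simp only [polyStep_one] at hrec
  -- Coefficients of η_t: twice the 2E of the residual, and at most 2E from the noise.
  have h8 : 540 * (L * h / κ ^ 2) ^ 2 = 6 * E := by rw [hE]; ring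
  rw [h8]
  have h9 : 0 ≤ E * earlyWeight τ t := by positivity
  linarith

/-- The variance of D at time j is of order E‖Δ_j‖², hence of order η_j, and an exponentially
weighted mean V of these keeps that order. Since a squared weight is at most η_t times the weight,
the total variance is of order η_t², and the filtered D is of order η_t instead of √η_t. -/
theorem poly_integral_filterD_le
    (hP : IsPerturbedIter μ ℱ κ h lam K (polyStep α) δ Δ ζ Z D)
    (hcard : 2 ≤ Fintype.card ι) (h0 : 0 ≤ α) (h1 : α < 1) {t : ℕ} (ht : 1 ≤ t) :
    ∫ ω, ‖linFilter (smoothMat ι (polyStep α)) (polyStep α) (fun j => D j ω) t‖ ∂μ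
      ≤ 210 * (logCard ι ^ 2 * h / κ ^ 2)
        * (polyStep α t + earlyWeight ((4 / κ) ^ (1 / (1 - α))) t) := by
  have hη : IsStepSeq (polyStep α) := isStepSeq_polyStep h0 h1.le
  have hF := hη.isStepFilter (ι := ι)
  have hκ := hP.rate_pos
  have hκ1 := hP.rate_lt_one
  have hL := one_le_logCard hcard
  have hh := hP.one_le_scale
  have hτ := zero_lt_one.trans_le (one_le_four_div_rpow hκ hκ1 h1)
  have hs := fun t ht => hP.poly_integral_norm_sq_le hcard h0 h1 (t := t) ht
  set τ := (4 / κ) ^ (1 / (1 - α)) with hτdef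
  set L := logCard ι with hLdef
  set G := L * h / κ ^ 2 with hG
  have hG0 : 0 ≤ G := by positivity
  set s : ℕ → ℝ := fun t => 4 * ∫ ω, ‖Δ t ω‖ ^ 2 ∂μ with hsdef
  set V : ℕ → ℝ := fun t =>
    ∑ j ∈ Finset.range t, filterWeight (fun t => 1 - polyStep α (t + 1)) (polyStep α) j t * s j
    with hV
  have hs0 : ∀ t, 0 ≤ s t := fun t =>
    mul_nonneg (by norm_num) (integral_nonneg fun ω => by positivity)
  have hV0 : ∀ t, 0 ≤ V t := fun t =>
    Finset.sum_nonneg fun j _ => mul_nonneg (hF.weight_nonneg j t) (hs0 j)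
  have hVs : ∀ t, V (t + 1) = (1 - polyStep α (t + 1)) * V t + polyStep α (t + 1) * s t :=
    fun t => sum_filterWeight_succ s t
  have hE0 : 0 ≤ 2160 * G ^ 2 := by positivity
  have hV1 : V 1 ≤ 2160 * G ^ 2 * polyStep α 1 := by
    rw [hVs 0, polyStep_one]
    have hδ : ‖δ‖ ≤ G := by
      refine hP.norm_init_le.trans ?_
      rw [hG, div_le_div_iff₀ hκ (by positivity)]
      have : h * κ ≤ h * L := by gcongr; linarith
      nlinarith
    have : s 0 = 4 * ‖δ‖ ^ 2 := by simp [hsdef, hP.init]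
    rw [this]
    nlinarith [norm_nonneg δ]
  -- V is itself an exponential smoothing of s, so it satisfies the scalar recursion with
  -- contraction η, which is stronger than κη.
  have hrec := contracting_recursion_le (τ := τ) (M := 2160 * G ^ 2) (y := V) (g := s)
    (ρ := polyStep α) (p := fun t => 2160 * G ^ 2 * polyStep α t) hτ hE0
    (polyStep_nonneg α) hη.le_one
    (fun t ht => (four_div_le_polyStep hκ h1 ht).trans
      (mul_le_of_le_one_left (polyStep_nonneg α t) hκ1.le))
    (fun t _ => mul_nonneg hE0 (polyStep_nonneg α t))
    (fun t ht => mul_le_mul_of_nonneg_left (polyStep_succ_le h0 ht) hE0)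
    (fun t ht => by
      have := mul_le_mul_of_nonneg_left (mul_polyStep_le h1.le ht) hE0
      linarith)
    (fun t ht => by
      have := hs t ht
      simp only [hsdef]
      linarith) hV1 (fun t _ => (hVs t).le) t ht
  simp only [polyStep_one] at hrec
  have hp0 := polyStep_nonneg α t
  have he0 := earlyWeight_nonneg τ t
  set p := polyStep α t
  set e := earlyWeight τ t
  have hVt : V t ≤ 10800 * G ^ 2 * (p + e) := by
    have : 0 ≤ G ^ 2 * p := by positivity
    linarith
  have h2 := hF.integral_norm_le hP.mdsD (by positivity) (x := s) (t := t)
    (fun j _ => hP.weightedVarLe_D j) (V := p * V t) (mul_nonneg hp0 (hV0 t)) (by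
      rw [hV, Finset.mul_sum]
      refine Finset.sum_le_sum fun j _ => ?_
      rw [sq, mul_assoc]
      exact mul_le_mul_of_nonneg_right (hF.weight_le j t)
        (mul_nonneg (hF.weight_nonneg j t) (hs0 j)))
  refine h2.trans ?_
  rw [← hLdef]
  -- 104² exceeds 10800. The square root of L is enlarged to L, and p to p + e, to obtain a perfect
  -- square.
  have h3 : Real.sqrt (L * (p * V t)) ≤ 104 * (L * G) * (p + e) := by
    apply Real.sqrt_le_iff.2 ⟨by positivity, ?_⟩
    have h4 : p * V t ≤ (p + e) * (10800 * G ^ 2 * (p + e)) :=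
      mul_le_mul (by linarith) hVt (hV0 t) (by positivity)
    calc L * (p * V t) ≤ (L * L) * ((p + e) * (10800 * G ^ 2 * (p + e))) := by
          refine mul_le_mul (by nlinarith) h4 (mul_nonneg hp0 (hV0 t)) (by positivity)
      _ ≤ (104 * (L * G) * (p + e)) ^ 2 := by
          have : 0 ≤ (L * G) ^ 2 * (p + e) ^ 2 := by positivity
          nlinarith
  have h5 : L * (p * (2 * h / κ)) ≤ 2 * (L * G) * p := by
    have h6 : h / κ ≤ G := by
      rw [hG, div_le_div_iff₀ hκ (by positivity)]
      have : h * κ ≤ h * L := by gcongr; linarith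
      nlinarith
    calc L * (p * (2 * h / κ)) = 2 * (L * (h / κ)) * p := by ring
      _ ≤ _ := by gcongr
  have h7 : L ^ 2 * h / κ ^ 2 = L * G := by rw [hG]; ring
  rw [h7]
  have h8 : 0 ≤ L * G * e := by positivity
  linarith

/-- Only the bound 1/κ on Z is used, so the leading order √η_t is independent of the initial error.
-/
theorem poly_integral_filterZ_le
    (hP : IsPerturbedIter μ ℱ κ h lam K (polyStep α) δ Δ ζ Z D)
    (hcard : 2 ≤ Fintype.card ι) (h0 : 0 ≤ α) (h1 : α < 1) (t : ℕ) :
    ∫ ω, ‖linFilter (smoothMat ι (polyStep α)) (polyStep α) (fun j => Z j ω) t‖ ∂μ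
      ≤ 2 * Real.sqrt (logCard ι) / κ * polyStep (α / 2) t + logCard ι / κ * polyStep α t := by
  have hη : IsStepSeq (polyStep α) := isStepSeq_polyStep h0 h1.le
  have hF := hη.isStepFilter (ι := ι)
  have hκ := hP.rate_pos
  have hL := one_le_logCard hcard
  have hp0 := polyStep_nonneg α t
  have hvar : ∀ j, WeightedVarLe μ ℱ Z j (1 / κ ^ 2) := fun j => by
    refine hP.mdsZ.weightedVarLe ?_
    have : ∫ ω, ‖Z j ω‖ ^ 2 ∂μ ≤ ∫ _, 1 / κ ^ 2 ∂μ := by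
      refine integral_mono (hP.mdsZ.integrable_norm_sq j) (integrable_const _) fun ω => ?_
      have := pow_le_pow_left₀ (norm_nonneg _) (hP.mdsZ.bound j ω) 2
      simpa [div_pow] using this
    simpa using this
  have h2 := hF.integral_norm_le hP.mdsZ (by positivity) (x := fun _ => 1 / κ ^ 2) (t := t)
    (fun j _ => hvar j) (V := polyStep α t * (1 / κ ^ 2)) (by positivity) (by
      have hle := sum_filterWeight_le_one (η := polyStep α) (fun t => hη.le_one _) t
      calc ∑ j ∈ Finset.range t,
            filterWeight (fun t => 1 - polyStep α (t + 1)) (polyStep α) j t ^ 2 * (1 / κ ^ 2)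
          ≤ ∑ j ∈ Finset.range t,
            filterWeight (fun t => 1 - polyStep α (t + 1)) (polyStep α) j t
              * (polyStep α t * (1 / κ ^ 2)) := by
            refine Finset.sum_le_sum fun j _ => ?_
            rw [sq, mul_assoc]
            exact mul_le_mul_of_nonneg_left (mul_le_mul_of_nonneg_right (hF.weight_le j t)
              (by positivity)) (hF.weight_nonneg j t)
        _ = (∑ j ∈ Finset.range t,
            filterWeight (fun t => 1 - polyStep α (t + 1)) (polyStep α) j t)
              * (polyStep α t * (1 / κ ^ 2)) := by rw [Finset.sum_mul]
        _ ≤ 1 * (polyStep α t * (1 / κ ^ 2)) := by gcongr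
        _ = _ := one_mul _)
  refine h2.trans (le_of_eq ?_)
  rw [Real.sqrt_mul (by linarith), Real.sqrt_mul hp0, sqrt_polyStep, Real.sqrt_div zero_le_one,
    Real.sqrt_one, Real.sqrt_sq hκ.le]
  ring

/-- The residual recursion is run again for the first moment, now with the smoothed noise split into
its Z and D parts. The term of order √η_t has coefficient √L/κ² only; the initial error appears at
order η_t and in the burn-in. -/
theorem poly_integral_norm_le
    (hP : IsPerturbedIter μ ℱ κ h lam K (polyStep α) δ Δ ζ Z D)
    (hcard : 2 ≤ Fintype.card ι) (h0 : 0 ≤ α) (h1 : α < 1) {t : ℕ} (ht : 1 ≤ t) :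
    ∫ ω, ‖Δ t ω‖ ∂μ ≤ 6 * Real.sqrt (logCard ι) / κ ^ 2 * polyStep (α / 2) t
      + 1500 * (logCard ι ^ 2 * h / κ ^ 3)
        * (polyStep α t + earlyWeight ((4 / κ) ^ (1 / (1 - α))) t) := by
  have hη : IsStepSeq (polyStep α) := isStepSeq_polyStep h0 h1.le
  have hF := hη.isStepFilter (ι := ι)
  have hκ := hP.rate_pos
  have hκ1 := hP.rate_lt_one
  have hL := one_le_logCard hcard
  have hh := hP.one_le_scale
  have hτ := zero_lt_one.trans_le (one_le_four_div_rpow hκ hκ1 h1)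
  have hD := fun t ht => hP.poly_integral_filterD_le hcard h0 h1 (t := t) ht
  have hZ := hP.poly_integral_filterZ_le hcard h0 h1
  set τ := (4 / κ) ^ (1 / (1 - α)) with hτdef
  set L := logCard ι with hLdef
  set R := L ^ 2 * h / κ ^ 3 with hR
  set r := Real.sqrt L / κ ^ 2 with hr
  have hR0 : 0 ≤ R := by positivity
  have hr0 : 0 ≤ r := by positivity
  -- The 211 combines 210 from D with the term L/κ · η_t from Z.
  have hN : ∀ t, 1 ≤ t → ∫ ω, ‖noise (polyStep α) Z D t ω‖ ∂μ
      ≤ κ * (2 * r * polyStep (α / 2) t + 211 * R * (polyStep α t + earlyWeight τ t)) :=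
    fun t ht => by
      have h2 : ∫ ω, ‖noise (polyStep α) Z D t ω‖ ∂μ
          ≤ ∫ ω, ‖linFilter (smoothMat ι (polyStep α)) (polyStep α) (fun j => Z j ω) t‖ ∂μ
          + ∫ ω, ‖linFilter (smoothMat ι (polyStep α)) (polyStep α) (fun j => D j ω) t‖ ∂μ := by
        refine integral_le_add (hP.integrable_noise hη t)
          (hF.integrable_norm hP.mdsZ (by positivity) t)
          (hF.integrable_norm hP.mdsD (by positivity) t) fun ω => ?_
        rw [noise, linFilter_add (fun j => Z j ω) (fun j => D j ω)]
        exact norm_add_le _ _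
      have h3 := hZ t
      have h4 := hD t ht
      have hp0 := polyStep_nonneg α t
      have he0 := earlyWeight_nonneg τ t
      have e1 : κ * (2 * r * polyStep (α / 2) t) = 2 * Real.sqrt L / κ * polyStep (α / 2) t := by
        rw [hr]; field_simp
      have e2 : L ^ 2 * h / κ ^ 2 = κ * R := by rw [hR]; field_simp
      have e3 : L / κ ≤ κ * R := by
        rw [← e2, div_le_div_iff₀ hκ (by positivity)]
        have : κ ^ 2 ≤ κ := by nlinarith
        have : L ≤ L ^ 2 * h := by nlinarith
        calc L * κ ^ 2 ≤ (L ^ 2 * h) * κ := by gcongr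
          _ = _ := by ring
      have e4 := mul_le_mul_of_nonneg_right e3 hp0
      have e5 : 0 ≤ κ * R * earlyWeight τ t := by positivity
      rw [e2] at h4
      rw [mul_add, e1]
      linarith
  set p : ℕ → ℝ := fun t => 2 * r * polyStep (α / 2) t + 211 * R * polyStep α t with hp
  have hy1 : ∫ ω, ‖Δ 1 ω - noise (polyStep α) Z D 1 ω‖ ∂μ ≤ p 1 := by
    have h2 := hP.integral_resid_succ_le hη 0
    have hN0 : ∀ ω, noise (polyStep α) Z D 0 ω = 0 := fun _ => rfl
    simp only [hP.init, hN0, sub_zero, integral_const, probReal_univ, one_smul, zero_add,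
      norm_zero, zero_div, mul_zero, add_zero, polyStep_one, mul_one, smul_zero] at h2
    simp only [hp, polyStep_one, mul_one]
    refine h2.trans ?_
    have h3 : ‖δ‖ ≤ R := by
      refine hP.norm_init_le.trans ?_
      rw [hR, div_le_div_iff₀ hκ (by positivity)]
      have h5 : κ ^ 3 ≤ κ := by
        have : κ ^ 2 ≤ 1 := by nlinarith
        nlinarith
      have h6 : h ≤ L ^ 2 * h := by
        have : 1 ≤ L ^ 2 := by nlinarith
        nlinarith
      calc h * κ ^ 3 ≤ (L ^ 2 * h) * κ := by gcongr
        _ = _ := by ring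
    have h4 : (1 - κ) * ‖δ‖ ≤ ‖δ‖ := by nlinarith [norm_nonneg δ]
    linarith
  have hrec := contracting_recursion_le (τ := τ) (M := 211 * R)
    (y := fun t => ∫ ω, ‖Δ t ω - noise (polyStep α) Z D t ω‖ ∂μ)
    (g := fun t => (∫ ω, ‖noise (polyStep α) Z D t ω‖ ∂μ) / κ)
    (ρ := fun t => κ * polyStep α t) (p := p) hτ (by positivity)
    (fun t => mul_nonneg hκ.le (polyStep_nonneg α t))
    (fun t => mul_le_one₀ hκ1.le (polyStep_nonneg α t) (hη.le_one t))
    (fun t ht => four_div_le_polyStep hκ h1 ht)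
    (fun t _ => by
      have := polyStep_nonneg α t
      have := polyStep_nonneg (α / 2) t
      simp only [hp]; positivity)
    (fun t ht => by
      have e1 := polyStep_succ_le h0 ht
      have e3 := polyStep_succ_le (α := α / 2) (by linarith) ht
      simp only [hp]
      gcongr)
    (fun t ht => by
      have e1 := mul_le_mul_of_nonneg_left (mul_polyStep_le h1.le ht)
        (by positivity : 0 ≤ 211 * R)
      have e2 := mul_le_mul_of_nonneg_left (mul_polyStep_le (α := α / 2) (by linarith) ht)
        (by positivity : 0 ≤ 2 * r)
      simp only [hp]
      linarith)
    (fun t ht => by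
      simp only [hp]
      rw [div_le_iff₀ hκ]
      refine (hN t ht).trans (le_of_eq ?_)
      ring) hy1 (fun t _ => hP.integral_resid_succ_le hη t) t ht
  have h5 := hP.integral_norm_le_resid hη t
  have h6 := hN t ht
  have hp0 := polyStep_nonneg α t
  have hp1 := polyStep_nonneg (α / 2) t
  have he0 := earlyWeight_nonneg τ t
  simp only [hp, polyStep_one, mul_one] at hrec
  have hrR : r ≤ R := by
    rw [hr, hR, div_le_div_iff₀ (by positivity) (by positivity)]
    have : Real.sqrt L ≤ L := by
      apply Real.sqrt_le_iff.2 ⟨by linarith, by nlinarith⟩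
    have h7 : Real.sqrt L ≤ L ^ 2 * h := by nlinarith
    have h8 : κ ^ 3 ≤ κ ^ 2 := pow_le_pow_of_le_one hκ.le hκ1.le (by norm_num)
    gcongr
  have e1 : 6 * Real.sqrt L / κ ^ 2 = 6 * r := by rw [hr]; ring
  rw [e1]
  have e2 := mul_le_mul_of_nonneg_right hrR he0
  have hx : 0 ≤ 2 * r * polyStep (α / 2) t + 211 * R * (polyStep α t + earlyWeight τ t) := by
    positivity
  have e3 := mul_le_mul_of_nonneg_right hκ1.le hx
  have e4 : 0 ≤ R * polyStep α t := by positivity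
  have e5 : 0 ≤ R * earlyWeight τ t := by positivity
  linarith

end IsPerturbedIter

end PolynomialSteps

/-! ### Bookkeeping of mean bounds together with integrability. -/

section MeanBound

variable {Ω : Type*} {mΩ : MeasurableSpace Ω} {μ : Measure Ω}

/-- `f` is integrable with mean at most `c`. -/
def MeanLe (μ : Measure Ω) (f : Ω → ℝ) (c : ℝ) : Prop := Integrable f μ ∧ ∫ ω, f ω ∂μ ≤ c

theorem MeanLe.add {f g : Ω → ℝ} {c d : ℝ} (hf : MeanLe μ f c) (hg : MeanLe μ g d) :
    MeanLe μ (fun ω => f ω + g ω) (c + d) :=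
  ⟨hf.1.add hg.1, (integral_add hf.1 hg.1).le.trans (add_le_add hf.2 hg.2)⟩

theorem MeanLe.const_mul {f : Ω → ℝ} {c a : ℝ} (ha : 0 ≤ a) (hf : MeanLe μ f c) :
    MeanLe μ (fun ω => a * f ω) (a * c) :=
  ⟨hf.1.const_mul a, (integral_const_mul a f).le.trans (mul_le_mul_of_nonneg_left hf.2 ha)⟩

theorem meanLe_const [IsProbabilityMeasure μ] (c : ℝ) : MeanLe μ (fun _ => c) c :=
  ⟨integrable_const c, by simp⟩

theorem MeanLe.sum {f : ℕ → Ω → ℝ} {c : ℕ → ℝ} {s : Finset ℕ}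
    (hf : ∀ t ∈ s, MeanLe μ (f t) (c t)) : MeanLe μ (fun ω => ∑ t ∈ s, f t ω) (∑ t ∈ s, c t) :=
  ⟨integrable_finsetSum _ fun t ht => (hf t ht).1,
    (integral_finsetSum _ fun t ht => (hf t ht).1).le.trans
      (Finset.sum_le_sum fun t ht => (hf t ht).2)⟩

theorem MeanLe.integral_le {f g : Ω → ℝ} {c : ℝ} (hg : MeanLe μ g c) (hf : Integrable f μ)
    (h : ∀ ω, f ω ≤ g ω) : ∫ ω, f ω ∂μ ≤ c :=
  (integral_mono hf hg.1 h).trans hg.2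

end MeanBound

/-! ### Summation by parts against monotone weights. -/

section AbelSummation

variable {E : Type*} [SeminormedAddCommGroup E] [NormedSpace ℝ E]

theorem sum_smul_sub_succ (b : ℕ → ℝ) (x : ℕ → E) (n : ℕ) :
    ∑ t ∈ Finset.range (n + 1), b (t + 1) • (x t - x (t + 1))
      = b 1 • x 0 - b (n + 1) • x (n + 1)
        + ∑ t ∈ Finset.range n, (b (t + 2) - b (t + 1)) • x (t + 1) := by
  induction n with
  | zero => simp [smul_sub]
  | succ n ih =>
    rw [Finset.sum_range_succ, ih, Finset.sum_range_succ (fun t => (b (t + 2) - b (t + 1)) • x (t + 1))]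
    module

theorem norm_sum_smul_sub_succ_le {b : ℕ → ℝ} (hb0 : ∀ t, 1 ≤ t → 0 ≤ b t)
    (hb : ∀ t, 1 ≤ t → b t ≤ b (t + 1)) (x : ℕ → E) (n : ℕ) :
    ‖∑ t ∈ Finset.range (n + 1), b (t + 1) • (x t - x (t + 1))‖
      ≤ b 1 * ‖x 0‖ + b (n + 1) * ‖x (n + 1)‖
        + ∑ t ∈ Finset.range n, (b (t + 2) - b (t + 1)) * ‖x (t + 1)‖ := by
  rw [sum_smul_sub_succ]
  refine (norm_add_le _ _).trans (add_le_add ((norm_sub_le _ _).trans (le_of_eq ?_))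
    (norm_sum_le_of_le _ fun t _ => le_of_eq ?_))
  · rw [norm_smul, norm_smul, Real.norm_of_nonneg (hb0 _ le_rfl),
      Real.norm_of_nonneg (hb0 _ (by omega))]
  · rw [norm_smul, Real.norm_of_nonneg (sub_nonneg.2 (hb (t + 1) (by omega)))]

end AbelSummation

/-! ### The inverse of I - γK in the sup norm. -/

section Resolvent

variable {ι : Type*} [Fintype ι] [DecidableEq ι] {κ : ℝ} {K : Matrix ι ι ℝ}

theorem mul_norm_le_norm_mulVec (hκ1 : κ ≤ 1) (hK : ∀ i k, 0 ≤ K i k)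
    (hK1 : ∀ i, ∑ k, K i k = 1) (x : ι → ℝ) :
    κ * ‖x‖ ≤ ‖(1 - (1 - κ) • K).mulVec x‖ := by
  have h1 : x = (1 - (1 - κ) • K).mulVec x + (1 - κ) • K.mulVec x := by
    rw [Matrix.sub_mulVec, Matrix.one_mulVec, Matrix.smul_mulVec, sub_add_cancel]
  have h2 : ‖x‖ ≤ ‖(1 - (1 - κ) • K).mulVec x‖ + ‖(1 - κ) • K.mulVec x‖ := by
    conv_lhs => rw [h1]
    exact norm_add_le _ _
  have h3 := norm_mulVec_le hK (fun i => (hK1 i).le) zero_le_one x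
  rw [norm_smul, Real.norm_of_nonneg (sub_nonneg.2 hκ1)] at h2
  have h4 := mul_le_mul_of_nonneg_left h3 (sub_nonneg.2 hκ1)
  linarith

theorem isUnit_resolvent (hκ : 0 < κ) (hκ1 : κ ≤ 1) (hK : ∀ i k, 0 ≤ K i k)
    (hK1 : ∀ i, ∑ k, K i k = 1) : IsUnit (1 - (1 - κ) • K) := by
  rw [← Matrix.mulVec_injective_iff_isUnit]
  intro x y hxy
  have h := mul_norm_le_norm_mulVec hκ1 hK hK1 (x - y)
  have h0 : (1 - (1 - κ) • K).mulVec (x - y) = 0 := by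
    rw [Matrix.mulVec_sub]; exact sub_eq_zero.2 hxy
  rw [h0, norm_zero] at h
  have : ‖x - y‖ ≤ 0 := by nlinarith [norm_nonneg (x - y)]
  exact sub_eq_zero.1 (norm_le_zero_iff.1 this)

theorem norm_resolvent_mulVec_le (hκ : 0 < κ) (hκ1 : κ ≤ 1) (hK : ∀ i k, 0 ≤ K i k)
    (hK1 : ∀ i, ∑ k, K i k = 1) (x : ι → ℝ) :
    ‖((1 - (1 - κ) • K)⁻¹).mulVec x‖ ≤ 1 / κ * ‖x‖ := by
  have hu := (Matrix.isUnit_iff_isUnit_det _).1 (isUnit_resolvent hκ hκ1 hK hK1)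
  have h := mul_norm_le_norm_mulVec hκ1 hK hK1 (((1 - (1 - κ) • K)⁻¹).mulVec x)
  rw [Matrix.mulVec_mulVec, Matrix.mul_nonsing_inv _ hu, Matrix.one_mulVec] at h
  rw [one_div, inv_mul_eq_div, le_div_iff₀ hκ]
  linarith

end Resolvent

/-- Since Y ≥ 1, √Y is enlarged to Y. This is lossy, but it brings the martingale sum of D to the
same shape as the sum of the quadratic terms, which needs Y anyway; 48² = 2304 covers 4 · 540. -/
theorem sqrt_mul_sq_mul_le {a L Y G S : ℝ} (ha : 0 ≤ a) (hL : 1 ≤ L) (hY : 1 ≤ Y)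
    (hS0 : 0 ≤ S) (hS : S ≤ 540 * (L * G) ^ 2 * Y) :
    Real.sqrt (L * (4 * a ^ 2 * S)) ≤ 48 * a * (L ^ 2 * |G|) * Y := by
  apply Real.sqrt_le_iff.2 ⟨by positivity, ?_⟩
  have h1 : L * 1 ≤ L * L := by gcongr
  have h2 : Y * 1 ≤ Y * Y := by gcongr
  have h3 : 540 * (L * G) ^ 2 * Y ≤ 576 * (L * G) ^ 2 * (Y * Y) := by
    gcongr
    · norm_num
    · linarith
  calc L * (4 * a ^ 2 * S) ≤ (L * L) * (4 * a ^ 2 * (576 * (L * G) ^ 2 * (Y * Y))) := by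
        refine mul_le_mul (by linarith) ?_ (by positivity) (by positivity)
        gcongr
        exact hS.trans h3
    _ = (48 * a * (L ^ 2 * |G|) * Y) ^ 2 := by
        rw [show (48 * a * (L ^ 2 * |G|) * Y) ^ 2 = (48 * a * L ^ 2 * Y) ^ 2 * |G| ^ 2 by ring,
          sq_abs]
        ring

set_option maxHeartbeats 1000000 in
/-- Collecting the error terms of the averaged iterates. -/
theorem poly_error_arith {κ L h i d aT TT I S x z c l τ e p₁ p₂ m : ℝ} (hκ : 0 < κ) (hκ1 : κ < 1)
    (hL : 1 ≤ L) (hh : 1 ≤ h) (hlam' : 0 ≤ i) (hτ : 1 ≤ τ) (hlog : 0 ≤ l) (hx1 : 0 ≤ x)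
    (hx2 : 0 ≤ z) (hc0 : 0 ≤ c) (hd0 : 0 ≤ d) (hδ : d ≤ h / κ) (hS0 : 0 ≤ S) (haT0 : 0 ≤ aT)
    (hTα : 1 ≤ TT) (f1 : TT * p₁ = z) (f2 : TT * p₂ = 1) (he0 : 0 ≤ e) (heT : TT * e ≤ 4 * τ)
    (hsumsq : S ≤ 540 * (L * h / κ ^ 2) ^ 2 * (c * x + 5 * τ))
    (hincr : I ≤ 24 * (Real.sqrt L / κ ^ 2) * z + 7500 * (L ^ 2 * h / κ ^ 3) * ((1 + l) * τ))
    (haT : aT ≤ 6 * Real.sqrt L / κ ^ 2 * p₁ + 1500 * (L ^ 2 * h / κ ^ 3) * (p₂ + e)) :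
    m + L * (1 / κ * (1 / κ))
        + 1 / κ * (d + TT * aT + I + (2 * Real.sqrt (L * (4 * (1 - κ) ^ 2 * S))
          + L * (2 * h / κ)) + (1 - κ) * (2 * i) * S) + (aT + d)
      ≤ m + 36 * (Real.sqrt L / κ ^ 3) * z
        + 23000 * (L ^ 2 * h ^ 2 / κ ^ 5) * (1 + i) * ((1 + l) * τ)
        + 1080 * (1 - κ) * (L ^ 2 * h ^ 2 / κ ^ 5) * (1 + i) * (c * x) := by
  -- In the application i = 1/λ, d = ‖δ‖, aT = E‖Δ_T‖, TT = T^α, I is the Abel sum, S the sum of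
  -- second moments, x = T^{1-α}, z = T^{α/2}, c = 1/(1-α), l = log T, e the burn-in weight at T,
  -- and m the leading term.
  set W := L ^ 2 * h ^ 2 / κ ^ 5 with hW
  set Y := c * x + 5 * τ with hY
  have hY1 : 1 ≤ Y := by
    have : 0 ≤ c * x := by positivity
    linarith
  have hW0 : 0 ≤ W := by positivity
  have hlτ : τ ≤ (1 + l) * τ := by nlinarith
  set Q := (1 + l) * τ with hQ
  have hQ1 : 1 ≤ Q := hτ.trans hlτ
  have hinv : 1 ≤ 1 / κ := by rw [le_div_iff₀ hκ]; linarith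
  have hLh : L ^ 2 * h ≤ L ^ 2 * h ^ 2 := by gcongr; nlinarith
  -- The power κ⁻⁵ is forced by the quadratic term, κ⁻¹ · (κ⁻²)²; all other error terms without z
  -- have smaller powers and are absorbed in W.
  have pw : ∀ (m : ℕ) (a : ℝ), m ≤ 5 → 0 ≤ a → a ≤ L ^ 2 * h ^ 2 → a / κ ^ m ≤ W :=
    fun m a hm ha0 ha => by
      rw [hW]
      have : κ ^ 5 ≤ κ ^ m := pow_le_pow_of_le_one hκ.le hκ1.le hm
      gcongr
  have hL2 : L * 1 ≤ L * L := by gcongr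
  have hh2 : h * 1 ≤ h * h := by gcongr
  have hLLh : L * h ≤ L ^ 2 * h ^ 2 := by
    calc L * h = (L * 1) * (h * 1) := by ring
      _ ≤ (L * L) * (h * h) := by gcongr
      _ = _ := by ring
  have hLle : L * 1 ≤ L * h := by gcongr
  have hhle : 1 * h ≤ L * h := by gcongr
  have hWQ1 : W ≤ W * Q := le_mul_of_one_le_right hW0 hQ1
  have u1 : L * (1 / κ * (1 / κ)) ≤ W * Q := by
    have : L * (1 / κ * (1 / κ)) = L / κ ^ 2 := by field_simp
    rw [this]
    exact (pw 2 L (by norm_num) (by linarith) (by linarith)).trans hWQ1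
  have u2 : d ≤ W * Q ∧ 1 / κ * d ≤ W * Q := by
    have e1 : 1 / κ * d ≤ W := by
      refine (mul_le_mul_of_nonneg_left hδ (by positivity)).trans ?_
      have : 1 / κ * (h / κ) = h / κ ^ 2 := by field_simp
      rw [this]
      exact pw 2 h (by norm_num) (by linarith) (by linarith)
    have e2 : 1 * d ≤ 1 / κ * d := mul_le_mul_of_nonneg_right hinv (hd0)
    constructor <;> linarith
  have u3 : 1 / κ * (TT * aT) ≤ 6 * (Real.sqrt L / κ ^ 3) * z + 7500 * (W * Q) := by
    have e1 := mul_le_mul_of_nonneg_left haT (by positivity : 0 ≤ 1 / κ * TT)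
    have e2 : 1 / κ * TT * (6 * Real.sqrt L / κ ^ 2 * p₁
        + 1500 * (L ^ 2 * h / κ ^ 3) * (p₂ + e))
        = 6 * (Real.sqrt L / κ ^ 3) * (TT * p₁)
          + 1500 * (L ^ 2 * h / κ ^ 4) * (TT * p₂
            + TT * e) := by field_simp
    rw [e2, f1, f2] at e1
    have e3 := pw 4 (L ^ 2 * h) (by norm_num) (by positivity) hLh
    have e4 : (L ^ 2 * h / κ ^ 4) * (1 + TT * e) ≤ W * (5 * Q) :=
      mul_le_mul e3 (by linarith) (by positivity) hW0
    linarith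
  have u4 : aT ≤ 1 / κ * (TT * aT) := by
    have e1 : 1 * aT ≤ TT * aT := mul_le_mul_of_nonneg_right hTα haT0
    have e2 : 1 * (TT * aT) ≤ 1 / κ * (TT * aT) :=
      mul_le_mul_of_nonneg_right hinv (by positivity)
    linarith
  have u5 : 1 / κ * I ≤ 24 * (Real.sqrt L / κ ^ 3) * z + 7500 * (W * Q) := by
    have e1 := mul_le_mul_of_nonneg_left hincr (by positivity : 0 ≤ 1 / κ)
    have e2 : 1 / κ * (24 * (Real.sqrt L / κ ^ 2) * z + 7500 * (L ^ 2 * h / κ ^ 3) * Q)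
        = 24 * (Real.sqrt L / κ ^ 3) * z + 7500 * ((L ^ 2 * h / κ ^ 4) * Q) := by field_simp
    rw [e2] at e1
    have e3 := mul_le_mul_of_nonneg_right
      (pw 4 (L ^ 2 * h) (by norm_num) (by positivity) hLh) (by linarith : 0 ≤ Q)
    linarith
  have u6 : 1 / κ * Real.sqrt (L * (4 * (1 - κ) ^ 2 * S)) ≤ 48 * (1 - κ) * (W * Y) := by
    have e1 : Real.sqrt (L * (4 * (1 - κ) ^ 2 * S))
        ≤ 48 * (1 - κ) * (L ^ 2 * h / κ ^ 2) * Y := by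
      rw [mul_div_assoc]
      rw [mul_div_assoc] at hsumsq
      have := sqrt_mul_sq_mul_le (sub_nonneg.2 hκ1.le) hL hY1 hS0 hsumsq
      rwa [abs_of_nonneg (by positivity : 0 ≤ h / κ ^ 2)] at this
    have e2 := mul_le_mul_of_nonneg_left e1 (by positivity : 0 ≤ 1 / κ)
    have e3 : 1 / κ * (48 * (1 - κ) * (L ^ 2 * h / κ ^ 2) * Y)
        = 48 * (1 - κ) * ((L ^ 2 * h / κ ^ 3) * Y) := by field_simp
    rw [e3] at e2
    have h1κ := sub_nonneg.2 hκ1.le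
    have e4 := mul_le_mul_of_nonneg_right
      (pw 3 (L ^ 2 * h) (by norm_num) (by positivity) hLh) (by linarith : 0 ≤ Y)
    have e5 := mul_le_mul_of_nonneg_left e4 (by positivity : 0 ≤ 48 * (1 - κ))
    exact e2.trans e5
  have u7 : 1 / κ * (L * (2 * h / κ)) ≤ 2 * (W * Q) := by
    have e1 : 1 / κ * (L * (2 * h / κ)) = 2 * (L * h / κ ^ 2) := by field_simp
    have e2 := pw 2 (L * h) (by norm_num) (by positivity) hLLh
    rw [e1]
    linarith
  have u8 : 1 / κ * ((1 - κ) * (2 * i) * S) ≤ 1080 * (1 - κ) * (i) * (W * Y) := by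
    have h1κ := sub_nonneg.2 hκ1.le
    have e1 := mul_le_mul_of_nonneg_left hsumsq
      (by positivity : 0 ≤ 1 / κ * ((1 - κ) * (2 * i)))
    have e2 : 1 / κ * ((1 - κ) * (2 * i)) * (540 * (L * h / κ ^ 2) ^ 2 * Y)
        = 1080 * (1 - κ) * (i) * (W * Y) := by rw [hW]; field_simp; ring
    linarith
  have h1κ := sub_nonneg.2 hκ1.le
  have hκle : 1 - κ ≤ 1 := by linarith
  have hWQ : 0 ≤ W * Q := by positivity
  have u9 : (1 - κ) * (W * τ) ≤ W * Q := by
    calc (1 - κ) * (W * τ) ≤ 1 * (W * Q) := by gcongr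
      _ = _ := one_mul _
  have u10 : i * ((1 - κ) * (W * τ)) ≤ i * (W * Q) := mul_le_mul_of_nonneg_left u9 hlam'
  have u11 : 0 ≤ (1 - κ) * (W * (c * x)) := by positivity
  have u12 : 0 ≤ i * (W * Q) := by positivity
  have e6 : 48 * (1 - κ) * (W * Y) = 48 * ((1 - κ) * (W * (c * x))) + 240 * ((1 - κ) * (W * τ)) := by
    rw [hY]; ring
  have e7 : 1080 * (1 - κ) * i * (W * Y)
      = 1080 * (i * ((1 - κ) * (W * (c * x)))) + 5400 * (i * ((1 - κ) * (W * τ))) := by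
    rw [hY]; ring
  rw [e6] at u6
  rw [e7] at u8
  have e8 : 23000 * W * (1 + i) * Q = 23000 * (W * Q) + 23000 * (i * (W * Q)) := by ring
  have e9 : 1080 * (1 - κ) * W * (1 + i) * (c * x)
      = 1080 * ((1 - κ) * (W * (c * x))) + 1080 * (i * ((1 - κ) * (W * (c * x)))) := by ring
  rw [e8, e9]
  have e10 : 1 / κ * (d + TT * aT + I + (2 * Real.sqrt (L * (4 * (1 - κ) ^ 2 * S))
      + L * (2 * h / κ)) + (1 - κ) * (2 * i) * S)
      = 1 / κ * d + 1 / κ * (TT * aT) + 1 / κ * I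
        + 2 * (1 / κ * Real.sqrt (L * (4 * (1 - κ) ^ 2 * S))) + 1 / κ * (L * (2 * h / κ))
        + 1 / κ * ((1 - κ) * (2 * i) * S) := by ring
  rw [e10]
  linarith [u2.1, u2.2]

/-! ### The averaged error for polynomial step sizes. -/

section PolynomialAverage

namespace IsPerturbedIter

variable {ι : Type*} [Fintype ι] [Nonempty ι] {Ω : Type*} {mΩ : MeasurableSpace Ω}
  {μ : Measure Ω} {ℱ : Filtration ℕ mΩ} [IsProbabilityMeasure μ] {κ h lam α : ℝ}
  {K : Matrix ι ι ℝ} {η : ℕ → ℝ} {δ : ι → ℝ} {Δ ζ Z D : ℕ → Ω → ι → ℝ}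

/-- Polyak–Ruppert decomposition, pathwise. With G = I - γK the recursion reads GΔ_t = η_{t+1}⁻¹(Δ_t
- Δ_{t+1}) + Z_t + D_t + γζ_t. Only the Z part is kept under G⁻¹; for the rest G⁻¹ is replaced by
its norm bound 1/κ. -/
theorem norm_sum_le [DecidableEq ι] (hP : IsPerturbedIter μ ℱ κ h lam K η δ Δ ζ Z D)
    (hη0 : ∀ t, 0 < η t) (hη : ∀ t, 1 ≤ t → η (t + 1) ≤ η t) (n : ℕ) (ω : Ω) :
    ‖∑ t ∈ Finset.range (n + 1), Δ (t + 1) ω‖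
      ≤ ‖∑ t ∈ Finset.range (n + 1), ((1 - (1 - κ) • K)⁻¹).mulVec (Z t ω)‖
        + 1 / κ * ((η 1)⁻¹ * ‖δ‖ + (η (n + 1))⁻¹ * ‖Δ (n + 1) ω‖
            + ∑ t ∈ Finset.range n, ((η (t + 2))⁻¹ - (η (t + 1))⁻¹) * ‖Δ (t + 1) ω‖
            + ‖∑ t ∈ Finset.range (n + 1), D t ω‖
            + (1 - κ) * (2 * (1 / lam)) * ∑ t ∈ Finset.range (n + 1), ‖Δ t ω‖ ^ 2)
        + (‖Δ (n + 1) ω‖ + ‖δ‖) := by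
  set G := 1 - (1 - κ) • K with hG
  have hκ := hP.rate_pos
  have hκ1 := hP.rate_lt_one.le
  have hu := (Matrix.isUnit_iff_isUnit_det _).1
    (isUnit_resolvent hκ hκ1 hP.mat_nonneg hP.mat_sum)
  rw [← hG] at hu
  have hstep : ∀ t, G.mulVec (Δ t ω) = (η (t + 1))⁻¹ • (Δ t ω - Δ (t + 1) ω)
      + (Z t ω + D t ω + (1 - κ) • ζ t ω) := fun t => by
    have e1 : Δ t ω - Δ (t + 1) ω = η (t + 1) • (G.mulVec (Δ t ω)
        - (Z t ω + D t ω + (1 - κ) • ζ t ω)) := by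
      rw [hP.step t ω, hG, Matrix.sub_mulVec, Matrix.one_mulVec, Matrix.smul_mulVec]
      module
    rw [e1, smul_smul, inv_mul_cancel₀ (hη0 _).ne', one_smul, sub_add_cancel]
  set rest := ∑ t ∈ Finset.range (n + 1), (η (t + 1))⁻¹ • (Δ t ω - Δ (t + 1) ω)
    + ∑ t ∈ Finset.range (n + 1), D t ω + (1 - κ) • ∑ t ∈ Finset.range (n + 1), ζ t ω with hrest
  have hsum : G.mulVec (∑ t ∈ Finset.range (n + 1), Δ t ω)
      = ∑ t ∈ Finset.range (n + 1), Z t ω + rest := by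
    rw [Matrix.mulVec_sum, Finset.sum_congr rfl fun t _ => hstep t]
    simp only [Finset.sum_add_distrib, hrest, Finset.smul_sum]
    abel
  have hS : ∑ t ∈ Finset.range (n + 1), Δ t ω
      = ∑ t ∈ Finset.range (n + 1), G⁻¹.mulVec (Z t ω) + G⁻¹.mulVec rest := by
    rw [← Matrix.mulVec_sum, ← Matrix.mulVec_add, ← hsum, Matrix.mulVec_mulVec,
      Matrix.nonsing_inv_mul _ hu, Matrix.one_mulVec]
  -- The recursion is summed over Δ_0, …, Δ_n, whereas the average runs over Δ_1, …, Δ_{n+1}; the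
  -- shift costs two boundary terms.
  have hshift : ∑ t ∈ Finset.range (n + 1), Δ (t + 1) ω
      = ∑ t ∈ Finset.range (n + 1), Δ t ω + (Δ (n + 1) ω - δ) := by
    have := Finset.sum_range_sub (fun t => Δ t ω) (n + 1)
    rw [Finset.sum_sub_distrib, hP.init] at this
    rw [← this]; abel
  have habel := norm_sum_smul_sub_succ_le (b := fun t => (η t)⁻¹)
    (fun t _ => (inv_pos.2 (hη0 t)).le) (fun t ht => inv_anti₀ (hη0 _) (hη t ht))
    (fun t => Δ t ω) n
  rw [hP.init] at habel
  have hζ : ‖(1 - κ) • ∑ t ∈ Finset.range (n + 1), ζ t ω‖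
      ≤ (1 - κ) * (2 * (1 / lam)) * ∑ t ∈ Finset.range (n + 1), ‖Δ t ω‖ ^ 2 := by
    rw [norm_smul, Real.norm_of_nonneg (sub_nonneg.2 hκ1), mul_assoc]
    refine mul_le_mul_of_nonneg_left ?_ (sub_nonneg.2 hκ1)
    rw [Finset.mul_sum]
    exact norm_sum_le_of_le _ fun t _ => (hP.quad t ω).trans (le_of_eq (by ring))
  have hrn : ‖rest‖ ≤ (η 1)⁻¹ * ‖δ‖ + (η (n + 1))⁻¹ * ‖Δ (n + 1) ω‖
      + ∑ t ∈ Finset.range n, ((η (t + 2))⁻¹ - (η (t + 1))⁻¹) * ‖Δ (t + 1) ω‖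
      + ‖∑ t ∈ Finset.range (n + 1), D t ω‖
      + (1 - κ) * (2 * (1 / lam)) * ∑ t ∈ Finset.range (n + 1), ‖Δ t ω‖ ^ 2 :=
    (norm_add_le _ _).trans (add_le_add ((norm_add_le _ _).trans
      (add_le_add habel le_rfl)) hζ)
  have hG1 := norm_resolvent_mulVec_le hκ hκ1 hP.mat_nonneg hP.mat_sum rest
  rw [← hG] at hG1
  have hG2 := mul_le_mul_of_nonneg_left hrn (by positivity : 0 ≤ 1 / κ)
  rw [hshift, hS]
  refine (norm_add_le _ _).trans (add_le_add ((norm_add_le _ _).trans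
    (add_le_add le_rfl (hG1.trans hG2))) (norm_sub_le _ _))

theorem integrable_sum (hP : IsPerturbedIter μ ℱ κ h lam K η δ Δ ζ Z D) (n : ℕ) :
    Integrable (fun ω => ‖∑ t ∈ Finset.range n, Δ (t + 1) ω‖) μ :=
  integrable_of_abs_le (C := ∑ t ∈ Finset.range n, h / κ)
    (Finset.measurable_sum _ fun t _ => hP.measurable (t + 1)).norm fun ω => by
      rw [abs_norm]; exact norm_sum_le_of_le _ fun t _ => hP.bound (t + 1) ω

theorem poly_sum_sq_le (hP : IsPerturbedIter μ ℱ κ h lam K (polyStep α) δ Δ ζ Z D)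
    (hcard : 2 ≤ Fintype.card ι) (h0 : 0 ≤ α) (h1 : α < 1) (n : ℕ) :
    ∑ t ∈ Finset.range (n + 1), ∫ ω, ‖Δ t ω‖ ^ 2 ∂μ
      ≤ 540 * (logCard ι * h / κ ^ 2) ^ 2 * (1 / (1 - α) * ((n + 1 : ℕ) : ℝ) ^ (1 - α)
        + 5 * (4 / κ) ^ (1 / (1 - α))) := by
  have hκ := hP.rate_pos
  have hκ1 := hP.rate_lt_one
  have hL := one_le_logCard hcard
  have hh := hP.one_le_scale
  have hτ := one_le_four_div_rpow hκ hκ1 h1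
  have hs := fun t => hP.poly_integral_norm_sq_le hcard h0 h1 (t := t + 1) (by omega)
  have hδ := hP.norm_init_le
  set τ := (4 / κ) ^ (1 / (1 - α)) with hτdef
  set L := logCard ι with hLdef
  set G := L * h / κ ^ 2 with hG
  have h1α : 0 < 1 - α := by linarith
  -- The moment bound starts at time 1, so the initial error is treated separately; it turns 4τ into
  -- 5τ.
  rw [Finset.sum_range_succ']
  have hδ2 : ∫ ω, ‖Δ 0 ω‖ ^ 2 ∂μ ≤ G ^ 2 := by
    simp only [hP.init, integral_const, probReal_univ, one_smul]
    have h3 : h / κ ≤ G := by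
      rw [hG, div_le_div_iff₀ hκ (by positivity)]
      have : h * κ ≤ h * L := by gcongr; linarith
      nlinarith
    exact pow_le_pow_left₀ (norm_nonneg _) (hδ.trans h3) 2
  have h2 : ∑ t ∈ Finset.range n, ∫ ω, ‖Δ (t + 1) ω‖ ^ 2 ∂μ
      ≤ 540 * G ^ 2 * (((n + 1 : ℕ) : ℝ) ^ (1 - α) / (1 - α) + 4 * τ) := by
    calc ∑ t ∈ Finset.range n, ∫ ω, ‖Δ (t + 1) ω‖ ^ 2 ∂μ
        ≤ ∑ t ∈ Finset.range n,
          540 * G ^ 2 * (((t : ℝ) + 1) ^ (1 - α - 1) + earlyWeight τ (t + 1)) := by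
          refine Finset.sum_le_sum fun t _ => (hs t).trans (le_of_eq ?_)
          rw [polyStep_succ]
          congr 3; ring
      _ = 540 * G ^ 2 * (∑ t ∈ Finset.range n, ((t : ℝ) + 1) ^ (1 - α - 1)
          + ∑ t ∈ Finset.range n, earlyWeight τ (t + 1)) := by
          rw [← Finset.sum_add_distrib, Finset.mul_sum]
      _ ≤ _ := by
          have e1 := sum_rpow_le h1α (by linarith) n
          have e2 := sum_earlyWeight_le (zero_lt_one.trans_le hτ) n
          have e3 : (n : ℝ) ^ (1 - α) / (1 - α) ≤ ((n + 1 : ℕ) : ℝ) ^ (1 - α) / (1 - α) := by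
            gcongr; simp
          gcongr
          exact e1.trans e3
  have e : 1 / (1 - α) * ((n + 1 : ℕ) : ℝ) ^ (1 - α) = ((n + 1 : ℕ) : ℝ) ^ (1 - α) / (1 - α) := by
    ring
  rw [e]
  have h3 : G ^ 2 * 1 ≤ G ^ 2 * τ := by gcongr
  have h4 : 0 ≤ G ^ 2 * τ := by positivity
  linarith

/-- The inverse steps grow by at most t^{α-1}. Against the three parts of E‖Δ_t‖ this gives a sum of
t^{α/2-1}, of order T^{α/2}, a harmonic sum, and the burn-in sum 4τ. -/
theorem poly_sum_increment_le (hP : IsPerturbedIter μ ℱ κ h lam K (polyStep α) δ Δ ζ Z D)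
    (hcard : 2 ≤ Fintype.card ι) (h0 : 1 / 2 < α) (h1 : α < 1) (n : ℕ) :
    ∑ t ∈ Finset.range n, ((polyStep α (t + 2))⁻¹ - (polyStep α (t + 1))⁻¹)
        * ∫ ω, ‖Δ (t + 1) ω‖ ∂μ
      ≤ 24 * (Real.sqrt (logCard ι) / κ ^ 2) * ((n + 1 : ℕ) : ℝ) ^ (α / 2)
        + 7500 * (logCard ι ^ 2 * h / κ ^ 3)
          * ((1 + Real.log (n + 1 : ℕ)) * (4 / κ) ^ (1 / (1 - α))) := by
  have hκ := hP.rate_pos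
  have hκ1 := hP.rate_lt_one
  have hL := one_le_logCard hcard
  have hh := hP.one_le_scale
  have hτ := one_le_four_div_rpow hκ hκ1 h1
  have ha := fun t => hP.poly_integral_norm_le hcard (by linarith) h1 (t := t + 1) (by omega)
  set τ := (4 / κ) ^ (1 / (1 - α)) with hτdef
  set L := logCard ι with hLdef
  set R := L ^ 2 * h / κ ^ 3 with hR
  set r := Real.sqrt L / κ ^ 2 with hr
  have hR0 : 0 ≤ R := by positivity
  have hr0 : 0 ≤ r := by positivity
  have hterm : ∀ t : ℕ, ((polyStep α (t + 2))⁻¹ - (polyStep α (t + 1))⁻¹)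
        * ∫ ω, ‖Δ (t + 1) ω‖ ∂μ
      ≤ 6 * r * ((t : ℝ) + 1) ^ (α / 2 - 1)
        + 1500 * R * (1 / ((t : ℝ) + 1) + earlyWeight τ (t + 1)) := fun t => by
    have hx : (0 : ℝ) < (t : ℝ) + 1 := by positivity
    have e1 := rpow_succ_sub_le (α := α) (by linarith) h1.le (t := t + 1) (by omega)
    rw [inv_polyStep α (by omega), inv_polyStep α (by omega)]
    have e2 : ((t + 2 : ℕ) : ℝ) = ((t + 1 : ℕ) : ℝ) + 1 := by push_cast; ring
    rw [e2]
    have h3 := ha t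
    rw [polyStep_succ, polyStep_succ] at h3
    push_cast at e1 ⊢
    have hy0 : 0 ≤ ((t : ℝ) + 1) ^ (α - 1) := by positivity
    have hy1 : ((t : ℝ) + 1) ^ (α - 1) ≤ 1 :=
      Real.rpow_le_one_of_one_le_of_nonpos (by linarith [Nat.cast_nonneg (α := ℝ) t])
        (by linarith)
    have hint : 0 ≤ ∫ ω, ‖Δ (t + 1) ω‖ ∂μ := integral_nonneg fun ω => norm_nonneg _
    have f1 : ((t : ℝ) + 1) ^ (α - 1) * ((t : ℝ) + 1) ^ (-(α / 2))
        = ((t : ℝ) + 1) ^ (α / 2 - 1) := by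
      rw [← Real.rpow_add hx]; congr 1; ring
    have f2 : ((t : ℝ) + 1) ^ (α - 1) * ((t : ℝ) + 1) ^ (-α) = 1 / ((t : ℝ) + 1) := by
      rw [← Real.rpow_add hx, one_div, ← Real.rpow_neg_one]; congr 1; ring
    have f3 : ((t : ℝ) + 1) ^ (α - 1) * earlyWeight τ (t + 1) ≤ 1 * earlyWeight τ (t + 1) :=
      mul_le_mul_of_nonneg_right hy1 (earlyWeight_nonneg _ _)
    calc (((t : ℝ) + 1 + 1) ^ α - ((t : ℝ) + 1) ^ α) * ∫ ω, ‖Δ (t + 1) ω‖ ∂μ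
        ≤ ((t : ℝ) + 1) ^ (α - 1) * ∫ ω, ‖Δ (t + 1) ω‖ ∂μ := by gcongr
      _ ≤ ((t : ℝ) + 1) ^ (α - 1) * (6 * Real.sqrt L / κ ^ 2 * ((t : ℝ) + 1) ^ (-(α / 2))
          + 1500 * R * (((t : ℝ) + 1) ^ (-α) + earlyWeight τ (t + 1))) := by gcongr
      _ = 6 * r * (((t : ℝ) + 1) ^ (α - 1) * ((t : ℝ) + 1) ^ (-(α / 2)))
          + 1500 * R * (((t : ℝ) + 1) ^ (α - 1) * ((t : ℝ) + 1) ^ (-α)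
            + ((t : ℝ) + 1) ^ (α - 1) * earlyWeight τ (t + 1)) := by rw [hr]; ring
      _ ≤ _ := by
          rw [f1, f2]
          gcongr
          simpa using f3
  refine (Finset.sum_le_sum fun t _ => hterm t).trans ?_
  rw [Finset.sum_add_distrib, ← Finset.mul_sum, ← Finset.mul_sum, Finset.sum_add_distrib]
  have g1 := sum_rpow_le (θ := α / 2) (by linarith) (by linarith) n
  have g2 := sum_inv_le n
  have g3 := sum_earlyWeight_le (zero_lt_one.trans_le hτ) n
  -- Here α > 1/2 bounds 2/α by the absolute constant 4.
  have g4 : (n : ℝ) ^ (α / 2) / (α / 2) ≤ 4 * ((n + 1 : ℕ) : ℝ) ^ (α / 2) := by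
    have : (n : ℝ) ^ (α / 2) ≤ ((n + 1 : ℕ) : ℝ) ^ (α / 2) := by
      gcongr; simp
    rw [div_le_iff₀ (by linarith)]
    have h4 : 0 ≤ ((n + 1 : ℕ) : ℝ) ^ (α / 2) := by positivity
    nlinarith
  have g5 : Real.log n ≤ Real.log (n + 1 : ℕ) := by
    rcases Nat.eq_zero_or_pos n with rfl | hn
    · simp
    · exact Real.log_le_log (by exact_mod_cast hn) (by simp)
  have g6 : 0 ≤ Real.log (n + 1 : ℕ) := Real.log_natCast_nonneg _
  set l := Real.log (n + 1 : ℕ)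
  have g7 : ∑ t ∈ Finset.range n, 1 / ((t : ℝ) + 1) + ∑ t ∈ Finset.range n, earlyWeight τ (t + 1)
      ≤ 5 * ((1 + l) * τ) := by
    have : 0 ≤ l * τ := by positivity
    nlinarith [mul_nonneg g6 (sub_nonneg.2 hτ)]
  have g8 := mul_le_mul_of_nonneg_left (g1.trans g4) (by positivity : 0 ≤ 6 * r)
  have g9 := mul_le_mul_of_nonneg_left g7 (by positivity : 0 ≤ 1500 * R)
  linarith

/-- Bound for the averaged iterates with polynomial step sizes. -/
theorem poly_average_le [DecidableEq ι]
    (hP : IsPerturbedIter μ ℱ κ h lam K (polyStep α) δ Δ ζ Z D)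
    (hcard : 2 ≤ Fintype.card ι) (h0 : 1 / 2 < α) (h1 : α < 1) {v : ℝ} (hv0 : 0 ≤ v)
    (hv : ∀ t, WeightedVarLe μ ℱ (fun t ω => ((1 - (1 - κ) • K)⁻¹).mulVec (Z t ω)) t v)
    {T : ℕ} (hT : 1 ≤ T) :
    ∫ ω, ‖∑ t ∈ Finset.range T, Δ (t + 1) ω‖ ∂μ
      ≤ 2 * Real.sqrt (logCard ι * (T * v))
        + 36 * (Real.sqrt (logCard ι) / κ ^ 3) * (T : ℝ) ^ (α / 2)
        + 23000 * (logCard ι ^ 2 * h ^ 2 / κ ^ 5) * (1 + 1 / lam)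
          * ((1 + Real.log T) * (4 / κ) ^ (1 / (1 - α)))
        + 1080 * (1 - κ) * (logCard ι ^ 2 * h ^ 2 / κ ^ 5) * (1 + 1 / lam)
          * (1 / (1 - α) * (T : ℝ) ^ (1 - α)) := by
  obtain ⟨n, rfl⟩ : ∃ n, T = n + 1 := ⟨T - 1, by omega⟩
  have hη : IsStepSeq (polyStep α) := isStepSeq_polyStep (by linarith) h1.le
  have hκ := hP.rate_pos
  have hκ1 := hP.rate_lt_one
  have hlam := hP.lam_pos
  have hL := one_le_logCard hcard
  have hh := hP.one_le_scale
  have hτ := one_le_four_div_rpow hκ hκ1 h1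
  have hJ : IsBoundedMDS μ ℱ (fun t ω => ((1 - (1 - κ) • K)⁻¹).mulVec (Z t ω))
      (1 / κ * (1 / κ)) := hP.mdsZ.mulVec (fun _ => (1 - (1 - κ) • K)⁻¹) fun t ω =>
    (norm_resolvent_mulVec_le hκ hκ1.le hP.mat_nonneg hP.mat_sum _).trans
      (mul_le_mul_of_nonneg_left (hP.mdsZ.bound t ω) (by positivity))
  have hsumsq := hP.poly_sum_sq_le hcard (by linarith) h1 n
  have hincr := hP.poly_sum_increment_le hcard h0 h1 n
  have haT := hP.poly_integral_norm_le hcard (by linarith) h1 (t := n + 1) (by omega)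
  have heT := rpow_mul_earlyWeight_le hτ (by linarith : 0 ≤ α) h1.le (n + 1)
  have mZ : MeanLe μ (fun ω => ‖∑ t ∈ Finset.range (n + 1),
      ((1 - (1 - κ) • K)⁻¹).mulVec (Z t ω)‖) (2 * Real.sqrt (logCard ι * ((n + 1 : ℕ) * v))
        + logCard ι * (1 / κ * (1 / κ))) :=
    ⟨integrable_of_abs_le (Finset.measurable_sum _ fun t _ => hJ.measurable t).norm fun ω => by
        rw [abs_norm]; exact hJ.norm_sum_le _ ω,
      hJ.integral_norm_sum_le_sqrt (by positivity) (v := fun _ => v) (fun t _ => hv t)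
        (by positivity) (by simp)⟩
  have hS0 : 0 ≤ ∑ t ∈ Finset.range (n + 1), ∫ ω, ‖Δ t ω‖ ^ 2 ∂μ :=
    Finset.sum_nonneg fun t _ => integral_nonneg fun ω => by positivity
  have mD : MeanLe μ (fun ω => ‖∑ t ∈ Finset.range (n + 1), D t ω‖)
      (2 * Real.sqrt (logCard ι * (4 * (1 - κ) ^ 2
        * ∑ t ∈ Finset.range (n + 1), ∫ ω, ‖Δ t ω‖ ^ 2 ∂μ)) + logCard ι * (2 * h / κ)) :=
    ⟨integrable_of_abs_le (Finset.measurable_sum _ fun t _ => hP.mdsD.measurable t).norm fun ω => by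
        rw [abs_norm]; exact hP.mdsD.norm_sum_le _ ω,
      hP.mdsD.integral_norm_sum_le_sqrt (by positivity)
        (v := fun t => 4 * (1 - κ) ^ 2 * ∫ ω, ‖Δ t ω‖ ^ 2 ∂μ)
        (fun t _ => hP.mdsD.weightedVarLe (hP.integral_normD_sq_le t))
        (by positivity) (by rw [Finset.mul_sum])⟩
  have mΔ : ∀ t, MeanLe μ (fun ω => ‖Δ t ω‖) (∫ ω, ‖Δ t ω‖ ∂μ) := fun t =>
    ⟨hP.integrable_norm t, le_rfl⟩
  have mI : MeanLe μ (fun ω => ∑ t ∈ Finset.range n,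
      ((polyStep α (t + 2))⁻¹ - (polyStep α (t + 1))⁻¹) * ‖Δ (t + 1) ω‖)
      (∑ t ∈ Finset.range n, ((polyStep α (t + 2))⁻¹ - (polyStep α (t + 1))⁻¹)
        * ∫ ω, ‖Δ (t + 1) ω‖ ∂μ) :=
    MeanLe.sum fun t _ => (mΔ (t + 1)).const_mul
      (sub_nonneg.2 (inv_anti₀ (hη.pos _) (polyStep_succ_le (by linarith) (by omega))))
  have mS : MeanLe μ (fun ω => ∑ t ∈ Finset.range (n + 1), ‖Δ t ω‖ ^ 2)
      (∑ t ∈ Finset.range (n + 1), ∫ ω, ‖Δ t ω‖ ^ 2 ∂μ) :=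
    MeanLe.sum fun t _ => ⟨hP.integrable_norm_sq t, le_rfl⟩
  -- The means are assembled in the same order as the summands of `norm_sum_le`.
  have hmain := ((mZ.add (((((meanLe_const ((polyStep α 1)⁻¹ * ‖δ‖)).add
    ((mΔ (n + 1)).const_mul (inv_pos.2 (hη.pos (n + 1))).le)).add mI).add mD).add
      (mS.const_mul (by have := sub_nonneg.2 hκ1.le; positivity :
        0 ≤ (1 - κ) * (2 * (1 / lam)))) |>.const_mul (by positivity : 0 ≤ 1 / κ))).add
    ((mΔ (n + 1)).add (meanLe_const ‖δ‖))).integral_le (hP.integrable_sum (n + 1))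
    fun ω => hP.norm_sum_le hη.pos (fun t ht => polyStep_succ_le (by linarith) ht) n ω
  refine hmain.trans ?_
  clear hmain mZ mD mΔ mI mS hJ hv
  rw [polyStep_one, inv_one, one_mul, inv_polyStep α (by omega : 1 ≤ n + 1)]
  have hδ := hP.norm_init_le
  have hlog : 0 ≤ Real.log (n + 1 : ℕ) := Real.log_natCast_nonneg _
  have hTα : 1 ≤ ((n + 1 : ℕ) : ℝ) ^ α :=
    Real.one_le_rpow (by simp) (by linarith)
  have f1 : ((n + 1 : ℕ) : ℝ) ^ α * polyStep (α / 2) (n + 1) = ((n + 1 : ℕ) : ℝ) ^ (α / 2) := by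
    rw [polyStep_of_pos _ (by omega), ← Real.rpow_add (by positivity)]; congr 1; ring
  have f2 : ((n + 1 : ℕ) : ℝ) ^ α * polyStep α (n + 1) = 1 := by
    rw [polyStep_of_pos _ (by omega), ← Real.rpow_add (by positivity)]; simp
  have hx1 : 0 ≤ ((n + 1 : ℕ) : ℝ) ^ (1 - α) := by positivity
  have hx2 : 0 ≤ ((n + 1 : ℕ) : ℝ) ^ (α / 2) := by positivity
  have hc1 : 1 ≤ 1 / (1 - α) := by rw [le_div_iff₀ (by linarith)]; linarith
  exact poly_error_arith hκ hκ1 hL hh (by positivity) hτ hlog hx1 hx2 (by positivity)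
    (norm_nonneg δ) hδ hS0 (integral_nonneg fun ω => norm_nonneg _) hTα f1 f2
    (earlyWeight_nonneg _ _) heT hsumsq hincr haT

end IsPerturbedIter

end PolynomialAverage

/-! ### Moments and average for linearly rescaled step sizes. -/

section LinearSteps

/-- The linearly rescaled step sizes with rate `κ`. -/
structure IsLinearStep (κ : ℝ) (η : ℕ → ℝ) : Prop where
  rate_pos : 0 < κ
  rate_le_one : κ ≤ 1
  eq : ∀ t : ℕ, η t = 1 / (1 + κ * t)

namespace IsLinearStep

variable {κ : ℝ} {η : ℕ → ℝ} (hη : IsLinearStep κ η)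
include hη

theorem denom_pos (t : ℕ) : 0 < 1 + κ * t := by
  have := hη.rate_pos
  positivity

theorem pos (t : ℕ) : 0 < η t := by
  rw [hη.eq]; exact one_div_pos.2 (hη.denom_pos t)

theorem le_one (t : ℕ) : η t ≤ 1 := by
  have := hη.rate_pos
  rw [hη.eq, div_le_one (hη.denom_pos t)]
  have : 0 ≤ κ * t := by positivity
  linarith

theorem zero : η 0 = 1 := by rw [hη.eq]; simp

/-- This identity characterizes the rescaled steps: η is the homogeneous solution of every recursion
with contraction 1 - κη. -/
theorem one_sub_mul (t : ℕ) : (1 - κ * η (t + 1)) * η t = η (t + 1) := by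
  have h1 := (hη.denom_pos t).ne'
  have h2 := (hη.denom_pos (t + 1)).ne'
  rw [hη.eq, hη.eq]
  push_cast at h2 ⊢
  field_simp
  ring

theorem isStepSeq : IsStepSeq η where
  pos := hη.pos
  le_one := hη.le_one
  mul_le t _ := by
    have := mul_le_mul_of_nonneg_right hη.rate_le_one (hη.pos (t + 1)).le
    exact (mul_le_mul_of_nonneg_right (by linarith) (hη.pos t).le).trans (hη.one_sub_mul t).le

theorem succ_le (t : ℕ) : η (t + 1) ≤ 1 / κ * (1 / ((t : ℝ) + 1)) := by
  have := hη.rate_pos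
  rw [hη.eq, one_div_mul_one_div]
  apply one_div_le_one_div_of_le (by positivity)
  push_cast
  linarith

theorem sum_succ_le (T : ℕ) :
    ∑ t ∈ Finset.range T, η (t + 1) ≤ 1 / κ * (1 + Real.log T) := by
  have := hη.rate_pos
  refine (Finset.sum_le_sum fun t _ => hη.succ_le t).trans ?_
  rw [← Finset.mul_sum]
  exact mul_le_mul_of_nonneg_left (sum_inv_le T) (by positivity)

theorem sum_le {t T : ℕ} (ht : t ≤ T) :
    ∑ j ∈ Finset.range t, η j ≤ 2 / κ * (1 + Real.log T) := by
  have hκ := hη.rate_pos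
  calc ∑ j ∈ Finset.range t, η j ≤ ∑ j ∈ Finset.range (T + 1), η j :=
        Finset.sum_le_sum_of_subset_of_nonneg (Finset.range_mono (by omega))
          fun j _ _ => (hη.pos j).le
    _ = ∑ j ∈ Finset.range T, η (j + 1) + 1 := by rw [Finset.sum_range_succ', hη.zero]
    _ ≤ 1 / κ * (1 + Real.log T) + 1 := by gcongr; exact hη.sum_succ_le T
    _ ≤ 2 / κ * (1 + Real.log T) := by
        have h1 : 1 ≤ 1 / κ := by rw [le_div_iff₀ hκ]; linarith [hη.rate_le_one]
        have h2 := Real.log_natCast_nonneg T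
        have h3 : 2 / κ * (1 + Real.log T)
          = 1 / κ * (1 + Real.log T) + 1 / κ * (1 + Real.log T) := by ring
        rw [h3]
        nlinarith

/-- Variation of constants: y/η grows by at most g at each step. -/
theorem recursion_le {y g : ℕ → ℝ}
    (hy : ∀ t, y (t + 1) ≤ (1 - κ * η (t + 1)) * y t + η (t + 1) * g t) (t : ℕ) :
    y t ≤ η t * (y 0 + ∑ j ∈ Finset.range t, g j) := by
  induction t with
  | zero => simp [hη.zero]
  | succ t ih =>
    have h1 : 0 ≤ 1 - κ * η (t + 1) :=
      sub_nonneg.2 (mul_le_one₀ hη.rate_le_one (hη.pos _).le (hη.le_one _))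
    calc y (t + 1) ≤ (1 - κ * η (t + 1)) * y t + η (t + 1) * g t := hy t
      _ ≤ (1 - κ * η (t + 1)) * (η t * (y 0 + ∑ j ∈ Finset.range t, g j))
          + η (t + 1) * g t := by gcongr
      _ = ((1 - κ * η (t + 1)) * η t) * (y 0 + ∑ j ∈ Finset.range t, g j)
          + η (t + 1) * g t := by ring
      _ = _ := by rw [hη.one_sub_mul, Finset.sum_range_succ]; ring

end IsLinearStep

open Classical in
/-- The transition matrices of the linearized recursion. -/
noncomputable def linearizedMat {ι : Type*} (κ : ℝ) (K : Matrix ι ι ℝ) (η : ℕ → ℝ) (t : ℕ) :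
    Matrix ι ι ℝ :=
  (1 - η (t + 1)) • 1 + (η (t + 1) * (1 - κ)) • K

namespace IsPerturbedIter

variable {ι : Type*} [Fintype ι] {Ω : Type*} {mΩ : MeasurableSpace Ω}
  {μ : Measure Ω} {ℱ : Filtration ℕ mΩ} {κ h lam : ℝ}
  {K : Matrix ι ι ℝ} {η : ℕ → ℝ} {δ : ι → ℝ} {Δ ζ Z D : ℕ → Ω → ι → ℝ}

theorem linearizedMat_mulVec (t : ℕ) (x : ι → ℝ) :
    (linearizedMat κ K η t).mulVec x
      = (1 - η (t + 1)) • x + (η (t + 1) * (1 - κ)) • K.mulVec x := by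
  classical
  rw [linearizedMat, Matrix.add_mulVec, Matrix.smul_mulVec, Matrix.smul_mulVec]
  congr 2
  convert Matrix.one_mulVec x

theorem isStepFilter_linearizedMat (hP : IsPerturbedIter μ ℱ κ h lam K η δ Δ ζ Z D)
    (hη : IsLinearStep κ η) :
    IsStepFilter (linearizedMat κ K η) (fun t => 1 - κ * η (t + 1)) η where
  mat_nonneg t i k := by
    classical
    rw [linearizedMat, Matrix.add_apply, Matrix.smul_apply, Matrix.smul_apply, Matrix.one_apply]
    have h1 := hη.le_one (t + 1)
    have h2 := mul_nonneg (mul_nonneg (hη.pos (t + 1)).le (sub_nonneg.2 hη.rate_le_one))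
      (hP.mat_nonneg i k)
    simp only [smul_eq_mul]
    refine add_nonneg (mul_nonneg (sub_nonneg.2 h1) ?_) h2
    split_ifs <;> simp
  mat_sum t i := by
    classical
    simp only [linearizedMat, Matrix.add_apply, Matrix.smul_apply, Matrix.one_apply, smul_eq_mul,
      Finset.sum_add_distrib, ← Finset.mul_sum, hP.mat_sum]
    simp
    ring
  fac_nonneg t := sub_nonneg.2 (mul_le_one₀ hη.rate_le_one (hη.pos _).le (hη.le_one _))
  step_pos := hη.pos
  step_le := hη.le_one
  fac_mul_le t _ := (hη.one_sub_mul t).le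

variable [IsProbabilityMeasure μ] [Nonempty ι]

/-- The residual is η_t times a sum of noise moments of order η_j. That sum produces the factor 1 +
log T, stated with T so that the bound is uniform over t ≤ T. -/
theorem linear_integral_norm_sq_le (hP : IsPerturbedIter μ ℱ κ h lam K η δ Δ ζ Z D)
    (hη : IsLinearStep κ η) (hcard : 2 ≤ Fintype.card ι) {t T : ℕ} (ht : t ≤ T) :
    ∫ ω, ‖Δ t ω‖ ^ 2 ∂μ ≤ 600 * (logCard ι * h / κ ^ 2) ^ 2 * (1 + Real.log T) * η t := by
  have hκ := hP.rate_pos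
  have hκ1 := hP.rate_lt_one
  have hL := one_le_logCard hcard
  have hh := hP.one_le_scale
  have hl := Real.log_natCast_nonneg T
  have hrec := hη.recursion_le (y := fun t => ∫ ω, ‖Δ t ω - noise η Z D t ω‖ ^ 2 ∂μ)
    (g := fun t => κ * ((∫ ω, ‖noise η Z D t ω‖ ^ 2 ∂μ) / κ ^ 2))
    (fun t => (hP.integral_resid_sq_succ_le hη.isStepSeq t).trans (le_of_eq (by ring))) t
  simp only [hP.resid_zero, integral_const, probReal_univ, one_smul] at hrec
  have hN := hP.integral_noise_sq_le hη.isStepSeq hcard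
  have hs := hP.integral_norm_sq_le_resid hη.isStepSeq t
  have hδ := hP.norm_init_le
  set L := logCard ι with hLdef
  set l := Real.log T
  have hG : 90 * (L * (h / κ)) ^ 2 = 90 * (L * h / κ ^ 2) ^ 2 * κ ^ 2 := by field_simp
  rw [hG] at hN
  set G := L * h / κ ^ 2 with hGdef
  have hδG : ‖δ‖ ≤ G := by
    refine hδ.trans ?_
    rw [hGdef, div_le_div_iff₀ hκ (by positivity)]
    have : h * κ ≤ h * L := by gcongr; linarith
    nlinarith
  have hδ2 : ‖δ‖ ^ 2 ≤ G ^ 2 := pow_le_pow_left₀ (norm_nonneg δ) hδG 2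
  have hsum : ∑ j ∈ Finset.range t, κ * ((∫ ω, ‖noise η Z D j ω‖ ^ 2 ∂μ) / κ ^ 2)
      ≤ 180 * G ^ 2 * (1 + l) := by
    calc ∑ j ∈ Finset.range t, κ * ((∫ ω, ‖noise η Z D j ω‖ ^ 2 ∂μ) / κ ^ 2)
        ≤ ∑ j ∈ Finset.range t, κ * (90 * G ^ 2) * η j := by
          refine Finset.sum_le_sum fun j _ => ?_
          rw [mul_assoc]
          refine mul_le_mul_of_nonneg_left ?_ hκ.le
          rw [div_le_iff₀ (by positivity)]
          exact (hN j).trans (le_of_eq (by ring))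
      _ = κ * (90 * G ^ 2) * ∑ j ∈ Finset.range t, η j := by rw [Finset.mul_sum]
      _ ≤ κ * (90 * G ^ 2) * (2 / κ * (1 + l)) := by gcongr; exact hη.sum_le ht
      _ = 180 * G ^ 2 * (1 + l) := by field_simp; ring
  have hp := (hη.pos t).le
  have hNt := hN t
  have hκ2 : κ ^ 2 ≤ 1 := by nlinarith
  have hGl : G ^ 2 * 1 ≤ G ^ 2 * (1 + l) := by gcongr; linarith
  have h1 : η t * (‖δ‖ ^ 2 + ∑ j ∈ Finset.range t, κ * ((∫ ω, ‖noise η Z D j ω‖ ^ 2 ∂μ) / κ ^ 2))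
      ≤ η t * (181 * (G ^ 2 * (1 + l))) := by
    gcongr
    linarith
  have h2 : 90 * G ^ 2 * κ ^ 2 * η t ≤ 90 * (G ^ 2 * (1 + l)) * 1 * η t := by
    gcongr
    linarith
  have h3 : 0 ≤ η t * (G ^ 2 * (1 + l)) := by positivity
  linarith

theorem linear_sum_sq_le (hP : IsPerturbedIter μ ℱ κ h lam K η δ Δ ζ Z D)
    (hη : IsLinearStep κ η) (hcard : 2 ≤ Fintype.card ι) {t T : ℕ} (ht : t ≤ T) :
    ∑ j ∈ Finset.range t, ∫ ω, ‖Δ j ω‖ ^ 2 ∂μ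
      ≤ 1200 * (logCard ι ^ 2 * h ^ 2 / κ ^ 5) * (1 + Real.log T) ^ 2 := by
  have hκ := hP.rate_pos
  have hl := Real.log_natCast_nonneg T
  calc ∑ j ∈ Finset.range t, ∫ ω, ‖Δ j ω‖ ^ 2 ∂μ
      ≤ ∑ j ∈ Finset.range t,
        600 * (logCard ι * h / κ ^ 2) ^ 2 * (1 + Real.log T) * η j :=
        Finset.sum_le_sum fun j hj => hP.linear_integral_norm_sq_le hη hcard
          ((Finset.mem_range.1 hj).le.trans ht)
    _ = 600 * (logCard ι * h / κ ^ 2) ^ 2 * (1 + Real.log T) * ∑ j ∈ Finset.range t, η j := by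
        rw [Finset.mul_sum]
    _ ≤ 600 * (logCard ι * h / κ ^ 2) ^ 2 * (1 + Real.log T)
        * (2 / κ * (1 + Real.log T)) := by gcongr; exact hη.sum_le ht
    _ = _ := by field_simp; ring

/-- The error of the linearized recursion. -/
theorem norm_linear_resid_succ_le (hP : IsPerturbedIter μ ℱ κ h lam K η δ Δ ζ Z D)
    (hη : IsLinearStep κ η) (t : ℕ) (ω : Ω) :
    ‖Δ (t + 1) ω - linFilter (linearizedMat κ K η) η (fun j => Z j ω + D j ω) (t + 1)‖
      ≤ (1 - κ * η (t + 1))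
          * ‖Δ t ω - linFilter (linearizedMat κ K η) η (fun j => Z j ω + D j ω) t‖
        + η (t + 1) * (2 / lam * ‖Δ t ω‖ ^ 2) := by
  have hF := hP.isStepFilter_linearizedMat hη
  have e : Δ (t + 1) ω - linFilter (linearizedMat κ K η) η (fun j => Z j ω + D j ω) (t + 1)
      = (linearizedMat κ K η t).mulVec
          (Δ t ω - linFilter (linearizedMat κ K η) η (fun j => Z j ω + D j ω) t)
        + (η (t + 1) * (1 - κ)) • ζ t ω := by
    rw [Matrix.mulVec_sub, linFilter, linearizedMat_mulVec t (Δ t ω), hP.step]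
    module
  rw [e]
  refine (norm_add_le _ _).trans (add_le_add
    (norm_mulVec_le (hF.mat_nonneg t) (fun i => (hF.mat_sum t i).le) (hF.fac_nonneg t) _) ?_)
  have h1 := (hη.pos (t + 1)).le
  have h2 := sub_nonneg.2 hη.rate_le_one
  have hlam := hP.lam_pos
  rw [norm_smul, Real.norm_of_nonneg (mul_nonneg h1 h2), mul_assoc]
  refine mul_le_mul_of_nonneg_left ?_ h1
  calc (1 - κ) * ‖ζ t ω‖ ≤ 1 * (2 * ‖Δ t ω‖ ^ 2 / lam) := by
        refine mul_le_mul (by linarith [hη.rate_pos]) (hP.quad t ω) (norm_nonneg _) zero_le_one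
    _ = _ := by ring

/-- The filter contains the full linear part, so all its weights are at most η_t: t inputs of
variance v contribute √(L v t) η_t. As η_t is at most 1/(κt), this is √(L v/t)/κ, with no further
loss of 1/κ from a residual comparison. The residual of the linearized recursion sees only ζ and is
second order. -/
theorem linear_integral_norm_le (hP : IsPerturbedIter μ ℱ κ h lam K η δ Δ ζ Z D)
    (hη : IsLinearStep κ η) (hcard : 2 ≤ Fintype.card ι) {v : ℝ} (hv0 : 0 ≤ v)
    (hv : ∀ t, WeightedVarLe μ ℱ Z t v) {t T : ℕ} (ht : t ≤ T) :
    ∫ ω, ‖Δ t ω‖ ∂μ ≤ 2 * Real.sqrt (logCard ι * v) * (Real.sqrt t * η t)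
      + 2400 * (logCard ι ^ 2 * h ^ 2 / κ ^ 5) * (1 + 1 / lam) * (1 + Real.log T) ^ 2 * η t := by
  have hF := hP.isStepFilter_linearizedMat hη
  have hκ := hP.rate_pos
  have hκ1 := hP.rate_lt_one
  have hlam := hP.lam_pos
  have hL := one_le_logCard hcard
  have hh := hP.one_le_scale
  have hl := Real.log_natCast_nonneg T
  have hδ := hP.norm_init_le
  have hp := (hη.pos t).le
  have hsum := hP.linear_sum_sq_le hη hcard ht
  have hB : 0 ≤ 3 * h / κ := by positivity
  have hs0 : ∀ j, 0 ≤ ∫ ω, ‖Δ j ω‖ ^ 2 ∂μ := fun j => integral_nonneg fun ω => by positivity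
  have hw2 : ∀ j, filterWeight (fun t => 1 - κ * η (t + 1)) η j t ^ 2 ≤ η t ^ 2 := fun j =>
    pow_le_pow_left₀ (hF.weight_nonneg j t) (hF.weight_le j t) 2
  have mR : ∀ t, Integrable (fun ω =>
      ‖Δ t ω - linFilter (linearizedMat κ K η) η (fun j => Z j ω + D j ω) t‖) μ := fun t => by
    refine ((hP.integrable_norm t).add (hF.integrable_norm hP.mdsNoise hB t)).mono'
      ((hP.measurable t).sub (hF.measurable hP.mdsNoise hB t)).norm.aestronglyMeasurable
      (Filter.Eventually.of_forall fun ω => ?_)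
    rw [norm_norm]
    exact norm_sub_le _ _
  have hR := hη.recursion_le (y := fun t => ∫ ω,
      ‖Δ t ω - linFilter (linearizedMat κ K η) η (fun j => Z j ω + D j ω) t‖ ∂μ)
    (g := fun t => 2 / lam * ∫ ω, ‖Δ t ω‖ ^ 2 ∂μ) (fun t => by
      rw [← integral_const_mul, ← integral_const_mul, ← integral_const_mul]
      exact integral_le_add (mR _) ((mR t).const_mul _)
        (((hP.integrable_norm_sq t).const_mul _).const_mul _)
        (hP.norm_linear_resid_succ_le hη t)) t
  simp only [hP.init, linFilter, sub_zero, integral_const, probReal_univ, one_smul] at hR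
  have hNZ := hF.integral_norm_le hP.mdsZ (by positivity) (x := fun _ => v) (t := t)
    (fun j _ => hv j) (V := t * (η t ^ 2 * v)) (by positivity) (by
      calc ∑ j ∈ Finset.range t, filterWeight (fun t => 1 - κ * η (t + 1)) η j t ^ 2 * v
          ≤ ∑ j ∈ Finset.range t, η t ^ 2 * v :=
            Finset.sum_le_sum fun j _ => mul_le_mul_of_nonneg_right (hw2 j) hv0
        _ = _ := by simp)
  have hND := hF.integral_norm_le hP.mdsD (by positivity)
    (x := fun j => 4 * ∫ ω, ‖Δ j ω‖ ^ 2 ∂μ) (t := t)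
    (fun j _ => hP.weightedVarLe_D j)
    (V := η t ^ 2 * (4 * ∑ j ∈ Finset.range t, ∫ ω, ‖Δ j ω‖ ^ 2 ∂μ))
    (mul_nonneg (sq_nonneg _) (mul_nonneg (by norm_num) (Finset.sum_nonneg fun j _ => hs0 j))) (by
      rw [Finset.mul_sum, Finset.mul_sum]
      exact Finset.sum_le_sum fun j _ =>
        mul_le_mul_of_nonneg_right (hw2 j) (mul_nonneg (by norm_num) (hs0 j)))
  have hsplit : ∫ ω, ‖Δ t ω‖ ∂μ
      ≤ ∫ ω, ‖Δ t ω - linFilter (linearizedMat κ K η) η (fun j => Z j ω + D j ω) t‖ ∂μ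
        + ∫ ω, ‖linFilter (linearizedMat κ K η) η (fun j => Z j ω) t‖ ∂μ
        + ∫ ω, ‖linFilter (linearizedMat κ K η) η (fun j => D j ω) t‖ ∂μ := by
    refine integral_le_add_add (hP.integrable_norm t) (mR t)
      (hF.integrable_norm hP.mdsZ (by positivity) t)
      (hF.integrable_norm hP.mdsD (by positivity) t) fun ω => ?_
    have e := linFilter_add (A := linearizedMat κ K η) (η := η) (fun j => Z j ω) (fun j => D j ω) t
    have h1 := norm_add_le
      (Δ t ω - linFilter (linearizedMat κ K η) η (fun j => Z j ω + D j ω) t)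
      (linFilter (linearizedMat κ K η) η (fun j => Z j ω + D j ω) t)
    rw [sub_add_cancel] at h1
    have h2 := norm_add_le (linFilter (linearizedMat κ K η) η (fun j => Z j ω) t)
      (linFilter (linearizedMat κ K η) η (fun j => D j ω) t)
    rw [← e] at h2
    linarith
  refine hsplit.trans ?_
  clear hsplit mR hw2
  rw [← Finset.mul_sum] at hR
  set S := ∑ j ∈ Finset.range t, ∫ ω, ‖Δ j ω‖ ^ 2 ∂μ
  set L := logCard ι with hLdef
  set l := 1 + Real.log T with hldef
  set W := L ^ 2 * h ^ 2 / κ ^ 5 with hW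
  have hl1 : 1 ≤ l := by linarith
  have hl2 : 1 ≤ l ^ 2 := one_le_pow₀ hl1
  have hW0 : 0 ≤ W := by positivity
  have hL2 : L * 1 ≤ L * L := by gcongr
  have hh2 : h * 1 ≤ h * h := by gcongr
  have hLLh : L * h ≤ L ^ 2 * h ^ 2 := by
    calc L * h = (L * 1) * (h * 1) := by ring
      _ ≤ (L * L) * (h * h) := by gcongr
      _ = _ := by ring
  have hLle : L * 1 ≤ L * h := by gcongr
  have hhle : 1 * h ≤ L * h := by gcongr
  have pw : ∀ (m : ℕ) (a : ℝ), m ≤ 5 → 0 ≤ a → a ≤ L ^ 2 * h ^ 2 → a / κ ^ m ≤ W :=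
    fun m a hm ha0 ha => by
      rw [hW]
      have : κ ^ 5 ≤ κ ^ m := pow_le_pow_of_le_one hκ.le hκ1.le hm
      gcongr
  have hWl : W ≤ W * l ^ 2 := le_mul_of_one_le_right hW0 hl2
  have u1 : ‖δ‖ ≤ W * l ^ 2 := by
    have := pw 1 h (by norm_num) (by linarith) (by linarith)
    rw [pow_one] at this
    linarith
  have u2 : L * (η t * (1 / κ)) ≤ W * l ^ 2 * η t := by
    have e1 := pw 1 L (by norm_num) (by linarith) (by linarith)
    rw [pow_one] at e1
    calc L * (η t * (1 / κ)) = L / κ * η t := by ring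
      _ ≤ _ := by gcongr; linarith
  have u3 : L * (η t * (2 * h / κ)) ≤ 2 * (W * l ^ 2) * η t := by
    have e1 := pw 1 (L * h) (by norm_num) (by positivity) (by linarith)
    rw [pow_one] at e1
    calc L * (η t * (2 * h / κ)) = 2 * (L * h / κ) * η t := by ring
      _ ≤ _ := by gcongr; linarith
  -- 70² = 4900 exceeds 4 · 1200, with one factor L absorbed by W.
  have u4 : Real.sqrt (L * (η t ^ 2 * (4 * S))) ≤ 70 * (W * l ^ 2) * η t := by
    apply Real.sqrt_le_iff.2 ⟨by positivity, ?_⟩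
    have e0 : L ≤ W := by
      have := pw 0 L (by norm_num) (by linarith) (by linarith)
      simpa using this
    calc L * (η t ^ 2 * (4 * S)) ≤ W * l ^ 2 * (η t ^ 2 * (4 * (1200 * W * l ^ 2))) := by
          gcongr
          linarith
      _ ≤ _ := by
          have : 0 ≤ (W * l ^ 2 * η t) ^ 2 := by positivity
          nlinarith
  have u5 : Real.sqrt (L * (t * (η t ^ 2 * v))) = Real.sqrt (L * v) * (Real.sqrt t * η t) := by
    rw [show L * (t * (η t ^ 2 * v)) = (L * v) * (t * η t ^ 2) by ring,
      Real.sqrt_mul (by positivity), Real.sqrt_mul (Nat.cast_nonneg t), Real.sqrt_sq hp]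
  have u6 : η t * (‖δ‖ + 2 / lam * S) ≤ W * l ^ 2 * η t + 2400 * (1 / lam) * (W * l ^ 2 * η t) := by
    calc η t * (‖δ‖ + 2 / lam * S) ≤ η t * (W * l ^ 2 + 2 / lam * (1200 * W * l ^ 2)) := by gcongr
      _ = _ := by ring
  rw [u5] at hNZ
  have u7 : 2400 * W * (1 + 1 / lam) * l ^ 2 * η t
      = 2400 * (W * l ^ 2 * η t) + 2400 * (1 / lam) * (W * l ^ 2 * η t) := by ring
  have u8 : 0 ≤ W * l ^ 2 * η t := by positivity
  rw [u7]
  linarith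

/-- Bound for the averaged iterates with linearly rescaled step sizes. -/
theorem linear_average_le (hP : IsPerturbedIter μ ℱ κ h lam K η δ Δ ζ Z D)
    (hη : IsLinearStep κ η) (hcard : 2 ≤ Fintype.card ι) {v : ℝ} (hv0 : 0 ≤ v)
    (hv : ∀ t, WeightedVarLe μ ℱ Z t v) (T : ℕ) :
    ∫ ω, ‖∑ t ∈ Finset.range T, Δ (t + 1) ω‖ ∂μ
      ≤ 4 / κ * Real.sqrt (logCard ι * v) * Real.sqrt T
        + 2400 * (logCard ι ^ 2 * h ^ 2 / κ ^ 6) * (1 + 1 / lam) * (1 + Real.log T) ^ 3 := by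
  have hκ := hP.rate_pos
  have hlam := hP.lam_pos
  have hl := Real.log_natCast_nonneg T
  -- The triangle inequality over time keeps the right order, because √t η_t ≤ t^{-1/2}/κ sums to at
  -- most 2√T/κ.
  have h1 := (MeanLe.sum (s := Finset.range T) (f := fun t ω => ‖Δ (t + 1) ω‖)
    fun t ht => ⟨hP.integrable_norm (t + 1), hP.linear_integral_norm_le hη hcard hv0 hv
      (Nat.succ_le_of_lt (Finset.mem_range.1 ht))⟩).integral_le (hP.integrable_sum T)
      fun ω => _root_.norm_sum_le _ _
  refine h1.trans ?_
  rw [Finset.sum_add_distrib, ← Finset.mul_sum, ← Finset.mul_sum]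
  have h2 : ∑ t ∈ Finset.range T, Real.sqrt (t + 1 : ℕ) * η (t + 1)
      ≤ 1 / κ * (2 * Real.sqrt T) := by
    refine le_trans ?_ (mul_le_mul_of_nonneg_left (sum_inv_sqrt_le T) (by positivity))
    rw [Finset.mul_sum]
    refine Finset.sum_le_sum fun t _ => ?_
    push_cast
    have hx : (0 : ℝ) < (t : ℝ) + 1 := by positivity
    calc Real.sqrt ((t : ℝ) + 1) * η (t + 1)
        ≤ Real.sqrt ((t : ℝ) + 1) * (1 / κ * (1 / ((t : ℝ) + 1))) := by
          gcongr; exact hη.succ_le t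
      _ = 1 / κ * (Real.sqrt ((t : ℝ) + 1) / ((t : ℝ) + 1)) := by ring
      _ = _ := by rw [Real.sqrt_div_self, one_div (Real.sqrt _)]
  have h3 := hη.sum_succ_le T
  have h4 := mul_le_mul_of_nonneg_left h2
    (by positivity : 0 ≤ 2 * Real.sqrt (logCard ι * v))
  have h5 := mul_le_mul_of_nonneg_left h3 (by positivity :
    0 ≤ 2400 * (logCard ι ^ 2 * h ^ 2 / κ ^ 5) * (1 + 1 / lam) * (1 + Real.log T) ^ 2)
  refine (add_le_add h4 h5).trans (le_of_eq ?_)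
  congr 1
  · ring
  · field_simp

end IsPerturbedIter

end LinearSteps

/-! ### The filtration of the observations and independence of the next batch. -/

section History

variable {Ω Ob : Type*} [MeasurableSpace Ob]

/-- The information carried by the observations up to time `t`. -/
def historyFiltration {mΩ : MeasurableSpace Ω} (o : ℕ → Ω → Ob) (ho : ∀ t, Measurable (o t)) :
    Filtration ℕ mΩ where
  seq t := ⨆ s ∈ Set.Iic t, MeasurableSpace.comap (o s) inferInstance
  mono' _ _ hst := biSup_mono fun _ hx => le_trans hx hst
  le' _ := iSup₂_le fun s _ => (ho s).comap_le

variable {mΩ : MeasurableSpace Ω} {μ : Measure Ω} {o : ℕ → Ω → Ob}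

theorem measurable_observation (ho : ∀ t, Measurable (o t)) (t : ℕ) :
    Measurable[historyFiltration o ho t] (o t) := by
  have h : MeasurableSpace.comap (o t) inferInstance
      ≤ ⨆ s ∈ Set.Iic t, MeasurableSpace.comap (o s) inferInstance :=
    le_biSup (fun s => MeasurableSpace.comap (o s) inferInstance) (Set.mem_Iic.2 le_rfl)
  exact (comap_measurable (o t)).mono h le_rfl

/-- The σ-algebras of the batches up to t and of batch t + 1 are independent, so the expectation
factorizes. This replaces conditional expectations everywhere. -/
theorem integral_mul_observation (ho : ∀ t, Measurable (o t)) (hi : iIndepFun o μ) {ν : Measure Ob}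
    (hν : ∀ t, μ.map (o t) = ν) (t : ℕ) {g : Ω → ℝ}
    (hg : Measurable[historyFiltration o ho t] g) {f : Ob → ℝ} (hf : Measurable f) :
    ∫ ω, g ω * f (o (t + 1) ω) ∂μ = (∫ ω, g ω ∂μ) * ∫ ob, f ob ∂ν := by
  have hind : IndepFun g (fun ω => f (o (t + 1) ω)) μ := by
    rw [IndepFun_iff_Indep]
    have h := indep_iSup_of_disjoint (fun s => (ho s).comap_le)
      ((iIndepFun_iff_iIndep _ _ _).1 hi) (S := Set.Iic t) (T := {t + 1})
      (Set.disjoint_singleton_right.2 (by simp))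
    rw [iSup_singleton] at h
    refine indep_of_indep_of_le_left (indep_of_indep_of_le_right h ?_) hg.comap_le
    exact (hf.comp (comap_measurable (o (t + 1)))).comap_le
  rw [hind.integral_fun_mul_eq_mul_integral
    ((hg.mono ((historyFiltration o ho).le t) le_rfl).aestronglyMeasurable)
    (hf.comp (ho (t + 1))).aestronglyMeasurable]
  rw [← hν (t + 1), integral_map (ho (t + 1)).aemeasurable hf.aestronglyMeasurable]

/-- The weights depend on the past and f on the next batch, so each product factorizes; the worst
coordinate variance then comes out with the total weight. -/
theorem weightedVarLe_observation {ι : Type*} [Fintype ι] [IsProbabilityMeasure μ]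
    (ho : ∀ t, Measurable (o t)) (hi : iIndepFun o μ) {ν : Measure Ob}
    (hν : ∀ t, μ.map (o t) = ν) {f : Ob → ι → ℝ} (hf : Measurable f) {b v : ℝ} (hv0 : 0 ≤ v)
    (hb : ∀ ob, ‖f ob‖ ≤ b) (hv : ∀ i, ∫ ob, f ob i ^ 2 ∂ν ≤ v) (t : ℕ) :
    WeightedVarLe μ (historyFiltration o ho) (fun t ω => f (o (t + 1) ω)) t v := by
  intro q C hq h0 hC
  have hfm : ∀ i, Measurable fun ob => f ob i ^ 2 := fun i =>
    ((measurable_pi_apply i).comp hf).pow_const 2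
  have hqm : ∀ i, Measurable (q i) := fun i =>
    (hq i).mono ((historyFiltration o ho).le t) le_rfl
  have hqi : ∀ i, Integrable (q i) μ := fun i =>
    integrable_of_abs_le (hqm i) (abs_weight_le h0 hC i)
  have hint : ∀ i, Integrable (fun ω => q i ω * f (o (t + 1) ω) i ^ 2) μ := fun i =>
    integrable_of_abs_le (C := C * b ^ 2) ((hqm i).mul ((hfm i).comp (ho (t + 1)))) fun ω => by
      rw [abs_mul, abs_pow]
      exact mul_le_mul (abs_weight_le h0 hC i ω) (pow_le_pow_left₀ (abs_nonneg _)
        ((norm_le_pi_norm (f (o (t + 1) ω)) i).trans (hb _)) 2) (by positivity)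
        ((abs_nonneg _).trans (abs_weight_le h0 hC i ω))
  rw [integral_finsetSum _ fun i _ => hint i]
  calc ∑ i, ∫ ω, q i ω * f (o (t + 1) ω) i ^ 2 ∂μ
      = ∑ i, (∫ ω, q i ω ∂μ) * ∫ ob, f ob i ^ 2 ∂ν :=
        Finset.sum_congr rfl fun i _ => integral_mul_observation ho hi hν t (hq i) (hfm i)
    _ ≤ ∑ i, (∫ ω, q i ω ∂μ) * v := Finset.sum_le_sum fun i _ =>
        mul_le_mul_of_nonneg_left (hv i) (integral_nonneg fun ω => h0 i ω)
    _ = (∫ ω, ∑ i, q i ω ∂μ) * v := by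
        rw [← Finset.sum_mul, integral_finsetSum _ fun i _ => hqi i]
    _ ≤ C * v := by
        refine mul_le_mul_of_nonneg_right ?_ hv0
        have := integral_mono (integrable_finsetSum _ fun i _ => hqi i) (integrable_const C) hC
        simpa using this

end History

/-! ### Range, convexity and smoothness of the soft maximum. -/

section SoftMax

variable {S A : Type*} [Fintype S] [Fintype A] [Nonempty A] {lam : ℝ}

theorem measurable_softMax (hlam : 0 < lam) (s : S) :
    Measurable fun Q : S × A → ℝ => softMax lam Q s := by
  have h : (fun Q : S × A → ℝ => softMax lam Q s)
      = fun Q => lam * Real.log (∑ a, Real.exp (Q (s, a) / lam)) := by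
    funext Q; exact softMax_eq hlam Q s
  rw [h]
  refine (Real.measurable_log.comp (Finset.measurable_sum _ fun a _ => ?_)).const_mul lam
  have h' : Measurable fun Q : S × A → ℝ => Q (s, a) := measurable_pi_apply _
  exact Real.measurable_exp.comp (h'.div_const lam)

theorem abs_softMax_sub_le (hlam : 0 < lam) (Q Q' : S × A → ℝ) (s : S) :
    |softMax lam Q s - softMax lam Q' s| ≤ ‖Q - Q'‖ := by
  have h1 := softMax_le_add hlam Q Q' s
  have h2 := softMax_le_add hlam Q' Q s
  rw [norm_sub_rev] at h2
  exact abs_le.2 ⟨by linarith, by linarith⟩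

/-- The upper and lower bounds share the offset λ log|A|. The width of a range is therefore
preserved, and only its position depends on λ. -/
theorem softMax_le_of_le (hlam : 0 < lam) {Q : S × A → ℝ} {b : ℝ} (hQ : ∀ x, Q x ≤ b) (s : S) :
    softMax lam Q s ≤ lam * Real.log (Fintype.card A) + b := by
  rw [softMax_eq hlam]
  have h1 : ∑ a, Real.exp (Q (s, a) / lam) ≤ Fintype.card A * Real.exp (b / lam) := by
    refine (Finset.sum_le_card_nsmul _ _ (Real.exp (b / lam)) fun a _ => ?_).trans (by simp)
    exact Real.exp_le_exp.2 (div_le_div_of_nonneg_right (hQ _) hlam.le)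
  have h0 : 0 < ∑ a, Real.exp (Q (s, a) / lam) :=
    Finset.sum_pos (fun a _ => Real.exp_pos _) Finset.univ_nonempty
  have h2 := mul_le_mul_of_nonneg_left (Real.log_le_log h0 h1) hlam.le
  rw [Real.log_mul (by simp) (Real.exp_pos _).ne', Real.log_exp, mul_add,
    mul_div_cancel₀ b hlam.ne'] at h2
  exact h2

theorem le_softMax_of_le (hlam : 0 < lam) {Q : S × A → ℝ} {b : ℝ} (hQ : ∀ x, b ≤ Q x) (s : S) :
    lam * Real.log (Fintype.card A) + b ≤ softMax lam Q s := by
  rw [softMax_eq hlam]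
  have h1 : Fintype.card A * Real.exp (b / lam) ≤ ∑ a, Real.exp (Q (s, a) / lam) := by
    refine le_trans (by simp) (Finset.card_nsmul_le_sum _ _ (Real.exp (b / lam)) fun a _ => ?_)
    exact Real.exp_le_exp.2 (div_le_div_of_nonneg_right (hQ _) hlam.le)
  have h2 := mul_le_mul_of_nonneg_left (Real.log_le_log
    (mul_pos (by exact_mod_cast Fintype.card_pos) (Real.exp_pos _)) h1) hlam.le
  rw [Real.log_mul (by simp) (Real.exp_pos _).ne', Real.log_exp, mul_add,
    mul_div_cancel₀ b hlam.ne'] at h2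
  exact h2

theorem regValue_sub (Q Q' : S × A → ℝ) (π : Policy S A) (s : S) :
    regValue lam Q π s - regValue lam Q' π s = ∑ a, π.1 s a * (Q - Q') (s, a) := by
  simp only [regValue]
  rw [← Finset.sum_sub_distrib]
  exact Finset.sum_congr rfl fun a _ => by simp only [Pi.sub_apply]; ring

/-- The greedy policy for Q' is a feasible competitor in the maximum for Q. This is the supporting
hyperplane of a convex function, with gradient the greedy policy. -/
theorem sum_greedy_mul_le (hlam : 0 < lam) (Q Q' : S × A → ℝ) (s : S) :
    ∑ a, (softGreedy lam Q').1 s a * (Q - Q') (s, a) ≤ softMax lam Q s - softMax lam Q' s := by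
  rw [← regValue_sub, (softGreedy_spec hlam Q').1 s]
  have := le_ciSup (bddAbove_regValue hlam Q s) (softGreedy lam Q')
  simp only [softMax] at this ⊢
  linarith

/-- A logarithmic moment generating function is quadratically close to its mean. -/
theorem log_sum_mul_exp_le {p x : A → ℝ} (hp : ∀ a, 0 ≤ p a) (hp1 : ∑ a, p a = 1) {b : ℝ}
    (hx : ∀ a, |x a| ≤ b) :
    Real.log (∑ a, p a * Real.exp (x a)) ≤ ∑ a, p a * x a + 2 * b ^ 2 := by
  have hb0 : 0 ≤ b := (abs_nonneg _).trans (hx (Classical.arbitrary A))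
  have hpos : 0 < ∑ a, p a * Real.exp (x a) := by
    have h1 : ∑ a, p a * Real.exp (-b) ≤ ∑ a, p a * Real.exp (x a) :=
      Finset.sum_le_sum fun a _ => mul_le_mul_of_nonneg_left
        (Real.exp_le_exp.2 (abs_le.1 (hx a)).1) (hp a)
    rw [← Finset.sum_mul, hp1, one_mul] at h1
    exact (Real.exp_pos _).trans_le h1
  -- For b ≤ 1 use e^x ≤ 1 + x + x² and log u ≤ u - 1. For b ≥ 1 the logarithm is at most b and the
  -- mean at least -b, so 2b ≤ 2b² is enough.
  rcases le_total b 1 with hb | hb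
  · have h1 : ∑ a, p a * Real.exp (x a) ≤ ∑ a, p a * (1 + x a + b ^ 2) := by
      refine Finset.sum_le_sum fun a _ => mul_le_mul_of_nonneg_left ?_ (hp a)
      have h2 := (abs_le.1 (Real.abs_exp_sub_one_sub_id_le ((hx a).trans hb))).2
      have h3 : x a ^ 2 ≤ b ^ 2 := sq_le_sq' (abs_le.1 (hx a)).1 (abs_le.1 (hx a)).2
      linarith
    have h4 : ∑ a, p a * (1 + x a + b ^ 2) = 1 + ∑ a, p a * x a + b ^ 2 := by
      simp only [mul_add, Finset.sum_add_distrib, ← Finset.sum_mul, hp1, mul_one, one_mul]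
    have h5 := Real.log_le_sub_one_of_pos hpos
    nlinarith [sq_nonneg b]
  · have h1 : ∑ a, p a * Real.exp (x a) ≤ Real.exp b := by
      have : ∑ a, p a * Real.exp (x a) ≤ ∑ a, p a * Real.exp b :=
        Finset.sum_le_sum fun a _ => mul_le_mul_of_nonneg_left
          (Real.exp_le_exp.2 (abs_le.1 (hx a)).2) (hp a)
      rwa [← Finset.sum_mul, hp1, one_mul] at this
    have h2 : Real.log (∑ a, p a * Real.exp (x a)) ≤ b := by
      have := Real.log_le_log hpos h1
      rwa [Real.log_exp] at this
    have h3 : ∑ a, p a * (-b) ≤ ∑ a, p a * x a :=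
      Finset.sum_le_sum fun a _ => mul_le_mul_of_nonneg_left (abs_le.1 (hx a)).1 (hp a)
    rw [← Finset.sum_mul, hp1, one_mul] at h3
    nlinarith

/-- The soft maximum is quadratically close to its linearization. -/
theorem softMax_sub_sub_le (hlam : 0 < lam) (Q Q' : S × A → ℝ) (s : S) :
    softMax lam Q s - softMax lam Q' s
      ≤ ∑ a, (softGreedy lam Q').1 s a * (Q - Q') (s, a) + 2 * ‖Q - Q'‖ ^ 2 / lam := by
  have hp := (regValue_le hlam Q' (softGreedy lam Q') s).2
    (((softGreedy_spec hlam Q').1 s).trans (softMax_eq hlam Q' s))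
  set π := softGreedy lam Q'
  have h := log_sum_mul_exp_le (p := π.1 s) (x := fun a => (Q - Q') (s, a) / lam)
    (π.2 s).1 (π.2 s).2 (b := ‖Q - Q'‖ / lam) fun a => by
      rw [abs_div, abs_of_pos hlam]
      exact div_le_div_of_nonneg_right (norm_le_pi_norm (Q - Q') (s, a)) hlam.le
  have hZ' : 0 < ∑ a, Real.exp (Q' (s, a) / lam) :=
    Finset.sum_pos (fun a _ => Real.exp_pos _) Finset.univ_nonempty
  have hZ : 0 < ∑ a, Real.exp (Q (s, a) / lam) :=
    Finset.sum_pos (fun a _ => Real.exp_pos _) Finset.univ_nonempty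
  -- The greedy policy is the Gibbs measure of Q', so the ratio of the two partition functions is
  -- the moment generating function of (Q - Q')/λ under it.
  have e1 : ∑ a, π.1 s a * Real.exp ((Q - Q') (s, a) / lam)
      = (∑ a, Real.exp (Q (s, a) / lam)) / ∑ a, Real.exp (Q' (s, a) / lam) := by
    rw [Finset.sum_div]
    refine Finset.sum_congr rfl fun a _ => ?_
    rw [hp a, div_mul_eq_mul_div, ← Real.exp_add]
    congr 2
    simp only [Pi.sub_apply]
    ring
  rw [e1, Real.log_div hZ.ne' hZ'.ne'] at h
  rw [softMax_eq hlam, softMax_eq hlam, ← mul_sub]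
  refine (mul_le_mul_of_nonneg_left h hlam.le).trans (le_of_eq ?_)
  rw [mul_add, Finset.mul_sum]
  congr 1
  · exact Finset.sum_congr rfl fun a _ => by field_simp
  · field_simp

end SoftMax

/-! ### Truncated observations and elementary matrix facts. -/

/-- Truncation of a reward to `[0, 1]`. -/
noncomputable def clipReward {S : Type*} (p : ℝ × S) : ℝ × S := (max 0 (min 1 p.1), p.2)

/-- Truncation of all rewards in a batch of observations to `[0, 1]`. -/
noncomputable def clipObs {S ι : Type*} (ob : ι → ℝ × S) (x : ι) : ℝ × S := clipReward (ob x)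

theorem clipReward_mem {S : Type*} (p : ℝ × S) :
    0 ≤ (clipReward p).1 ∧ (clipReward p).1 ≤ 1 :=
  ⟨le_max_left _ _, max_le zero_le_one (min_le_left _ _)⟩

theorem clipReward_eq {S : Type*} {p : ℝ × S} (h : 0 ≤ p.1 ∧ p.1 ≤ 1) : clipReward p = p := by
  rw [clipReward, min_eq_right h.2, max_eq_right h.1]

theorem measurable_clipReward {S : Type*} [MeasurableSpace S] :
    Measurable (clipReward : ℝ × S → ℝ × S) :=
  (measurable_const.max (measurable_const.min measurable_fst)).prodMk measurable_snd

theorem measurable_clipObs {S ι : Type*} [MeasurableSpace S] :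
    Measurable (clipObs : (ι → ℝ × S) → ι → ℝ × S) :=
  measurable_pi_lambda _ fun x => measurable_clipReward.comp (measurable_pi_apply x)

theorem measurable_apply_of_finite {S Ω : Type*} [Fintype S] [MeasurableSpace S]
    [MeasurableSingletonClass S] {m : MeasurableSpace Ω} {W : Ω → S → ℝ}
    (hW : ∀ s, Measurable fun ω => W ω s) {σ : Ω → S} (hσ : Measurable σ) :
    Measurable fun ω => W ω (σ ω) := by
  classical
  have h : (fun ω => W ω (σ ω)) = fun ω => ∑ s, if σ ω = s then W ω s else 0 := by
    funext ω; simp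
  rw [h]
  exact Finset.measurable_sum _ fun s _ =>
    Measurable.ite (hσ (measurableSet_singleton s)) (hW s) measurable_const

theorem abs_apply_le_matInfNorm {ι : Type*} [Fintype ι] (B : Matrix ι ι ℝ) (i j : ι) :
    |B i j| ≤ matInfNorm B := by
  have h1 : |B i j| ≤ ∑ k, |B i k| :=
    Finset.single_le_sum (f := fun k => |B i k|) (fun _ _ => abs_nonneg _) (Finset.mem_univ j)
  exact h1.trans ((le_abs_self _).trans (norm_le_pi_norm (fun i => ∑ j, |B i j|) i))

theorem matInfNorm_nonneg {ι : Type*} [Fintype ι] (B : Matrix ι ι ℝ) : 0 ≤ matInfNorm B :=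
  norm_nonneg _

/-! ### Ranges of Q*, of the iterates and of the Bellman noise. -/

namespace DiscountedMDP

section Model

variable {S : Type u} {A : Type v} [Fintype S] [Fintype A] (M : DiscountedMDP S A)

theorem transMat_nonneg (x : S × A) (s : S) : 0 ≤ M.transMat x s := ENNReal.toReal_nonneg

theorem transMat_mulVec_const (b : ℝ) (x : S × A) : M.transMat.mulVec (fun _ => b) x = b := by
  simp [Matrix.mulVec, dotProduct, ← Finset.sum_mul, M.sum_transMat]

theorem transMat_mulVec_mono {V W : S → ℝ} (h : ∀ s, V s ≤ W s) (x : S × A) :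
    M.transMat.mulVec V x ≤ M.transMat.mulVec W x :=
  Finset.sum_le_sum fun s _ => mul_le_mul_of_nonneg_left (h s) (M.transMat_nonneg x s)

theorem le_transMat_mulVec {V : S → ℝ} {b : ℝ} (h : ∀ s, b ≤ V s) (x : S × A) :
    b ≤ M.transMat.mulVec V x := by
  rw [← M.transMat_mulVec_const b x]; exact M.transMat_mulVec_mono h x

theorem transMat_mulVec_le {V : S → ℝ} {b : ℝ} (h : ∀ s, V s ≤ b) (x : S × A) :
    M.transMat.mulVec V x ≤ b := by
  rw [← M.transMat_mulVec_const b x]; exact M.transMat_mulVec_mono h x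

theorem abs_transMat_mulVec_le {V : S → ℝ} {b : ℝ} (h : ∀ s, |V s| ≤ b) (x : S × A) :
    |M.transMat.mulVec V x| ≤ b :=
  abs_le.2 ⟨M.le_transMat_mulVec (fun s => (abs_le.1 (h s)).1) x,
    M.transMat_mulVec_le (fun s => (abs_le.1 (h s)).2) x⟩

theorem policyMat_apply [DecidableEq S] (π : Policy S A) (x y : S × A) :
    M.policyMat π x y = M.transMat x y.1 * π.1 y.1 y.2 := by
  simp [policyMat, Matrix.mul_apply, projMat]

theorem policyMat_nonneg [DecidableEq S] (π : Policy S A) (x y : S × A) :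
    0 ≤ M.policyMat π x y := by
  rw [policyMat_apply]
  exact mul_nonneg (M.transMat_nonneg x y.1) ((π.2 y.1).1 y.2)

theorem sum_policyMat [DecidableEq S] (π : Policy S A) (x : S × A) :
    ∑ y, M.policyMat π x y = 1 := by
  simp only [policyMat_apply, Fintype.sum_prod_type, ← Finset.mul_sum]
  rw [← M.sum_transMat x]
  exact Finset.sum_congr rfl fun s _ => by rw [(π.2 s).2, mul_one]

theorem policyMat_mulVec [DecidableEq S] (π : Policy S A) (d : S × A → ℝ) (x : S × A) :
    (M.policyMat π).mulVec d x = M.transMat.mulVec (fun s => ∑ a, π.1 s a * d (s, a)) x := by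
  simp only [Matrix.mulVec, dotProduct, policyMat_apply, Fintype.sum_prod_type, Finset.mul_sum,
    mul_assoc]

theorem integrable_reward (hR : ∀ x, ∀ᵐ y ∂(M.R x), 0 ≤ y ∧ y ≤ 1) (x : S × A) :
    Integrable (fun y => y) (M.R x) :=
  Integrable.of_bound measurable_id.aestronglyMeasurable 1
    ((hR x).mono fun y hy => by rw [Real.norm_eq_abs, abs_le]; constructor <;> linarith [hy.1, hy.2])

theorem meanReward_mem (hR : ∀ x, ∀ᵐ y ∂(M.R x), 0 ≤ y ∧ y ≤ 1) (x : S × A) :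
    0 ≤ M.meanReward x ∧ M.meanReward x ≤ 1 := by
  refine ⟨integral_nonneg_of_ae ((hR x).mono fun y hy => hy.1), ?_⟩
  have := integral_mono_ae (M.integrable_reward hR x) (integrable_const (1 : ℝ))
    ((hR x).mono fun y hy => hy.2)
  simpa [meanReward] using this

/-- The value of always receiving zero reward but collecting the maximal entropy bonus. -/
noncomputable def entropyValue (lam : ℝ) : ℝ :=
  M.γ * (lam * Real.log (Fintype.card A)) / (1 - M.γ)

theorem one_sub_pos : 0 < 1 - M.γ := sub_pos.2 M.γ_lt_one

theorem entropyValue_eq (lam : ℝ) :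
    M.γ * (lam * Real.log (Fintype.card A) + M.entropyValue lam) = M.entropyValue lam := by
  have := M.one_sub_pos.ne'
  rw [entropyValue]
  field_simp
  ring

theorem one_add_eq : 1 + M.γ * (1 / (1 - M.γ)) = 1 / (1 - M.γ) := by
  have := M.one_sub_pos.ne'
  field_simp
  ring

variable [Nonempty A] {lam : ℝ}

theorem softQStar_apply (hlam : 0 < lam) (x : S × A) : M.softQStar lam x = M.meanReward x
    + M.γ * M.transMat.mulVec (softMax lam (M.softQStar lam)) x := by
  conv_lhs => rw [(M.softQStar_spec hlam).1]
  rfl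

/-- Evaluate the fixed point equation at the minimizing and at the maximizing pair. At the minimum q
it gives q ≥ γ(λ log|A| + q), whose equality case is `entropyValue`; the maximum adds the reward,
worth at most 1/(1-γ). -/
theorem softQStar_mem (hR : ∀ x, ∀ᵐ y ∂(M.R x), 0 ≤ y ∧ y ≤ 1) (hlam : 0 < lam) (x : S × A) :
    M.entropyValue lam ≤ M.softQStar lam x ∧
      M.softQStar lam x ≤ M.entropyValue lam + 1 / (1 - M.γ) := by
  have : Nonempty (S × A) := ⟨x⟩
  have hγ := M.γ_pos
  have hκ := M.one_sub_pos
  have he := M.entropyValue_eq lam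
  have h1 := M.one_add_eq
  obtain ⟨y, hy⟩ := Finite.exists_min (M.softQStar lam)
  obtain ⟨z, hz⟩ := Finite.exists_max (M.softQStar lam)
  have hy' := mul_le_mul_of_nonneg_left
    (M.le_transMat_mulVec (le_softMax_of_le hlam hy) y) hγ.le
  have hz' := mul_le_mul_of_nonneg_left
    (M.transMat_mulVec_le (softMax_le_of_le hlam hz) z) hγ.le
  have ey := M.softQStar_apply hlam y
  have ez := M.softQStar_apply hlam z
  have ry := M.meanReward_mem hR y
  have rz := M.meanReward_mem hR z
  constructor
  · refine le_trans ?_ (hy x)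
    have : 0 ≤ (1 - M.γ) * (M.softQStar lam y - M.entropyValue lam) := by nlinarith
    have := nonneg_of_mul_nonneg_right this hκ
    linarith
  · refine (hz x).trans ?_
    have : 0 ≤ (1 - M.γ) * (M.entropyValue lam + 1 / (1 - M.γ) - M.softQStar lam z) := by
      nlinarith
    have := nonneg_of_mul_nonneg_right this hκ
    linarith

/-- The interval is invariant under the sampled Bellman map, because clipped rewards lie in [0, 1]
surely and the margin d shrinks by γ; the update is a convex combination. -/
theorem softIter_mem (hlam : 0 < lam) {η : ℕ → ℝ} (hη0 : ∀ t, 0 ≤ η t) (hη1 : ∀ t, η t ≤ 1)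
    {Q₀ : S × A → ℝ} {d : ℝ} (hd : 0 ≤ d)
    (h0 : ∀ x, M.entropyValue lam - d ≤ Q₀ x ∧
      Q₀ x ≤ M.entropyValue lam + 1 / (1 - M.γ) + d)
    (o : ℕ → S × A → ℝ × S) (t : ℕ) (x : S × A) :
    M.entropyValue lam - d ≤ M.softIter lam η Q₀ (fun t => clipObs (o t)) t x ∧
      M.softIter lam η Q₀ (fun t => clipObs (o t)) t x
        ≤ M.entropyValue lam + 1 / (1 - M.γ) + d := by
  have hγ := M.γ_pos
  have hγ1 := M.γ_lt_one
  have he := M.entropyValue_eq lam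
  have h1 := M.one_add_eq
  induction t generalizing x with
  | zero => exact h0 x
  | succ t ih =>
    simp only [softIter]
    set q := M.softIter lam η Q₀ (fun t => clipObs (o t)) t
    set p := clipObs (o (t + 1)) x with hp
    have hr := clipReward_mem (o (t + 1) x)
    have hlo := mul_le_mul_of_nonneg_left
      (le_softMax_of_le hlam (fun y => (ih y).1) p.2) hγ.le
    have hhi := mul_le_mul_of_nonneg_left
      (softMax_le_of_le hlam (fun y => (ih y).2) p.2) hγ.le
    have hr' : 0 ≤ p.1 ∧ p.1 ≤ 1 := hr
    have hγd : M.γ * d ≤ d := mul_le_of_le_one_left hd hγ1.le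
    have g1 : M.entropyValue lam - d ≤ p.1 + M.γ * softMax lam q p.2 := by nlinarith
    have g2 : p.1 + M.γ * softMax lam q p.2 ≤ M.entropyValue lam + 1 / (1 - M.γ) + d := by
      nlinarith
    have e0 := sub_nonneg.2 (hη1 (t + 1))
    have e1 := hη0 (t + 1)
    constructor
    · have a1 := mul_le_mul_of_nonneg_left (ih x).1 e0
      have a2 := mul_le_mul_of_nonneg_left g1 e1
      linarith
    · have a1 := mul_le_mul_of_nonneg_left (ih x).2 e0
      have a2 := mul_le_mul_of_nonneg_left g2 e1
      linarith

/-- Both the iterate and Q* lie near the same interval of length 1/(1-γ), up to the initial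
distance. The right-hand side is h/κ with h the scale in `IsPerturbedIter`. -/
theorem norm_softIter_sub_le (hR : ∀ x, ∀ᵐ y ∂(M.R x), 0 ≤ y ∧ y ≤ 1) (hlam : 0 < lam)
    {η : ℕ → ℝ} (hη0 : ∀ t, 0 ≤ η t) (hη1 : ∀ t, η t ≤ 1) (Q₀ : S × A → ℝ)
    (o : ℕ → S × A → ℝ × S) (t : ℕ) :
    ‖M.softIter lam η Q₀ (fun t => clipObs (o t)) t - M.softQStar lam‖
      ≤ (1 + (1 - M.γ) * ‖Q₀ - M.softQStar lam‖) / (1 - M.γ) := by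
  have hκ := M.one_sub_pos
  set d := ‖Q₀ - M.softQStar lam‖
  have hd : 0 ≤ d := norm_nonneg _
  have e : (1 + (1 - M.γ) * d) / (1 - M.γ) = 1 / (1 - M.γ) + d := by field_simp
  rw [e]
  refine (pi_norm_le_iff_of_nonneg (by positivity)).2 fun x => ?_
  have h0 : ∀ x, M.entropyValue lam - d ≤ Q₀ x ∧
      Q₀ x ≤ M.entropyValue lam + 1 / (1 - M.γ) + d := fun x => by
    have h1 := abs_le.1 (norm_le_pi_norm (Q₀ - M.softQStar lam) x)
    have h2 := M.softQStar_mem hR hlam x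
    simp only [Pi.sub_apply] at h1
    constructor <;> linarith [h1.1, h1.2, h2.1, h2.2]
  have h1 := M.softIter_mem hlam hη0 hη1 hd h0 o t x
  have h2 := M.softQStar_mem hR hlam x
  rw [Real.norm_eq_abs, Pi.sub_apply, abs_le]
  constructor <;> linarith [h1.1, h1.2, h2.1, h2.2]

/-- The noise sees only the oscillation of the soft value, at most 1/(1-γ), since the entropy offset
cancels; then 1 + γ/(1-γ) = 1/(1-γ). -/
theorem norm_softNoise_clipObs_le (hR : ∀ x, ∀ᵐ y ∂(M.R x), 0 ≤ y ∧ y ≤ 1) (hlam : 0 < lam)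
    (ob : S × A → ℝ × S) : ‖M.softNoise lam (clipObs ob)‖ ≤ 1 / (1 - M.γ) := by
  have hκ := M.one_sub_pos
  have hγ := M.γ_pos
  refine (pi_norm_le_iff_of_nonneg (by positivity)).2 fun x => ?_
  have hlo := le_softMax_of_le hlam fun y => (M.softQStar_mem hR hlam y).1
  have hhi := softMax_le_of_le hlam fun y => (M.softQStar_mem hR hlam y).2
  have h1 := M.le_transMat_mulVec hlo x
  have h2 := M.transMat_mulVec_le hhi x
  have h3 := hlo (clipObs ob x).2
  have h4 := hhi (clipObs ob x).2
  have hr : 0 ≤ (clipObs ob x).1 ∧ (clipObs ob x).1 ≤ 1 := clipReward_mem (ob x)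
  have hm := M.meanReward_mem hR x
  have he := M.one_add_eq
  rw [Real.norm_eq_abs, softNoise]
  set V := softMax lam (M.softQStar lam)
  have h5 : |V (clipObs ob x).2 - M.transMat.mulVec V x| ≤ 1 / (1 - M.γ) :=
    abs_le.2 ⟨by linarith, by linarith⟩
  have h6 : |(clipObs ob x).1 - M.meanReward x| ≤ 1 :=
    abs_le.2 ⟨by linarith [hr.1, hm.2], by linarith [hr.2, hm.1]⟩
  calc _ ≤ 1 + M.γ * (1 / (1 - M.γ)) := by
        refine (abs_add_le _ _).trans (add_le_add h6 ?_)
        rw [abs_mul, abs_of_pos hγ]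
        exact mul_le_mul_of_nonneg_left h5 hγ.le
    _ = _ := he

end Model

/-! ### Moments of a single batch of observations. -/

section Law

variable {S : Type u} {A : Type v} [Fintype S] [Fintype A] [MeasurableSpace S]
  (M : DiscountedMDP S A)

instance : IsProbabilityMeasure M.obsLaw := by
  unfold obsLaw; infer_instance

theorem integral_obsLaw_apply (x : S × A) {f : ℝ × S → ℝ} (hf : Measurable f) :
    ∫ ob, f (ob x) ∂M.obsLaw = ∫ p, f p ∂((M.R x).prod (M.P x).toMeasure) := by
  have h := (measurePreserving_eval (fun x => (M.R x).prod (M.P x).toMeasure) x)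
  rw [← h.map_eq, integral_map h.measurable.aemeasurable hf.aestronglyMeasurable]
  rfl

/-- Clipping changes nothing almost surely, yet makes the bounds hold at every sample point, as
`IsBoundedMDS` demands. -/
theorem ae_clipObs_eq (hR : ∀ x, ∀ᵐ y ∂(M.R x), 0 ≤ y ∧ y ≤ 1) :
    ∀ᵐ ob ∂M.obsLaw, clipObs ob = ob := by
  have h : ∀ x, ∀ᵐ ob ∂M.obsLaw, 0 ≤ (ob x).1 ∧ (ob x).1 ≤ 1 := fun x =>
    (measurePreserving_eval (fun x => (M.R x).prod (M.P x).toMeasure) x).quasiMeasurePreserving.ae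
      (Measure.quasiMeasurePreserving_fst.ae (hR x))
  filter_upwards [ae_all_iff.2 h] with ob hob
  exact funext fun x => clipReward_eq (hob x)

theorem integral_reward_clip (hR : ∀ x, ∀ᵐ y ∂(M.R x), 0 ≤ y ∧ y ≤ 1) (x : S × A) :
    ∫ ob, (clipObs ob x).1 ∂M.obsLaw = M.meanReward x := by
  have h1 : ∫ ob, (clipObs ob x).1 ∂M.obsLaw = ∫ ob, (ob x).1 ∂M.obsLaw :=
    integral_congr_ae ((M.ae_clipObs_eq hR).mono fun ob h => by simp only [h])
  rw [h1, M.integral_obsLaw_apply x measurable_fst, meanReward]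
  have h := measurePreserving_fst (μ := M.R x) (ν := (M.P x).toMeasure)
  conv_rhs => rw [← h.map_eq]
  exact (integral_map (f := fun y : ℝ => y) h.measurable.aemeasurable
    measurable_id.aestronglyMeasurable).symm

variable [MeasurableSingletonClass S]

theorem integral_nextState (x : S × A) (V : S → ℝ) :
    ∫ ob, V (clipObs ob x).2 ∂M.obsLaw = M.transMat.mulVec V x := by
  have hV : Measurable V := measurable_of_finite V
  have h := measurePreserving_snd (μ := M.R x) (ν := (M.P x).toMeasure)
  have h1 := M.integral_obsLaw_apply x (f := fun p => V p.2) (hV.comp measurable_snd)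
  have h2 : ∫ s, V s ∂(M.P x).toMeasure
      = ∫ p, V p.2 ∂((M.R x).prod (M.P x).toMeasure) := by
    conv_lhs => rw [← h.map_eq]
    rw [integral_map h.measurable.aemeasurable hV.aestronglyMeasurable]
  refine h1.trans (h2.symm.trans ?_)
  rw [PMF.integral_eq_sum]
  rfl

theorem measurable_nextState (x : S × A) (V : S → ℝ) :
    Measurable fun ob : S × A → ℝ × S => V (clipObs ob x).2 :=
  (measurable_of_finite V).comp
    (measurable_snd.comp ((measurable_pi_apply x).comp measurable_clipObs))

theorem integrable_nextState (x : S × A) (V : S → ℝ) :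
    Integrable (fun ob : S × A → ℝ × S => V (clipObs ob x).2) M.obsLaw :=
  integrable_of_abs_le (measurable_nextState x V) fun ob => norm_le_pi_norm V (clipObs ob x).2

theorem measurable_reward_clip (x : S × A) :
    Measurable fun ob : S × A → ℝ × S => (clipObs ob x).1 :=
  measurable_fst.comp ((measurable_pi_apply x).comp measurable_clipObs)

theorem integrable_reward_clip (x : S × A) :
    Integrable (fun ob : S × A → ℝ × S => (clipObs ob x).1) M.obsLaw :=
  integrable_of_abs_le (C := 1) (measurable_reward_clip x) fun ob => by
    have := clipReward_mem (ob x)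
    exact (abs_of_nonneg this.1).trans_le this.2

theorem measurable_softNoise (lam : ℝ) :
    Measurable fun ob : S × A → ℝ × S => M.softNoise lam (clipObs ob) :=
  measurable_pi_lambda _ fun x => ((measurable_reward_clip x).sub_const _).add
    (((measurable_nextState x _).sub_const _).const_mul _)

theorem integral_softNoise_clip (hR : ∀ x, ∀ᵐ y ∂(M.R x), 0 ≤ y ∧ y ≤ 1) (lam : ℝ)
    (x : S × A) : ∫ ob, M.softNoise lam (clipObs ob) x ∂M.obsLaw = 0 := by
  set V := softMax lam (M.softQStar lam) with hV
  have h1 := M.integrable_reward_clip x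
  have h2 := M.integrable_nextState x V
  simp only [softNoise, ← hV]
  have h3 : Integrable (fun ob => (clipObs ob x).1 - M.meanReward x) M.obsLaw :=
    h1.sub (integrable_const _)
  have h4 : Integrable (fun ob => M.γ * (V (clipObs ob x).2 - M.transMat.mulVec V x)) M.obsLaw :=
    (h2.sub (integrable_const _)).const_mul _
  rw [integral_add h3 h4, integral_sub h1 (integrable_const _), integral_const_mul,
    integral_sub h2 (integrable_const _), M.integral_reward_clip hR, M.integral_nextState]
  simp

theorem integral_softNoise_mul_clip (hR : ∀ x, ∀ᵐ y ∂(M.R x), 0 ≤ y ∧ y ≤ 1) (lam : ℝ)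
    (x y : S × A) :
    ∫ ob, M.softNoise lam (clipObs ob) x * M.softNoise lam (clipObs ob) y ∂M.obsLaw
      = M.softNoiseVar lam x y := by
  rw [softNoiseVar, Matrix.of_apply]
  exact integral_congr_ae ((M.ae_clipObs_eq hR).mono fun ob h => by simp only [h])

variable [Nonempty A] {lam : ℝ}

theorem integral_sq_softNoise_le (hR : ∀ x, ∀ᵐ y ∂(M.R x), 0 ≤ y ∧ y ≤ 1) (x : S × A) :
    ∫ ob, M.softNoise lam (clipObs ob) x ^ 2 ∂M.obsLaw ≤ matInfNorm (M.softNoiseVar lam) := by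
  simp only [sq]
  rw [M.integral_softNoise_mul_clip hR]
  exact (le_abs_self _).trans (abs_apply_le_matInfNorm _ x x)

/-- With J the resolvent, the diagonal of the sandwich is that of the asymptotic variance; this
identifies the leading constant for polynomial steps. -/
theorem integral_sq_mulVec_softNoise (hR : ∀ x, ∀ᵐ y ∂(M.R x), 0 ≤ y ∧ y ≤ 1) (hlam : 0 < lam)
    (J : Matrix (S × A) (S × A) ℝ) (x : S × A) :
    ∫ ob, J.mulVec (M.softNoise lam (clipObs ob)) x ^ 2 ∂M.obsLaw
      = (J * M.softNoiseVar lam * J.transpose) x x := by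
  have hm : ∀ y, Measurable fun ob : S × A → ℝ × S => M.softNoise lam (clipObs ob) y := fun y =>
    (measurable_pi_apply y).comp (M.measurable_softNoise lam)
  have hb : ∀ ob y, |M.softNoise lam (clipObs ob) y| ≤ 1 / (1 - M.γ) := fun ob y =>
    (norm_le_pi_norm _ y).trans (M.norm_softNoise_clipObs_le hR hlam ob)
  have hi : ∀ y z, Integrable (fun ob => J x y * J x z
      * (M.softNoise lam (clipObs ob) y * M.softNoise lam (clipObs ob) z)) M.obsLaw :=
    fun y z => (integrable_of_abs_le (C := 1 / (1 - M.γ) * (1 / (1 - M.γ)))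
      ((hm y).mul (hm z)) fun ob => by
        rw [Pi.mul_apply, abs_mul]
        exact mul_le_mul (hb ob y) (hb ob z) (abs_nonneg _)
          ((abs_nonneg _).trans (hb ob y))).const_mul _
  have e : ∀ ob, J.mulVec (M.softNoise lam (clipObs ob)) x ^ 2 = ∑ y, ∑ z, J x y * J x z
      * (M.softNoise lam (clipObs ob) y * M.softNoise lam (clipObs ob) z) := fun ob => by
    rw [sq, Matrix.mulVec, dotProduct, Finset.sum_mul_sum]
    exact Finset.sum_congr rfl fun y _ => Finset.sum_congr rfl fun z _ => by ring
  simp only [e]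
  rw [integral_finsetSum _ fun y _ => integrable_finsetSum _ fun z _ => hi y z]
  simp only [Matrix.mul_apply, Finset.sum_mul, Matrix.transpose_apply]
  have : ∀ y, ∫ ob, ∑ z, J x y * J x z * (M.softNoise lam (clipObs ob) y
      * M.softNoise lam (clipObs ob) z) ∂M.obsLaw
      = ∑ z, J x y * M.softNoiseVar lam y z * J x z := fun y => by
    rw [integral_finsetSum _ fun z _ => hi y z]
    refine Finset.sum_congr rfl fun z _ => ?_
    rw [integral_const_mul, M.integral_softNoise_mul_clip hR]
    ring
  simp only [this]
  exact Finset.sum_comm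

end Law

end DiscountedMDP

/-! ### Q-learning as a perturbed iteration. -/

namespace DiscountedMDP

section ErrorProcess

variable {S : Type u} {A : Type v} [Fintype S] [Fintype A] [MeasurableSpace S]
  (M : DiscountedMDP S A) {Ω : Type w}

/-- The Q-learning iterates along the truncated observations. -/
noncomputable def clipIter (lam : ℝ) (η : ℕ → ℝ) (Q₀ : S × A → ℝ) (o : ℕ → Ω → S × A → ℝ × S)
    (t : ℕ) (ω : Ω) : S × A → ℝ :=
  M.softIter lam η Q₀ (fun t => clipObs (o t ω)) t

/-- The fluctuation at the error `W = L Q - L Q*` of the soft values. -/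
noncomputable def stateNoise (W : S → ℝ) (ob : S × A → ℝ × S) (x : S × A) : ℝ :=
  M.γ * (W (ob x).2 - M.transMat.mulVec W x)

theorem norm_stateNoise_le {W : S → ℝ} {b : ℝ} (hb : 0 ≤ b) (hW : ∀ s, |W s| ≤ b)
    (ob : S × A → ℝ × S) : ‖M.stateNoise W ob‖ ≤ 2 * M.γ * b := by
  have hγ := M.γ_pos
  refine (pi_norm_le_iff_of_nonneg (by positivity)).2 fun x => ?_
  rw [stateNoise, norm_mul, Real.norm_of_nonneg hγ.le, Real.norm_eq_abs]
  have := (abs_sub _ _).trans (add_le_add (hW (ob x).2) (M.abs_transMat_mulVec_le hW x))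
  nlinarith

/-- Separates the random function W, known from the past, from centered indicators of the next
state. -/
theorem stateNoise_eq_sum [DecidableEq S] (W : S → ℝ) (ob : S × A → ℝ × S) (x : S × A) :
    M.stateNoise W ob x
      = M.γ * ∑ s, W s * ((if (ob x).2 = s then 1 else 0) - M.transMat x s) := by
  simp [stateNoise, Matrix.mulVec, dotProduct, mul_sub, Finset.sum_sub_distrib, mul_comm]

theorem measurable_iteration [MeasurableSingletonClass S] [Nonempty A] {lam : ℝ} (hlam : 0 < lam)
    (e : ℝ) {m : MeasurableSpace Ω} {Q : Ω → S × A → ℝ} (hQ : Measurable Q)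
    {ob : Ω → S × A → ℝ × S} (hob : Measurable ob) :
    Measurable fun ω x => (1 - e) * Q ω x
      + e * ((ob ω x).1 + M.γ * softMax lam (Q ω) (ob ω x).2) := by
  refine measurable_pi_lambda _ fun x => ?_
  have hx : Measurable fun ω => ob ω x := (measurable_pi_apply x).comp hob
  have h1 : Measurable fun ω => Q ω x := (measurable_pi_apply x).comp hQ
  have h2 : Measurable fun ω => softMax lam (Q ω) (ob ω x).2 :=
    measurable_apply_of_finite (W := fun ω => softMax lam (Q ω))
      (fun s => (measurable_softMax hlam s).comp hQ) (measurable_snd.comp hx)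
  exact (h1.const_mul _).add (((measurable_fst.comp hx).add (h2.const_mul _)).const_mul _)

variable [MeasurableSingletonClass S] {mΩ : MeasurableSpace Ω} {μ : Measure Ω}
  {o : ℕ → Ω → S × A → ℝ × S} {lam : ℝ} {η : ℕ → ℝ} {Q₀ : S × A → ℝ}

theorem IsSample.ae_clipIter_eq (ho : M.IsSample μ o)
    (hR : ∀ x, ∀ᵐ y ∂(M.R x), 0 ≤ y ∧ y ≤ 1) :
    ∀ᵐ ω ∂μ, ∀ t, M.softIter lam η Q₀ (fun t => o t ω) t = M.clipIter lam η Q₀ o t ω := by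
  have h : ∀ t, ∀ᵐ ω ∂μ, clipObs (o t ω) = o t ω := fun t =>
    ae_of_ae_map (ho.measurable t).aemeasurable (by rw [ho.law t]; exact M.ae_clipObs_eq hR)
  filter_upwards [ae_all_iff.2 h] with ω hω t
  simp only [clipIter, hω]

variable [Nonempty A]

theorem measurable_clipIter (hlam : 0 < lam) (ho : ∀ t, Measurable (o t)) (t : ℕ) :
    Measurable[historyFiltration o ho t] (M.clipIter lam η Q₀ o t) := by
  induction t with
  | zero => exact measurable_const
  | succ t ih =>
    exact M.measurable_iteration hlam _
      (ih.mono ((historyFiltration o ho).mono t.le_succ) le_rfl)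
      (measurable_clipObs.comp (measurable_observation ho (t + 1)))

variable [IsProbabilityMeasure μ]

theorem IsSample.isBoundedMDS_softNoise (ho : M.IsSample μ o)
    (hR : ∀ x, ∀ᵐ y ∂(M.R x), 0 ≤ y ∧ y ≤ 1) (hlam : 0 < lam) :
    IsBoundedMDS μ (historyFiltration o ho.measurable)
      (fun t ω => M.softNoise lam (clipObs (o (t + 1) ω))) (1 / (1 - M.γ)) where
  adapted t x := (measurable_pi_apply x).comp
    ((M.measurable_softNoise lam).comp (measurable_observation ho.measurable (t + 1)))
  bound t ω := M.norm_softNoise_clipObs_le hR hlam _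
  centered t x g hg _ := by
    have := integral_mul_observation ho.measurable ho.indep ho.law t hg
      ((measurable_pi_apply x).comp (M.measurable_softNoise lam))
    refine this.trans ?_
    rw [show ∫ ob, ((fun b : S × A → ℝ => b x) ∘ fun ob => M.softNoise lam (clipObs ob)) ob
      ∂M.obsLaw = 0 from M.integral_softNoise_clip hR lam x, mul_zero]

/-- Here W is random, so the one-batch integral cannot be applied directly. The finite expansion
over next states reduces the claim to products of a past variable with a centered function of the
next batch. -/
theorem IsSample.isBoundedMDS_stateNoise (ho : M.IsSample μ o) {W : ℕ → Ω → S → ℝ}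
    (hW : ∀ t s, Measurable[historyFiltration o ho.measurable t] fun ω => W t ω s) {b : ℝ}
    (hb : 0 ≤ b) (hWb : ∀ t ω s, |W t ω s| ≤ b) :
    IsBoundedMDS μ (historyFiltration o ho.measurable)
      (fun t ω => M.stateNoise (W t ω) (clipObs (o (t + 1) ω))) (2 * M.γ * b) where
  adapted t x := by
    have hW' : ∀ s, Measurable[historyFiltration o ho.measurable (t + 1)] fun ω => W t ω s :=
      fun s => (hW t s).mono ((historyFiltration o ho.measurable).mono t.le_succ) le_rfl
    have hob : Measurable[historyFiltration o ho.measurable (t + 1)]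
        fun ω => (clipObs (o (t + 1) ω) x).2 :=
      measurable_snd.comp ((measurable_pi_apply x).comp
        (measurable_clipObs.comp (measurable_observation ho.measurable (t + 1))))
    have hP : Measurable[historyFiltration o ho.measurable (t + 1)]
        fun ω => M.transMat.mulVec (W t ω) x :=
      Finset.measurable_sum _ fun s _ => (hW' s).const_mul _
    exact ((measurable_apply_of_finite hW' hob).sub hP).const_mul _
  bound t ω := M.norm_stateNoise_le hb (hWb t ω) _
  centered t x g hg hgb := by
    classical
    obtain ⟨C, hC⟩ := hgb
    set φ : S → (S × A → ℝ × S) → ℝ := fun s ob =>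
      (if (clipObs ob x).2 = s then 1 else 0) - M.transMat x s with hφ
    have hφm : ∀ s, Measurable (φ s) := fun s =>
      (measurable_nextState x fun s' => if s' = s then (1 : ℝ) else 0).sub_const _
    have hφ0 : ∀ s, ∫ ob, φ s ob ∂M.obsLaw = 0 := fun s => by
      have h := M.integral_nextState x fun s' => if s' = s then (1 : ℝ) else 0
      have h' := M.integrable_nextState x fun s' => if s' = s then (1 : ℝ) else 0
      simp only [hφ]
      rw [integral_sub h' (integrable_const _), h]
      simp [Matrix.mulVec, dotProduct]
    have hφ1 : ∀ s ob, |φ s ob| ≤ 1 := fun s ob => by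
      have h0 := M.transMat_nonneg x s
      have h1 : M.transMat x s ≤ 1 := by
        rw [← M.sum_transMat x]
        exact Finset.single_le_sum (fun s _ => M.transMat_nonneg x s) (Finset.mem_univ s)
      simp only [hφ]
      split_ifs <;> rw [abs_le] <;> constructor <;> linarith
    have hgW : ∀ s, Measurable[historyFiltration o ho.measurable t] fun ω => g ω * W t ω s :=
      fun s => hg.mul (hW t s)
    have hle := (historyFiltration o ho.measurable).le t
    have hint : ∀ s, Integrable (fun ω => g ω * W t ω s * φ s (o (t + 1) ω)) μ := fun s =>
      integrable_of_abs_le (C := C * b * 1) (((hgW s).mono hle le_rfl).mul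
        ((hφm s).comp (ho.measurable (t + 1)))) fun ω => by
          rw [abs_mul, abs_mul]
          exact mul_le_mul (mul_le_mul (hC ω) (hWb t ω s) (abs_nonneg _)
            ((abs_nonneg _).trans (hC ω))) (hφ1 s _) (abs_nonneg _)
            (mul_nonneg ((abs_nonneg _).trans (hC ω)) hb)
    have e : ∀ ω, g ω * M.stateNoise (W t ω) (clipObs (o (t + 1) ω)) x
        = M.γ * ∑ s, g ω * W t ω s * φ s (o (t + 1) ω) := fun ω => by
      rw [stateNoise_eq_sum, mul_left_comm, Finset.mul_sum]
      simp only [hφ, mul_assoc]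
    simp only [e]
    rw [integral_const_mul, integral_finsetSum _ fun s _ => hint s]
    refine mul_eq_zero_of_right _ (Finset.sum_eq_zero fun s _ => ?_)
    rw [integral_mul_observation ho.measurable ho.indep ho.law t (hgW s) (hφm s), hφ0, mul_zero]

/-- The error of Q-learning is a perturbed linear iteration around the soft optimal policy. -/
theorem IsSample.isPerturbedIter [DecidableEq S] (ho : M.IsSample μ o)
    (hR : ∀ x, ∀ᵐ y ∂(M.R x), 0 ≤ y ∧ y ≤ 1) (hlam : 0 < lam)
    (hη0 : ∀ t, 0 ≤ η t) (hη1 : ∀ t, η t ≤ 1) (Q₀ : S × A → ℝ) :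
    IsPerturbedIter μ (historyFiltration o ho.measurable) (1 - M.γ)
      (1 + (1 - M.γ) * ‖Q₀ - M.softQStar lam‖) lam (M.policyMat (M.softOptPolicy lam)) η
      (Q₀ - M.softQStar lam) (fun t ω => M.clipIter lam η Q₀ o t ω - M.softQStar lam)
      (fun t ω => M.transMat.mulVec fun s =>
        softMax lam (M.clipIter lam η Q₀ o t ω) s - softMax lam (M.softQStar lam) s
          - ∑ a, (M.softOptPolicy lam).1 s a
            * (M.clipIter lam η Q₀ o t ω - M.softQStar lam) (s, a))
      (fun t ω => M.softNoise lam (clipObs (o (t + 1) ω)))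
      (fun t ω => M.stateNoise (fun s =>
        softMax lam (M.clipIter lam η Q₀ o t ω) s - softMax lam (M.softQStar lam) s)
        (clipObs (o (t + 1) ω))) := by
  have hκ := M.one_sub_pos
  have hγ := M.γ_pos
  have hbound : ∀ t ω, ‖M.clipIter lam η Q₀ o t ω - M.softQStar lam‖
      ≤ (1 + (1 - M.γ) * ‖Q₀ - M.softQStar lam‖) / (1 - M.γ) := fun t ω =>
    M.norm_softIter_sub_le hR hlam hη0 hη1 Q₀ (fun t => o t ω) t
  -- Adding ζ back to KΔ restores P(LQ - LQ*). The nonexpansive bound is proved for this sum, the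
  -- quadratic bound for ζ alone.
  have hK : ∀ t ω, (M.policyMat (M.softOptPolicy lam)).mulVec
      (M.clipIter lam η Q₀ o t ω - M.softQStar lam)
      + (M.transMat.mulVec fun s =>
        softMax lam (M.clipIter lam η Q₀ o t ω) s - softMax lam (M.softQStar lam) s
          - ∑ a, (M.softOptPolicy lam).1 s a
            * (M.clipIter lam η Q₀ o t ω - M.softQStar lam) (s, a))
      = M.transMat.mulVec fun s =>
        softMax lam (M.clipIter lam η Q₀ o t ω) s - softMax lam (M.softQStar lam) s :=
    fun t ω => by
      funext x
      rw [Pi.add_apply, policyMat_mulVec]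
      simp only [Matrix.mulVec, dotProduct]
      rw [← Finset.sum_add_distrib]
      exact Finset.sum_congr rfl fun s _ => by ring
  exact {
    rate_pos := hκ
    rate_lt_one := by linarith
    lam_pos := hlam
    scale_eq := rfl
    mat_nonneg := M.policyMat_nonneg _
    mat_sum := M.sum_policyMat _
    init := fun ω => rfl
    step := fun t ω => by
      rw [hK]
      funext x
      have hs := M.softQStar_apply hlam x
      have e : M.clipIter lam η Q₀ o (t + 1) ω x = (1 - η (t + 1)) * M.clipIter lam η Q₀ o t ω x
          + η (t + 1) * ((clipObs (o (t + 1) ω) x).1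
            + M.γ * softMax lam (M.clipIter lam η Q₀ o t ω) (clipObs (o (t + 1) ω) x).2) := rfl
      simp only [Pi.sub_apply, Pi.add_apply, Pi.smul_apply, smul_eq_mul, e, softNoise, stateNoise]
      rw [sub_sub_cancel]
      linear_combination (-η (t + 1)) * hs
    contr := fun t ω => by
      rw [hK]
      exact (pi_norm_le_iff_of_nonneg (norm_nonneg _)).2 fun x =>
        M.abs_transMat_mulVec_le (fun s => abs_softMax_sub_le hlam _ _ s) x
    quad := fun t ω => by
      refine (pi_norm_le_iff_of_nonneg (by positivity)).2 fun x =>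
        M.abs_transMat_mulVec_le (fun s => ?_) x
      -- Convexity makes the linearization error nonnegative; smoothness bounds it from above.
      have h1 := sum_greedy_mul_le hlam (M.clipIter lam η Q₀ o t ω) (M.softQStar lam) s
      have h2 := softMax_sub_sub_le hlam (M.clipIter lam η Q₀ o t ω) (M.softQStar lam) s
      have h3 : 0 ≤ 2 * ‖M.clipIter lam η Q₀ o t ω - M.softQStar lam‖ ^ 2 / lam := by positivity
      rw [softOptPolicy, abs_le]
      constructor <;> linarith
    measurable := fun t => ((M.measurable_clipIter hlam ho.measurable t).mono
      ((historyFiltration o ho.measurable).le t) le_rfl).sub_const _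
    bound := hbound
    mdsZ := ho.isBoundedMDS_softNoise M hR hlam
    mdsD := by
      refine (ho.isBoundedMDS_stateNoise M (fun t s => ?_)
        ((norm_nonneg _).trans (hbound 0 (Classical.choice μ.nonempty_of_neZero)))
        fun t ω s => (abs_softMax_sub_le hlam _ _ s).trans (hbound t ω)).mono ?_
      · exact ((measurable_softMax hlam s).comp
          (M.measurable_clipIter hlam ho.measurable t)).sub_const _
      · rw [mul_div_assoc, mul_assoc]
        have := mul_le_of_le_one_left
          ((norm_nonneg _).trans (hbound 0 (Classical.choice μ.nonempty_of_neZero)))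
          M.γ_lt_one.le
        linarith
    norm_le := fun t ω => by
      rw [sub_sub_cancel]
      exact M.norm_stateNoise_le (norm_nonneg _) (fun s => abs_softMax_sub_le hlam _ _ s) _ }

theorem IsSample.weightedVarLe_softNoise (ho : M.IsSample μ o)
    (hR : ∀ x, ∀ᵐ y ∂(M.R x), 0 ≤ y ∧ y ≤ 1) (hlam : 0 < lam) (t : ℕ) :
    WeightedVarLe μ (historyFiltration o ho.measurable)
      (fun t ω => M.softNoise lam (clipObs (o (t + 1) ω))) t (matInfNorm (M.softNoiseVar lam)) :=
  weightedVarLe_observation ho.measurable ho.indep ho.law (M.measurable_softNoise lam)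
    (matInfNorm_nonneg _) (M.norm_softNoise_clipObs_le hR hlam)
    (fun x => M.integral_sq_softNoise_le hR x) t

theorem IsSample.weightedVarLe_resolvent_softNoise [DecidableEq S] [DecidableEq A]
    (ho : M.IsSample μ o) (hR : ∀ x, ∀ᵐ y ∂(M.R x), 0 ≤ y ∧ y ≤ 1) (hlam : 0 < lam) (t : ℕ) :
    WeightedVarLe μ (historyFiltration o ho.measurable)
      (fun t ω => ((1 - (1 - (1 - M.γ)) • M.policyMat (M.softOptPolicy lam))⁻¹).mulVec
        (M.softNoise lam (clipObs (o (t + 1) ω)))) t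
      (matInfNorm (Matrix.diagonal (M.softAsymVar lam).diag)) := by
  have hκ := M.one_sub_pos
  have hκ1 : 1 - M.γ ≤ 1 := by linarith [M.γ_pos]
  refine weightedVarLe_observation ho.measurable ho.indep ho.law
    (f := fun ob => ((1 - (1 - (1 - M.γ)) • M.policyMat (M.softOptPolicy lam))⁻¹).mulVec
      (M.softNoise lam (clipObs ob))) (b := 1 / (1 - M.γ) * (1 / (1 - M.γ)))
    ?_ (matInfNorm_nonneg _) (fun ob => ?_) (fun x => ?_) t
  · refine measurable_pi_lambda _ fun x => Finset.measurable_sum _ fun y _ => ?_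
    exact ((measurable_pi_apply y).comp (M.measurable_softNoise lam)).const_mul _
  · refine (norm_resolvent_mulVec_le hκ hκ1 (M.policyMat_nonneg _) (M.sum_policyMat _) _).trans ?_
    exact mul_le_mul_of_nonneg_left (M.norm_softNoise_clipObs_le hR hlam ob) (by positivity)
  · rw [sub_sub_cancel, M.integral_sq_mulVec_softNoise hR hlam]
    have := abs_apply_le_matInfNorm (Matrix.diagonal (M.softAsymVar lam).diag) x x
    rw [Matrix.diagonal_apply_eq] at this
    exact (le_abs_self _).trans this

/-- Transfers the estimates from the clipped to the original iterates, which agree almost surely,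
and reindexes times 1, …, T as t + 1 with t < T. -/
theorem IsSample.integral_norm_softAvg_sub (ho : M.IsSample μ o)
    (hR : ∀ x, ∀ᵐ y ∂(M.R x), 0 ≤ y ∧ y ≤ 1) {T : ℕ} (hT : 1 ≤ T)
    (hi : Integrable (fun ω => ‖∑ t ∈ Finset.range T,
      (M.clipIter lam η Q₀ o (t + 1) ω - M.softQStar lam)‖) μ) :
    Integrable (fun ω => ‖M.softAvg lam η Q₀ (fun t => o t ω) T - M.softQStar lam‖) μ ∧
    ∫ ω, ‖M.softAvg lam η Q₀ (fun t => o t ω) T - M.softQStar lam‖ ∂μ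
      = (T : ℝ)⁻¹ * ∫ ω, ‖∑ t ∈ Finset.range T,
          (M.clipIter lam η Q₀ o (t + 1) ω - M.softQStar lam)‖ ∂μ := by
  have hT0 : (T : ℝ) ≠ 0 := by positivity
  have h : (fun ω => ‖M.softAvg lam η Q₀ (fun t => o t ω) T - M.softQStar lam‖)
      =ᵐ[μ] fun ω => (T : ℝ)⁻¹ * ‖∑ t ∈ Finset.range T,
        (M.clipIter lam η Q₀ o (t + 1) ω - M.softQStar lam)‖ := by
    filter_upwards [ho.ae_clipIter_eq M hR (lam := lam) (η := η) (Q₀ := Q₀)] with ω hω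
    rw [← Real.norm_of_nonneg (inv_nonneg.2 (Nat.cast_nonneg T)), ← norm_smul]
    congr 1
    rw [softAvg, Finset.sum_sub_distrib, smul_sub]
    simp only [hω]
    rw [Finset.sum_const, Finset.card_range, ← Nat.cast_smul_eq_nsmul ℝ, smul_smul,
      inv_mul_cancel₀ hT0, one_smul, Finset.range_eq_Ico, Finset.sum_Ico_add' (fun t =>
        M.clipIter lam η Q₀ o t ω) 0 T 1]
    rfl
  exact ⟨(hi.const_mul _).congr h.symm, by rw [integral_congr_ae h, integral_const_mul]⟩

end ErrorProcess

end DiscountedMDP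

/-! ### Conversion of the estimates to the stated form. -/

section FinalBounds

theorem logCard_le_two_mul_log {ι : Type*} [Fintype ι] (h : 2 ≤ Fintype.card ι) :
    logCard ι ≤ 2 * Real.log (Fintype.card ι) := by
  have h2 : (2 : ℝ) ≤ Fintype.card ι := by exact_mod_cast h
  rw [logCard, Real.log_mul (by norm_num) (by linarith)]
  linarith [Real.log_le_log (by norm_num) h2]

theorem logCard_le_one_add_log {ι : Type*} [Fintype ι] (h : 2 ≤ Fintype.card ι) :
    logCard ι ≤ 1 + Real.log (Fintype.card ι) := by
  have h2 : (2 : ℝ) ≤ Fintype.card ι := by exact_mod_cast h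
  rw [logCard, Real.log_mul (by norm_num) (by linarith)]
  linarith [Real.log_two_lt_d9]

variable {L d h κ lam T v : ℝ}

/-- The exponent 3 comes from the cube of 1 + log T for linear steps; the other factors occur only
squared and are at least one after enlarging L to 1 + d. -/
theorem sq_mul_sq_mul_pow_le (hL0 : 0 ≤ L) (hL : L ≤ 1 + d) (hd : 0 ≤ d) (hh : 1 ≤ h)
    (hT : 1 ≤ T) {n : ℕ} (hn : n ≤ 3) :
    L ^ 2 * h ^ 2 * (1 + Real.log T) ^ n ≤ (h * (1 + d) * (1 + Real.log T)) ^ 3 := by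
  have hl : 1 ≤ 1 + Real.log T := by linarith [Real.log_nonneg hT]
  rw [mul_pow, mul_pow]
  have h1 : L ^ 2 ≤ (1 + d) ^ 3 := (pow_le_pow_left₀ hL0 hL 2).trans
    (pow_le_pow_right₀ (by linarith) (by norm_num))
  have h2 : h ^ 2 ≤ h ^ 3 := pow_le_pow_right₀ hh (by norm_num)
  have h3 := pow_le_pow_right₀ hl hn
  rw [mul_comm (L ^ 2)]
  gcongr

theorem sqrt_le_two_mul_sqrt (hL : L ≤ 2 * d) (hd : 0 ≤ d) : √L ≤ 2 * √d := by
  rw [Real.sqrt_le_left (by positivity), mul_pow, Real.sq_sqrt hd]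
  linarith

theorem inv_mul_sqrt_le (hL : L ≤ 2 * d) (hd : 0 ≤ d) (hv : 0 ≤ v) (hT : 0 < T) :
    T⁻¹ * √(L * (T * v)) ≤ 2 * (√v * √(d / T)) := by
  have h1 : √(L * (T * v)) ≤ T * (2 * (√v * √(d / T))) := by
    rw [Real.sqrt_le_left (by positivity), mul_pow, mul_pow, mul_pow, Real.sq_sqrt hv,
      Real.sq_sqrt (by positivity)]
    have : T ^ 2 * (2 ^ 2 * (v * (d / T))) = 4 * d * (T * v) := by field_simp; ring
    rw [this]
    have := mul_nonneg hT.le hv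
    gcongr
    linarith
  rwa [inv_mul_le_iff₀ hT]

theorem inv_rpow_le_inv_rpow (hκ : 0 < κ) (hκ1 : κ ≤ 1) {a b : ℝ} (hab : a ≤ b) :
    (κ ^ a)⁻¹ ≤ (κ ^ b)⁻¹ :=
  inv_anti₀ (Real.rpow_pos_of_pos hκ _) (Real.rpow_le_rpow_of_exponent_ge hκ hκ1 hab)

theorem poly_bound_le {α : ℝ} (h0 : 1 / 2 < α) (h1 : α < 1) (hL0 : 0 ≤ L) (hL : L ≤ 1 + d)
    (hL2 : L ≤ 2 * d) (hd : 0 ≤ d) (hh : 1 ≤ h) (hκ : 0 < κ) (hκ1 : κ < 1) (hlam : 0 < lam)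
    (hT : 1 ≤ T) (hv : 0 ≤ v) :
    T⁻¹ * (2 * √(L * (T * v)) + 36 * (√L / κ ^ 3) * T ^ (α / 2)
        + 23000 * (L ^ 2 * h ^ 2 / κ ^ 5) * (1 + 1 / lam)
          * ((1 + Real.log T) * (4 / κ) ^ (1 / (1 - α)))
        + 1080 * (1 - κ) * (L ^ 2 * h ^ 2 / κ ^ 5) * (1 + 1 / lam)
          * (1 / (1 - α) * T ^ (1 - α)))
      ≤ 2400 * (√v * √(d / T))
        + (72 + 23000 * 4 ^ (1 / (1 - α)) + 1080 * (1 / (1 - α)))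
          * (√d / κ ^ 3 * (1 / T ^ (1 - α / 2)))
        + (72 + 23000 * 4 ^ (1 / (1 - α)) + 1080 * (1 / (1 - α))) * (1 + lam)
          * (h * (1 + d) * (1 + Real.log T)) ^ 3
          * ((1 / lam) / κ ^ (3 + 2 / (1 - α)) * (1 / T)
            + (1 - κ) * (1 / lam) / κ ^ (4 + 1 / (1 - α)) * (1 / T ^ α)) := by
  have hT0 : 0 < T := by linarith
  have h1α : 0 < 1 - α := by linarith
  set s := 1 / (1 - α) with hs
  -- This is where α > 1/2 fits the powers of κ: the actual exponents 5 + s and 5 are at most 3 + 2s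
  -- and 4 + s because s ≥ 2.
  have hs2 : 2 ≤ s := by rw [hs, le_div_iff₀ h1α]; linarith
  have hl : 0 ≤ Real.log T := Real.log_nonneg hT
  set X := (h * (1 + d) * (1 + Real.log T)) ^ 3 with hX
  have hX0 : 0 ≤ X := by positivity
  have hX1 := sq_mul_sq_mul_pow_le hL0 hL hd hh hT (n := 1) (by norm_num)
  have hX2 := sq_mul_sq_mul_pow_le hL0 hL hd hh hT (n := 0) (by norm_num)
  rw [pow_one] at hX1
  rw [pow_zero, mul_one] at hX2
  have h4 : 0 < (4 : ℝ) ^ s := by positivity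
  set C := 72 + 23000 * 4 ^ s + 1080 * s with hC
  have k5 : (κ ^ 5)⁻¹ = (κ ^ (5 : ℝ))⁻¹ := by norm_cast
  have hk1 : (κ ^ 5)⁻¹ * (4 / κ) ^ s ≤ 4 ^ s * (κ ^ (3 + 2 / (1 - α)))⁻¹ := by
    have e : (κ ^ 5)⁻¹ * (4 / κ) ^ s = 4 ^ s * (κ ^ (5 + s))⁻¹ := by
      rw [Real.div_rpow (by norm_num) hκ.le, Real.rpow_add hκ, k5, mul_inv]
      ring
    rw [e]
    refine mul_le_mul_of_nonneg_left (inv_rpow_le_inv_rpow hκ hκ1.le ?_) h4.le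
    have : 2 / (1 - α) = 2 * s := by rw [hs]; ring
    linarith
  have hk2 : (κ ^ 5)⁻¹ ≤ (κ ^ (4 + s))⁻¹ := by
    rw [k5]; exact inv_rpow_le_inv_rpow hκ hκ1.le (by linarith)
  -- Explains the shape of the statement: the estimates carry 1 + 1/λ, which is split into 1/λ and
  -- the prefactor 1 + λ.
  have hl1 : 1 + 1 / lam = (1 + lam) * (1 / lam) := by field_simp; ring
  have hT1 : T⁻¹ * T ^ (α / 2) = 1 / T ^ (1 - α / 2) := by
    rw [one_div, ← Real.rpow_neg hT0.le, ← Real.rpow_neg_one, ← Real.rpow_add hT0]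
    congr 1; ring
  have hT2 : T⁻¹ * T ^ (1 - α) = 1 / T ^ α := by
    rw [one_div, ← Real.rpow_neg hT0.le, ← Real.rpow_neg_one, ← Real.rpow_add hT0]
    congr 1; ring
  have t1 := inv_mul_sqrt_le hL2 hd hv hT0
  have t2 : T⁻¹ * (36 * (√L / κ ^ 3) * T ^ (α / 2)) ≤ C * (√d / κ ^ 3 * (1 / T ^ (1 - α / 2))) := by
    have e : T⁻¹ * (36 * (√L / κ ^ 3) * T ^ (α / 2))
        = √L * (36 * (1 / κ ^ 3 * (1 / T ^ (1 - α / 2)))) := by rw [← hT1]; ring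
    have e' : C * (√d / κ ^ 3 * (1 / T ^ (1 - α / 2)))
        = (C / 36 * √d) * (36 * (1 / κ ^ 3 * (1 / T ^ (1 - α / 2)))) := by ring
    rw [e, e']
    refine mul_le_mul_of_nonneg_right ((sqrt_le_two_mul_sqrt hL2 hd).trans ?_) (by positivity)
    refine mul_le_mul_of_nonneg_right ?_ (Real.sqrt_nonneg _)
    rw [hC]
    nlinarith
  have t3 : T⁻¹ * (23000 * (L ^ 2 * h ^ 2 / κ ^ 5) * (1 + 1 / lam)
      * ((1 + Real.log T) * (4 / κ) ^ s))
      ≤ C * (1 + lam) * X * ((1 / lam) / κ ^ (3 + 2 / (1 - α)) * (1 / T)) := by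
    rw [hl1]
    calc _ = (L ^ 2 * h ^ 2 * (1 + Real.log T)) * ((κ ^ 5)⁻¹ * (4 / κ) ^ s)
          * (23000 * ((1 + lam) * (1 / lam) * T⁻¹)) := by ring
      _ ≤ X * (4 ^ s * (κ ^ (3 + 2 / (1 - α)))⁻¹)
          * (23000 * ((1 + lam) * (1 / lam) * T⁻¹)) := by gcongr
      _ = (23000 * 4 ^ s) * ((1 + lam) * X * ((1 / lam) / κ ^ (3 + 2 / (1 - α)) * (1 / T))) := by
          ring
      _ ≤ C * ((1 + lam) * X * ((1 / lam) / κ ^ (3 + 2 / (1 - α)) * (1 / T))) := by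
          refine mul_le_mul_of_nonneg_right ?_ (by positivity)
          rw [hC]; linarith
      _ = _ := by ring
  have hκ' : 0 ≤ 1 - κ := by linarith
  have t4 : T⁻¹ * (1080 * (1 - κ) * (L ^ 2 * h ^ 2 / κ ^ 5) * (1 + 1 / lam)
      * (s * T ^ (1 - α)))
      ≤ C * (1 + lam) * X * ((1 - κ) * (1 / lam) / κ ^ (4 + s) * (1 / T ^ α)) := by
    rw [hl1]
    calc _ = (L ^ 2 * h ^ 2) * (κ ^ 5)⁻¹
          * (1080 * s * ((1 - κ) * ((1 + lam) * (1 / lam)) * (T⁻¹ * T ^ (1 - α)))) := by ring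
      _ ≤ X * (κ ^ (4 + s))⁻¹
          * (1080 * s * ((1 - κ) * ((1 + lam) * (1 / lam)) * (T⁻¹ * T ^ (1 - α)))) := by gcongr
      _ = (1080 * s)
          * ((1 + lam) * X * ((1 - κ) * (1 / lam) / κ ^ (4 + s) * (1 / T ^ α))) := by
          rw [hT2]; ring
      _ ≤ C * ((1 + lam) * X * ((1 - κ) * (1 / lam) / κ ^ (4 + s) * (1 / T ^ α))) := by
          refine mul_le_mul_of_nonneg_right ?_ (by positivity)
          rw [hC]; linarith
      _ = _ := by ring
  have h5 : 0 ≤ √v * √(d / T) := by positivity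
  rw [mul_add, mul_add, mul_add, mul_add]
  linarith

theorem linear_bound_le (hL0 : 0 ≤ L) (hL : L ≤ 1 + d)
    (hL2 : L ≤ 2 * d) (hd : 0 ≤ d) (hh : 1 ≤ h) (hκ : 0 < κ) (hlam : 0 < lam)
    (hT : 1 ≤ T) (hv : 0 ≤ v) :
    T⁻¹ * (4 / κ * √(L * v) * √T
        + 2400 * (L ^ 2 * h ^ 2 / κ ^ 6) * (1 + 1 / lam) * (1 + Real.log T) ^ 3)
      ≤ 2400 * (√(v / κ ^ 2) * √(d / T))
        + 2400 * (1 + lam) * (h * (1 + d) * (1 + Real.log T)) ^ 3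
          * ((1 / lam) / κ ^ 6 * (1 / T)) := by
  have hT0 : 0 < T := by linarith
  have hX := sq_mul_sq_mul_pow_le hL0 hL hd hh hT (n := 3) le_rfl
  have hl1 : 1 + 1 / lam = (1 + lam) * (1 / lam) := by field_simp; ring
  have t1 : T⁻¹ * (4 / κ * √(L * v) * √T) ≤ 2400 * (√(v / κ ^ 2) * √(d / T)) := by
    have h1 := inv_mul_sqrt_le hL2 hd hv hT0
    have e1 : √(L * (T * v)) = √(L * v) * √T := by
      rw [← Real.sqrt_mul (mul_nonneg hL0 hv)]; congr 1; ring
    have e2 : √(v / κ ^ 2) = √v / κ := by rw [Real.sqrt_div hv, Real.sqrt_sq hκ.le]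
    rw [e1] at h1
    rw [e2]
    calc _ = 4 / κ * (T⁻¹ * (√(L * v) * √T)) := by ring
      _ ≤ 4 / κ * (2 * (√v * √(d / T))) := by gcongr
      _ = 8 * (√v / κ * √(d / T)) := by ring
      _ ≤ _ := mul_le_mul_of_nonneg_right (by norm_num) (by positivity)
  have t2 : T⁻¹ * (2400 * (L ^ 2 * h ^ 2 / κ ^ 6) * (1 + 1 / lam) * (1 + Real.log T) ^ 3)
      ≤ 2400 * (1 + lam) * (h * (1 + d) * (1 + Real.log T)) ^ 3
          * ((1 / lam) / κ ^ 6 * (1 / T)) := by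
    rw [hl1]
    calc _ = (L ^ 2 * h ^ 2 * (1 + Real.log T) ^ 3)
          * (2400 * (1 + lam) * ((1 / lam) / κ ^ 6 * (1 / T))) := by ring
      _ ≤ (h * (1 + d) * (1 + Real.log T)) ^ 3
          * (2400 * (1 + lam) * ((1 / lam) / κ ^ 6 * (1 / T))) := by gcongr
      _ = _ := by ring
  rw [mul_add]
  exact add_le_add t1 t2

end FinalBounds

theorem theorem6 :
    ∃ (c : ℝ) (k : ℕ), 0 < c ∧
      -- polynomial step sizes
      (∀ α : ℝ, 1 / 2 < α → α < 1 → ∃ C : ℝ, 0 < C ∧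
        ∀ (S : Type u) (A : Type v) [Fintype S] [Fintype A] [Nonempty A] [DecidableEq S]
          [DecidableEq A] [MeasurableSpace S] [MeasurableSingletonClass S]
          (M : DiscountedMDP S A) (lam : ℝ) (Q₀ : S × A → ℝ)
          (Ω : Type w) [MeasurableSpace Ω] (μ : Measure Ω) [IsProbabilityMeasure μ]
          (o : ℕ → Ω → S × A → ℝ × S) (T : ℕ),
          2 ≤ Fintype.card (S × A) →
          (∀ x, ∀ᵐ y ∂(M.R x), 0 ≤ y ∧ y ≤ 1) →
          0 < lam →
          M.IsSample μ o →
          1 ≤ T →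
          Integrable (fun ω => ‖M.softAvg lam (polyStep α) Q₀ (fun t => o t ω) T
            - M.softQStar lam‖) μ ∧
          ∫ ω, ‖M.softAvg lam (polyStep α) Q₀ (fun t => o t ω) T - M.softQStar lam‖ ∂μ
            ≤ c * (Real.sqrt (matInfNorm (Matrix.diagonal (M.softAsymVar lam).diag))
                  * Real.sqrt (Real.log (Fintype.card (S × A)) / T))
              + C * (Real.sqrt (Real.log (Fintype.card (S × A))) / (1 - M.γ) ^ 3
                  * (1 / (T : ℝ) ^ (1 - α / 2)))
              + C * (1 + lam) * ((1 + (1 - M.γ) * ‖Q₀ - M.softQStar lam‖)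
                  * (1 + Real.log (Fintype.card (S × A))) * (1 + Real.log T)) ^ k
                * ((1 / lam) / (1 - M.γ) ^ (3 + 2 / (1 - α)) * (1 / T)
                  + M.γ * (1 / lam) / (1 - M.γ) ^ (4 + 1 / (1 - α)) * (1 / (T : ℝ) ^ α))) ∧
      -- linearly rescaled step sizes
      (∀ (S : Type u) (A : Type v) [Fintype S] [Fintype A] [Nonempty A] [DecidableEq S]
          [DecidableEq A] [MeasurableSpace S] [MeasurableSingletonClass S]
          (M : DiscountedMDP S A) (lam : ℝ) (Q₀ : S × A → ℝ)
          (Ω : Type w) [MeasurableSpace Ω] (μ : Measure Ω) [IsProbabilityMeasure μ]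
          (o : ℕ → Ω → S × A → ℝ × S) (T : ℕ),
          2 ≤ Fintype.card (S × A) →
          (∀ x, ∀ᵐ y ∂(M.R x), 0 ≤ y ∧ y ≤ 1) →
          0 < lam →
          M.IsSample μ o →
          1 ≤ T →
          Integrable (fun ω => ‖M.softAvg lam (linStep M.γ) Q₀ (fun t => o t ω) T
            - M.softQStar lam‖) μ ∧
          ∫ ω, ‖M.softAvg lam (linStep M.γ) Q₀ (fun t => o t ω) T - M.softQStar lam‖ ∂μ
            ≤ c * (Real.sqrt (matInfNorm (M.softNoiseVar lam) / (1 - M.γ) ^ 2)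
                  * Real.sqrt (Real.log (Fintype.card (S × A)) / T))
              + c * (1 + lam) * ((1 + (1 - M.γ) * ‖Q₀ - M.softQStar lam‖)
                  * (1 + Real.log (Fintype.card (S × A))) * (1 + Real.log T)) ^ k
                * ((1 / lam) / (1 - M.γ) ^ 6 * (1 / T))) := by
  -- The leading terms need only 4 and 8; 2400 is the remainder constant for linear steps, which
  -- shares c. In C, 4^{1/(1-α)} stems from the burn-in time and 1/(1-α) from summing t^{-α}.
  refine ⟨2400, 3, by norm_num, fun α h0 h1 =>
    ⟨72 + 23000 * 4 ^ (1 / (1 - α)) + 1080 * (1 / (1 - α)), ?_, ?_⟩, ?_⟩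
  · have : 0 < 1 - α := by linarith
    positivity
  · intro S A _ _ _ _ _ _ _ M lam Q₀ Ω _ μ _ o T hcard hR hlam ho hT
    have : Nonempty (S × A) := Fintype.card_pos_iff.1 (by omega)
    have hη := isStepSeq_polyStep (α := α) (by linarith) h1.le
    have hP := ho.isPerturbedIter M hR hlam (fun t => (hη.pos t).le) hη.le_one Q₀
    have hκ := M.one_sub_pos
    have hT' : (1 : ℝ) ≤ T := by exact_mod_cast hT
    have hv0 := matInfNorm_nonneg (Matrix.diagonal (M.softAsymVar lam).diag)
    have hd : 0 ≤ Real.log (Fintype.card (S × A)) := Real.log_natCast_nonneg _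
    have hb := hP.poly_average_le hcard h0 h1 hv0
      (ho.weightedVarLe_resolvent_softNoise M hR hlam) hT
    obtain ⟨hint, heq⟩ := ho.integral_norm_softAvg_sub M hR hT (hP.integrable_sum T)
    refine ⟨hint, ?_⟩
    rw [heq]
    refine (mul_le_mul_of_nonneg_left hb (by positivity)).trans ?_
    have := poly_bound_le h0 h1 (zero_le_one.trans (one_le_logCard hcard))
      (logCard_le_one_add_log hcard) (logCard_le_two_mul_log hcard) hd hP.one_le_scale hκ
      hP.rate_lt_one hlam hT' hv0
    rwa [sub_sub_cancel] at this ⊢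
  · intro S A _ _ _ _ _ _ _ M lam Q₀ Ω _ μ _ o T hcard hR hlam ho hT
    have : Nonempty (S × A) := Fintype.card_pos_iff.1 (by omega)
    have hκ := M.one_sub_pos
    have hη : IsLinearStep (1 - M.γ) (linStep M.γ) :=
      ⟨hκ, by linarith [M.γ_pos], fun t => rfl⟩
    have hP := ho.isPerturbedIter M hR hlam (fun t => (hη.isStepSeq.pos t).le)
      hη.isStepSeq.le_one Q₀
    have hT' : (1 : ℝ) ≤ T := by exact_mod_cast hT
    have hv0 := matInfNorm_nonneg (M.softNoiseVar lam)
    have hd : 0 ≤ Real.log (Fintype.card (S × A)) := Real.log_natCast_nonneg _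
    have hb := hP.linear_average_le hη hcard hv0 (ho.weightedVarLe_softNoise M hR hlam) T
    obtain ⟨hint, heq⟩ := ho.integral_norm_softAvg_sub M hR hT (hP.integrable_sum T)
    refine ⟨hint, ?_⟩
    rw [heq]
    refine (mul_le_mul_of_nonneg_left hb (by positivity)).trans ?_
    exact linear_bound_le (zero_le_one.trans (one_le_logCard hcard))
      (logCard_le_one_add_log hcard) (logCard_le_two_mul_log hcard) hd hP.one_le_scale hκ
      hlam hT' hv0
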